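/- Let $g \ge 1$ and let $W \subset S_{2g}$ be the Weyl group of $\mathrm{GSp}_{2g}$, i.e. the centralizer of $\theta = (1\ 2g)(2\ 2g-1)\cdots(g\ g+1)$. Let $X_*(T) = \{v \in \mathbb{Z}^{2g} : v(1)+v(2g) = v(2)+v(2g-1) = \cdots = v(g)+v(g+1)\}$, let $\widetilde W = X_*(T) \rtimes W$ be the extended affine Weyl group of $\mathrm{GSp}_{2g}$, where $W$ acts by $(wv)(i) = v(w^{-1}(i))$, and write its elements as $t^{x_0} w$ with $x_0 \in X_*(T)$, $w \in W$. Let $Q^\vee$ be the coroot lattice and $W_a = Q^\vee \rtimes W$ the affine Weyl group, a Coxeter group with simple reflections $s_0 = t^{(-1,0,\ldots,0,1)}(1\ 2g)$, $s_{i,i+1} = (i\ i+1)(2g-i\ 2g-i+1)$ for $1 \le i \le g-1$, and $s_g = (g\ g+1)$. Let $\Omega \subset \widetilde W$ be the stabilizer of the base alcove $\{v \in X_*(T)_{\mathbb R} : -1 < \langle \beta, v\rangle < 0 \text{ for all positive roots } \beta\}$, where the positive roots are the restrictions to $T$ of $e_i^* - e_j^*$ for $1 \le i<j \le 2g$, with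 $e_i^*$ the $i$-th coordinate. Then $\widetilde W = \Omega W_a$, with unique decompositions; for $c, c' \in \Omega$ and $w, w' \in W_a$ put $\ell(cw) = \ell(w)$, and let $cw \le c'w'$ if and only if $c = c'$ and $w \le w'$ in the Bruhat order of $W_a$. Let $\mu = (1,\ldots,1,0,\ldots,0)$ ($g$ ones followed by $g$ zeros), and let $\mathrm{Adm}(\mu)$ be the set of $x \in \widetilde W$ such that $x \le t^{w(\mu)}$ for some $w \in W$. For $0 \le d \le g$ let $\mathrm{Adm}(\mu)^{(d)}$ be the set of $x = t^{x_0} w \in \mathrm{Adm}(\mu)$ such that $w$ has exactly $d$ fixed points in $\{1,\ldots,g\}$ (equivalently, such that the $p$-rank on the Kottwitz-Rapoport stratum attached to $x$ is $d$), and let $M^{(d)}$ be the set of elements of maximal length in $\mathrm{Adm}(\mu)^{(d)}$, i.e. of those $x \in \mathrm{Adm}(\mu)^{(d)}$ with $\ell(x) = \max_{x' \in \mathrm{Adm}(\mu)^{(d)}} \ell(x')$. Let $C_n = \frac{1}{n+1}\binom{2n}{n}$ be the $n$-th Catalan number. Then for all $0 \le d \le g$ the set $M^{(d)}$ is finite and: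 1. if $g-d$ is even, then $\# M^{(d)} = 2^d \cdot \binom{g}{d} \cdot C_{(g-d)/2}$; 2. if $g-d$ is odd, then $\# M^{(d)} = 2^d \cdot \binom{g}{d} \cdot \frac{g-d+1}{2} \cdot C_{(g-d+1)/2}$. -/

import Mathlib

namespace GSpWeyl

/-! Indices `1, …, 2g` are represented by `Fin (2 * g)`, so the index `i` of the mathematical text
is `i - 1` here and `i ↦ 2g + 1 - i` is `Fin.rev`. -/

/-- The extended affine Weyl group `ℤ^{2g} ⋊ S_{2g}` of `GL_{2g}`. The group `S_{2g}` acts by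
`(w • v) i = v (w⁻¹ i)`; translations are written multiplicatively. -/
abbrev GLExtAffineWeyl (g : ℕ) : Type :=
  (Fin (2 * g) → Multiplicative ℤ) ⋊[mulAutArrow] Equiv.Perm (Fin (2 * g))

/-- The cocharacter `x₀` of `x = t^{x₀} w`. -/
def transPart {g : ℕ} (x : GLExtAffineWeyl g) : Fin (2 * g) → ℤ :=
  fun i => Multiplicative.toAdd (x.left i)

/-- The permutation `w` of `x = t^{x₀} w`. -/
def permPart {g : ℕ} (x : GLExtAffineWeyl g) : Equiv.Perm (Fin (2 * g)) := x.right

/-- The element `t^v w`. -/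
def mkElt {g : ℕ} (v : Fin (2 * g) → ℤ) (w : Equiv.Perm (Fin (2 * g))) : GLExtAffineWeyl g :=
  ⟨fun i => Multiplicative.ofAdd (v i), w⟩

/-- The (finite) Weyl group `W` of `GSp_{2g}`: the centralizer of
`θ = (1 2g)(2 2g-1)⋯(g g+1)` in `S_{2g}`. -/
def weyl (g : ℕ) : Subgroup (Equiv.Perm (Fin (2 * g))) :=
  Subgroup.centralizer {Fin.revPerm}

/-- The cocharacter lattice `X_*(T)` of the diagonal torus of `GSp_{2g}`. -/
def cochar (g : ℕ) : AddSubgroup (Fin (2 * g) → ℤ) where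
  carrier := {v | ∃ c : ℤ, ∀ i, v i + v i.rev = c}
  zero_mem' := ⟨0, fun i => by simp⟩
  add_mem' := by
    rintro a b ⟨c, hc⟩ ⟨d, hd⟩
    refine ⟨c + d, fun i => ?_⟩
    have h1 := hc i
    have h2 := hd i
    simp only [Pi.add_apply]
    linarith
  neg_mem' := by
    rintro a ⟨c, hc⟩
    refine ⟨-c, fun i => ?_⟩
    have h1 := hc i
    simp only [Pi.neg_apply]
    linarith

/-- The coroots of `GSp_{2g}`. The roots are the restrictions to `T` of the roots
`e_i^* - e_j^*`, `i ≠ j`, of `GL_{2g}`; the pairs `(i, j)` and `(2g+1-j, 2g+1-i)` give the same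
root. The coroot is `e_i - e_{2g+1-i}` if `j = 2g+1-i` (long roots `±(2e_i^* - c)`), and
`e_i - e_j + e_{2g+1-j} - e_{2g+1-i}` otherwise. -/
def coroots (g : ℕ) : Set (Fin (2 * g) → ℤ) :=
  {v | ∃ i : Fin (2 * g), v = Pi.single i 1 - Pi.single i.rev 1} ∪
  {v | ∃ i j : Fin (2 * g), i ≠ j ∧ j ≠ i.rev ∧
    v = Pi.single i 1 - Pi.single j 1 + Pi.single j.rev 1 - Pi.single i.rev 1}

/-- The coroot lattice `Q^∨`. -/
def corootLattice (g : ℕ) : AddSubgroup (Fin (2 * g) → ℤ) := AddSubgroup.closure (coroots g)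

/-- The extended affine Weyl group `X_*(T) ⋊ W` of `GSp_{2g}`, inside that of `GL_{2g}`. -/
def extAffineWeyl (g : ℕ) : Set (GLExtAffineWeyl g) :=
  {x | transPart x ∈ cochar g ∧ permPart x ∈ weyl g}

/-- The affine Weyl group `W_a = Q^∨ ⋊ W` of `GSp_{2g}`. -/
def affineWeyl (g : ℕ) : Set (GLExtAffineWeyl g) :=
  {x | transPart x ∈ corootLattice g ∧ permPart x ∈ weyl g}

/-- The simple affine reflections
`s_0 = t^{(-1, 0, …, 0, 1)} (1 2g)`, `s_{i,i+1} = (i i+1)(2g-i 2g-i+1)` for `1 ≤ i ≤ g - 1`, and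
`s_g = (g g+1)`. -/
def simpleReflections (g : ℕ) : Set (GLExtAffineWeyl g) :=
  {s | ∃ i : Fin (2 * g), i.val = 0 ∧
    s = mkElt (Pi.single i.rev 1 - Pi.single i 1) (Equiv.swap i i.rev)} ∪
  {s | ∃ i j : Fin (2 * g), i.val + 1 = j.val ∧ j.val < g ∧
    s = mkElt 0 (Equiv.swap i j * Equiv.swap i.rev j.rev)} ∪
  {s | ∃ i : Fin (2 * g), i.val + 1 = g ∧ s = mkElt 0 (Equiv.swap i i.rev)}

/-- The affine transformation `v ↦ w v + x₀` of `ℝ^{2g}` given by `x = t^{x₀} w`. -/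
def affineAct {g : ℕ} (x : GLExtAffineWeyl g) (v : Fin (2 * g) → ℝ) : Fin (2 * g) → ℝ :=
  fun i => (transPart x i : ℝ) + v ((permPart x)⁻¹ i)

/-- The base alcove in `X_*(T)_ℝ`, lying in the antidominant chamber: the set of `v` with
`-1 < ⟨β, v⟩ < 0` for all positive roots `β`, these being the restrictions of `e_i^* - e_j^*`
for `i < j`. -/
def baseAlcove (g : ℕ) : Set (Fin (2 * g) → ℝ) :=
  {v | (∃ c : ℝ, ∀ i, v i + v i.rev = c) ∧ ∀ i j, i < j → -1 < v i - v j ∧ v i - v j < 0}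

/-- The subgroup `Ω` of the extended affine Weyl group fixing the base alcove. -/
def omega (g : ℕ) : Set (GLExtAffineWeyl g) :=
  {x | x ∈ extAffineWeyl g ∧ affineAct x '' baseAlcove g = baseAlcove g}

/-- The length on `W_a` with respect to the simple affine reflections. -/
noncomputable def affineLength {g : ℕ} (x : GLExtAffineWeyl g) : ℕ :=
  sInf {n | ∃ l : List (GLExtAffineWeyl g),
    (∀ s ∈ l, s ∈ simpleReflections g) ∧ l.prod = x ∧ l.length = n}

/-- The reflections of the Coxeter group `W_a`: conjugates of simple affine reflections. -/
def reflections (g : ℕ) : Set (GLExtAffineWeyl g) :=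
  {r | ∃ u ∈ affineWeyl g, ∃ s ∈ simpleReflections g, r = u * s * u⁻¹}

/-- The Bruhat order on `W_a`: the reflexive transitive closure of `u < r u`, where `r` is a
reflection with `ℓ(u) < ℓ(r u)`. -/
def affineBruhatLE {g : ℕ} (u v : GLExtAffineWeyl g) : Prop :=
  Relation.ReflTransGen
    (fun a b => ∃ r ∈ reflections g, b = r * a ∧ affineLength a < affineLength b) u v

/-- The length on the extended affine Weyl group `Ω W_a`: `ℓ(c w) = ℓ(w)` for `c ∈ Ω` and
`w ∈ W_a` (this decomposition of an element is unique). -/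
noncomputable def length {g : ℕ} (x : GLExtAffineWeyl g) : ℕ :=
  sInf {n | ∃ c ∈ omega g, ∃ w ∈ affineWeyl g, x = c * w ∧ n = affineLength w}

/-- The Bruhat order on the extended affine Weyl group: `c₁ w₁ ≤ c₂ w₂` iff `c₁ = c₂` and
`w₁ ≤ w₂`, where `c₁, c₂ ∈ Ω` and `w₁, w₂ ∈ W_a`. -/
def bruhatLE {g : ℕ} (x y : GLExtAffineWeyl g) : Prop :=
  ∃ c ∈ omega g, ∃ w₁ ∈ affineWeyl g, ∃ w₂ ∈ affineWeyl g,
    x = c * w₁ ∧ y = c * w₂ ∧ affineBruhatLE w₁ w₂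

/-- The cocharacter `μ = (1, …, 1, 0, …, 0)` with `g` ones and `g` zeros. -/
def mu (g : ℕ) : Fin (2 * g) → ℤ := fun i => if i.val < g then 1 else 0

/-- The `μ`-admissible set `Adm(μ)`: the elements `x` of the extended affine Weyl group with
`x ≤ t^{w(μ)}` for some `w ∈ W`. -/
def adm (g : ℕ) : Set (GLExtAffineWeyl g) :=
  {x | x ∈ extAffineWeyl g ∧ ∃ w ∈ weyl g, bruhatLE x (mkElt (fun i => mu g (w⁻¹ i)) 1)}

/-- The `p`-rank attached to `x = t^{x₀} w`: the number of `1 ≤ i ≤ g` with `w(i) = i`. -/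
def pRank {g : ℕ} (x : GLExtAffineWeyl g) : ℕ :=
  (Finset.univ.filter (fun i : Fin (2 * g) => i.val < g ∧ permPart x i = i)).card

/-- `Adm(μ)^{(d)}`, the `μ`-admissible elements of `p`-rank `d`. -/
def admRank (g d : ℕ) : Set (GLExtAffineWeyl g) := {x | x ∈ adm g ∧ pRank x = d}

/-- `M^{(d)}`, the elements of maximal length in `Adm(μ)^{(d)}`. -/
def maxLengthSet (g d : ℕ) : Set (GLExtAffineWeyl g) :=
  {x | x ∈ admRank g d ∧ ∀ y ∈ admRank g d, length y ≤ length x}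

end GSpWeyl

namespace GSpWeyl

/-! ### Affine permutations of ℤ attached to group elements -/

section AffinePermutations

variable {g : ℕ}

/-! An element x is replaced by a permutation F of ℤ with F(m + 2g) = F(m) + 2g (`aperm`), which
records the image under x of the base alcove point with coordinates i/2g. Membership in the group
for `GSp` becomes F(-1 - m) = 2gc - 1 - F(m), with c = 0 on the affine Weyl group. Left
multiplication permutes arguments, simple reflections exchange adjacent arguments (with their mirror
images), and twice the length is a weighted number of inversions (`two_mul_affineLength`). Elements
of Ω are the shifts m ↦ m + gc, and all of Adm(μ) lies in the component c = 1, that of `tau`.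

Admissibility amounts to m ≤ F(m) ≤ m + 2g (`mem_adm_iff`). These bounds survive when an inversion
is undone, and a pigeonhole argument shows that any F within them that is not a translation can be
raised in the Bruhat order while respecting them. On one period such an F is a permutation σ
together with the set S of indices that are not shifted by 2g: a symmetric decorated permutation,
drawn as up arcs from S and down arcs from its complement.

Counting inversions by arcs, the nestings cancel and 2ℓ = g(g + 1) - (g - d) - excess - 2 ·
crossings, where the excess counts, in the lower half, the indices with both arcs in the same
direction and the arcs over the axis. As g(g + 1) is even, the excess is congruent to g - d modulo
2, so the maximal length is reached exactly without crossings and with excess e equal to the parity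
of g - d, once such configurations exist.

Without crossings, (σ, S) is determined by local data at the indices below the axis, that is, by a
word of length g. Its d fixed letters, each with two decorations, contribute 2^d binom(g, d). The
rest is a path of length g - d from height 0 with up steps, down steps, and two-colored level steps
at positive height, where the final height plus the number of level steps is e. For e = 0 these are
Dyck paths. For e = 1, marking a vertex of a Dyck path gives (k + 1) C_{k+1} with g - d = 2k + 1. -/

theorem transPart_mul (x y : GLExtAffineWeyl g) (i : Fin (2 * g)) :
    transPart (x * y) i = transPart x i + transPart y ((permPart x)⁻¹ i) := rfl

theorem permPart_mul (x y : GLExtAffineWeyl g) :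
    permPart (x * y) = permPart x * permPart y := rfl

theorem ext_parts {x y : GLExtAffineWeyl g} (h : transPart x = transPart y)
    (h' : permPart x = permPart y) : x = y :=
  SemidirectProduct.ext h h'

theorem rev_val_int (i : Fin (2 * g)) : ((i.rev : ℕ) : ℤ) = 2 * g - 1 - i := by
  rw [Fin.val_rev]
  have := i.isLt
  omega

theorem mem_weyl_iff (w : Equiv.Perm (Fin (2 * g))) : w ∈ weyl g ↔ ∀ i, w i.rev = (w i).rev := by
  rw [weyl, Subgroup.mem_centralizer_singleton_iff]
  constructor
  · intro h i
    exact (congrArg (fun f : Equiv.Perm (Fin (2 * g)) => f i) h)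
  · intro h
    ext1 i
    exact h i

/-- The coroots of the long roots alone already generate: v is the sum over the lower half of its
coordinates times these. -/
theorem mem_corootLattice_iff (v : Fin (2 * g) → ℤ) :
    v ∈ corootLattice g ↔ ∀ i, v i + v i.rev = 0 := by
  constructor
  · intro h
    induction h using AddSubgroup.closure_induction with
    | mem v hv =>
      intro k
      rcases hv with ⟨i, rfl⟩ | ⟨i, j, -, -, rfl⟩
      · simp only [Pi.sub_apply, Pi.single_apply, Fin.rev_eq_iff, Fin.rev_rev]
        ring
      · simp only [Pi.sub_apply, Pi.add_apply, Pi.single_apply, Fin.rev_eq_iff, Fin.rev_rev]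
        ring
    | zero => simp
    | add a b _ _ ha hb =>
      intro k
      have := ha k
      have := hb k
      simp only [Pi.add_apply]
      linarith
    | neg a _ ha =>
      intro k
      have := ha k
      simp only [Pi.neg_apply]
      linarith
  · intro h
    have hv : v = ∑ i ∈ Finset.univ.filter (fun i : Fin (2 * g) => i.val < g),
        v i • (Pi.single i 1 - Pi.single i.rev 1 : Fin (2 * g) → ℤ) := by
      ext k
      simp only [Finset.sum_apply, Pi.smul_apply, Pi.sub_apply, Pi.single_apply, smul_eq_mul,
        mul_sub, Finset.sum_sub_distrib, mul_ite, mul_one, mul_zero]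
      have e : ∀ i : Fin (2 * g), (k = i.rev) = (k.rev = i) := fun i => by
        rw [← Fin.rev_eq_iff]
      simp only [e, Finset.sum_ite_eq, Finset.mem_filter, Finset.mem_univ, true_and, Fin.val_rev]
      have := h k
      have := k.isLt
      by_cases hk : k.val < g
      · rw [if_pos hk, if_neg (by omega)]
        ring
      · rw [if_neg hk, if_pos (by omega)]
        linarith
    rw [hv]
    refine AddSubgroup.sum_mem _ fun i _ => AddSubgroup.zsmul_mem _ ?_ _
    exact AddSubgroup.subset_closure (Or.inl ⟨i, rfl⟩)

variable [NeZero g]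

theorem two_mul_pos : (0 : ℤ) < 2 * g := by
  have := NeZero.pos g
  omega

/-- The residue of an integer modulo `2g`, as an index. -/
def res (g : ℕ) [NeZero g] (m : ℤ) : Fin (2 * g) :=
  ⟨(m % (2 * g : ℤ)).toNat, by
    have h := two_mul_pos (g := g)
    have h1 := Int.emod_nonneg m h.ne'
    have h2 := Int.emod_lt_of_pos m h
    omega⟩

theorem res_val (m : ℤ) : ((res g m).val : ℤ) = m % (2 * g : ℤ) := by
  have h := two_mul_pos (g := g)
  have h1 := Int.emod_nonneg m h.ne'
  simp only [res]
  omega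

theorem res_add (i : Fin (2 * g)) (k : ℤ) : res g (i + 2 * g * k) = i := by
  apply Fin.ext
  have h1 := res_val (g := g) (i + 2 * g * k)
  have h2 : ((i : ℤ) + 2 * g * k) % (2 * g) = i := by
    rw [Int.add_mul_emod_self_left]
    exact Int.emod_eq_of_lt (by omega) (by have := i.isLt; omega)
  omega

theorem res_decomp (m : ℤ) : m = (res g m : ℕ) + 2 * g * (m / (2 * g)) := by
  rw [res_val, Int.emod_add_mul_ediv]

theorem exists_res (m : ℤ) : ∃ (i : Fin (2 * g)) (k : ℤ), m = i + 2 * g * k :=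
  ⟨_, _, res_decomp m⟩

theorem add_ediv (i : Fin (2 * g)) (k : ℤ) : ((i : ℤ) + 2 * g * k) / (2 * g) = k := by
  have h := two_mul_pos (g := g)
  rw [Int.add_mul_ediv_left _ _ h.ne', Int.ediv_eq_zero_of_lt (by omega) (by have := i.isLt; omega)]
  simp

/-- The affine permutation of `ℤ` given by the action on the regular point with coordinates
`i / 2g`, scaled by `2g`. -/
def aperm (x : GLExtAffineWeyl g) (m : ℤ) : ℤ :=
  ((permPart x)⁻¹ (res g m) : ℕ) + 2 * g * (transPart x (res g m) + m / (2 * g))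

theorem aperm_coe (x : GLExtAffineWeyl g) (i : Fin (2 * g)) (k : ℤ) :
    aperm x (i + 2 * g * k) = ((permPart x)⁻¹ i : ℕ) + 2 * g * (transPart x i + k) := by
  rw [aperm, res_add, add_ediv]

theorem aperm_coe_zero (x : GLExtAffineWeyl g) (i : Fin (2 * g)) :
    aperm x i = ((permPart x)⁻¹ i : ℕ) + 2 * g * transPart x i := by
  simpa using aperm_coe x i 0

theorem aperm_add (x : GLExtAffineWeyl g) (m k : ℤ) :
    aperm x (m + 2 * g * k) = aperm x m + 2 * g * k := by
  obtain ⟨i, l, rfl⟩ := exists_res (g := g) m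
  rw [show (i : ℤ) + 2 * g * l + 2 * g * k = i + 2 * g * (l + k) by ring, aperm_coe, aperm_coe]
  ring

/-- The order is reversed because `aperm` uses the inverse permutation. Hence left multiplication
acts on the arguments of the affine permutation. -/
theorem aperm_mul (x y : GLExtAffineWeyl g) (m : ℤ) :
    aperm (x * y) m = aperm y (aperm x m) := by
  obtain ⟨i, l, rfl⟩ := exists_res (g := g) m
  rw [aperm_coe, aperm_coe, aperm_coe, transPart_mul, permPart_mul]
  simp only [mul_inv_rev, Equiv.Perm.mul_apply]
  ring

theorem aperm_one (m : ℤ) : aperm (1 : GLExtAffineWeyl g) m = m := by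
  obtain ⟨i, l, rfl⟩ := exists_res (g := g) m
  rw [aperm_coe]
  change ((i : ℕ) : ℤ) + 2 * g * (0 + l) = _
  ring

theorem aperm_inv_apply (x : GLExtAffineWeyl g) (m : ℤ) : aperm x⁻¹ (aperm x m) = m := by
  rw [← aperm_mul, mul_inv_cancel, aperm_one]

theorem aperm_apply_inv (x : GLExtAffineWeyl g) (m : ℤ) : aperm x (aperm x⁻¹ m) = m := by
  rw [← aperm_mul, inv_mul_cancel, aperm_one]

theorem aperm_injective (x : GLExtAffineWeyl g) : Function.Injective (aperm x) :=
  Function.LeftInverse.injective (aperm_inv_apply x)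

theorem aperm_ext {x y : GLExtAffineWeyl g} (h : ∀ m, aperm x m = aperm y m) : x = y := by
  have hN := two_mul_pos (g := g)
  have key : ∀ i, (permPart x)⁻¹ i = (permPart y)⁻¹ i ∧ transPart x i = transPart y i := by
    intro i
    have h1 := h i
    rw [aperm_coe_zero, aperm_coe_zero] at h1
    have h2 := congrArg (res g) h1
    rw [res_add, res_add] at h2
    refine ⟨h2, ?_⟩
    rw [h2] at h1
    exact mul_left_cancel₀ hN.ne' (add_left_cancel h1)
  refine ext_parts (funext fun i => (key i).2) ?_
  exact inv_injective (Equiv.ext fun i => (key i).1)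

/-- Sums over a period are invariant under affine permutations. -/
theorem sum_aperm {M : Type*} [AddCommMonoid M] (x : GLExtAffineWeyl g) (φ : ℤ → M)
    (hφ : ∀ m k, φ (m + 2 * g * k) = φ m) :
    ∑ i : Fin (2 * g), φ (aperm x i) = ∑ i : Fin (2 * g), φ i := by
  simp_rw [aperm_coe_zero, hφ]
  exact Equiv.sum_comp (permPart x)⁻¹ (fun i : Fin (2 * g) => φ i)

/-! ### Similitudes -/

/-- The affine permutations of similitude `c`. -/
def HasSim (x : GLExtAffineWeyl g) (c : ℤ) : Prop :=
  ∀ m, aperm x (-1 - m) = 2 * g * c - 1 - aperm x m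

theorem HasSim.mul {x y : GLExtAffineWeyl g} {c d : ℤ} (hx : HasSim x c) (hy : HasSim y d) :
    HasSim (x * y) (c + d) := by
  intro m
  rw [aperm_mul, aperm_mul, hx, show 2 * g * c - 1 - aperm x m = -1 - aperm x m + 2 * g * c by ring,
    aperm_add, hy]
  ring

theorem hasSim_one : HasSim (1 : GLExtAffineWeyl g) 0 := by
  intro m
  simp [aperm_one]

theorem HasSim.inv {x : GLExtAffineWeyl g} {c : ℤ} (hx : HasSim x c) : HasSim x⁻¹ (-c) := by
  intro m
  apply aperm_injective x
  rw [aperm_apply_inv, show 2 * g * -c - 1 - aperm x⁻¹ m = -1 - aperm x⁻¹ m + 2 * g * -c by ring,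
    aperm_add, hx, aperm_apply_inv]
  ring

/-- With indices starting at 0, `Fin.rev` is m ↦ -1 - m modulo 2g, so the functional equation splits
into a condition on quotients and one on residues. -/
theorem hasSim_iff (x : GLExtAffineWeyl g) (c : ℤ) :
    HasSim x c ↔ (∀ i, transPart x i + transPart x i.rev = c) ∧ permPart x ∈ weyl g := by
  have hN := two_mul_pos (g := g)
  have hw : permPart x ∈ weyl g ↔ ∀ i, (permPart x)⁻¹ i.rev = ((permPart x)⁻¹ i).rev := by
    rw [← mem_weyl_iff, inv_mem_iff]
  rw [hw]
  have h1 : ∀ (i : Fin (2 * g)) (k : ℤ), -1 - ((i : ℤ) + 2 * g * k) = (i.rev : ℕ) + 2 * g * (-1 - k) := by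
    intro i k
    rw [rev_val_int]
    ring
  constructor
  · intro h
    have h2 : ∀ i, (permPart x)⁻¹ i.rev = ((permPart x)⁻¹ i).rev := by
      intro i
      have h3 := h i
      have h4 := h1 i 0
      rw [mul_zero, add_zero] at h4
      rw [h4, aperm_coe, aperm_coe_zero] at h3
      have h5 : (((permPart x)⁻¹ i.rev : ℕ) : ℤ) + 2 * g * (transPart x i.rev + (-1 - 0)) =
          (((permPart x)⁻¹ i).rev : ℕ) + 2 * g * (c - 1 - transPart x i) := by
        rw [h3, rev_val_int]
        ring
      have h6 := congrArg (res g) h5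
      rwa [res_add, res_add] at h6
    refine ⟨fun i => ?_, h2⟩
    have h3 := h i
    have h4 := h1 i 0
    rw [mul_zero, add_zero] at h4
    rw [h4, aperm_coe, aperm_coe_zero, h2, rev_val_int] at h3
    apply mul_left_cancel₀ hN.ne'
    linarith
  · rintro ⟨h2, h3⟩ m
    obtain ⟨i, k, rfl⟩ := exists_res (g := g) m
    rw [h1, aperm_coe, aperm_coe, h3, rev_val_int, ← h2 i]
    ring

theorem mem_extAffineWeyl_iff (x : GLExtAffineWeyl g) : x ∈ extAffineWeyl g ↔ ∃ c, HasSim x c := by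
  simp only [hasSim_iff]
  constructor
  · rintro ⟨⟨c, hc⟩, hw⟩
    exact ⟨c, hc, hw⟩
  · rintro ⟨c, hc, hw⟩
    exact ⟨⟨c, hc⟩, hw⟩

theorem mem_affineWeyl_iff (x : GLExtAffineWeyl g) : x ∈ affineWeyl g ↔ HasSim x 0 := by
  rw [hasSim_iff, ← mem_corootLattice_iff]
  rfl

/-- Every affine permutation of similitude `0` comes from the affine Weyl group. -/
theorem exists_aperm_eq (R : ℤ → ℤ) (h1 : ∀ m k, R (m + 2 * g * k) = R m + 2 * g * k)
    (h2 : ∀ m, R (R m) = m) (h3 : ∀ m, R (-1 - m) = -1 - R m) :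
    ∃ r ∈ affineWeyl g, ∀ m, aperm r m = R m := by
  have h4 : ∀ i : Fin (2 * g), res g (R (res g (R i))) = i := by
    intro i
    have h5 := res_decomp (g := g) (R i)
    have h6 : R (res g (R i) : ℕ) = i + 2 * g * (- (R i / (2 * g))) := by
      have h7 : ((res g (R i) : ℕ) : ℤ) = R i + 2 * g * (-(R i / (2 * g))) := by linarith
      rw [h7, h1, h2]
    rw [h6, res_add]
  let w : Equiv.Perm (Fin (2 * g)) :=
    ⟨fun i => res g (R i), fun i => res g (R i), h4, h4⟩
  have hr : ∀ m, aperm (mkElt (fun i : Fin (2 * g) => R i / (2 * g)) w) m = R m := by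
    intro m
    obtain ⟨i, k, rfl⟩ := exists_res (g := g) m
    rw [aperm_coe, h1]
    change ((res g (R i) : ℕ) : ℤ) + 2 * g * (R i / (2 * g) + k) = _
    rw [mul_add, ← add_assoc, ← res_decomp]
  refine ⟨_, (mem_affineWeyl_iff _).2 ?_, hr⟩
  intro m
  rw [hr, hr, h3]
  ring

end AffinePermutations

end GSpWeyl

namespace GSpWeyl

/-! ### Simple reflections as exchanges of adjacent integers -/

section SimpleReflections

/-- The affine permutation exchanging `t` and `t + 1`, as well as `-2 - t` and `-1 - t`, modulo
`2g`. -/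
def adjSwap (g : ℕ) (t m : ℤ) : ℤ :=
  if 2 * (g : ℤ) ∣ m - t ∨ 2 * (g : ℤ) ∣ m + t + 2 then m + 1
  else if 2 * (g : ℤ) ∣ m - t - 1 ∨ 2 * (g : ℤ) ∣ m + t + 1 then m - 1 else m

/-- The residues raised by `adjSwap`. -/
def Raised (g : ℕ) (t m : ℤ) : Prop := 2 * (g : ℤ) ∣ m - t ∨ 2 * (g : ℤ) ∣ m + t + 2

variable {g : ℕ}

/-- Both t and its mirror -2 - t have the same parity, and 2g is even. This is what keeps raised and
lowered residues apart. -/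
theorem Raised.parity {t m : ℤ} (h : Raised g t m) : 2 ∣ m - t := by
  rcases h with ⟨a, ha⟩ | ⟨a, ha⟩ <;> rw [mul_assoc] at ha <;> omega

theorem Raised.not_raised_pred {t m : ℤ} (h : Raised g t m) : ¬ Raised g t (m - 1) := by
  intro h'
  have := h.parity
  have := h'.parity
  omega

theorem adjSwap_of_raised {t m : ℤ} (h : Raised g t m) : adjSwap g t m = m + 1 := if_pos h

theorem adjSwap_of_raised_pred {t m : ℤ} (h : Raised g t (m - 1)) : adjSwap g t m = m - 1 := by
  rw [adjSwap, if_neg, if_pos]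
  · exact h.imp (fun h => by convert h using 1; ring) (fun h => by convert h using 1; ring)
  · intro h'
    exact Raised.not_raised_pred h' h

theorem adjSwap_of_not {t m : ℤ} (h : ¬ Raised g t m) (h' : ¬ Raised g t (m - 1)) :
    adjSwap g t m = m := by
  refine (if_neg h).trans (if_neg ?_)
  intro h2
  exact h' (h2.imp (fun h => by convert h using 1; ring) (fun h => by convert h using 1; ring))

theorem raised_sub_one_neg {t m : ℤ} : Raised g t (-1 - m) ↔ Raised g t (m - 1) := by
  unfold Raised
  rw [or_comm, show -1 - m + t + 2 = -(m - 1 - t) by ring, dvd_neg,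
    show -1 - m - t = -(m - 1 + t + 2) by ring, dvd_neg]

theorem raised_add {t m k : ℤ} : Raised g t (m + 2 * g * k) ↔ Raised g t m := by
  unfold Raised
  rw [show m + 2 * g * k - t = (m - t) + 2 * g * k by ring,
    show m + 2 * g * k + t + 2 = (m + t + 2) + 2 * g * k by ring,
    dvd_add_left (Dvd.intro _ rfl), dvd_add_left (Dvd.intro _ rfl)]

theorem adjSwap_cases (g : ℕ) (t m : ℤ) :
    (Raised g t m ∧ adjSwap g t m = m + 1) ∨ (Raised g t (m - 1) ∧ adjSwap g t m = m - 1) ∨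
      (¬ Raised g t m ∧ ¬ Raised g t (m - 1) ∧ adjSwap g t m = m) := by
  by_cases h : Raised g t m
  · exact Or.inl ⟨h, adjSwap_of_raised h⟩
  · by_cases h' : Raised g t (m - 1)
    · exact Or.inr (Or.inl ⟨h', adjSwap_of_raised_pred h'⟩)
    · exact Or.inr (Or.inr ⟨h, h', adjSwap_of_not h h'⟩)

theorem adjSwap_adjSwap (t m : ℤ) : adjSwap g t (adjSwap g t m) = m := by
  rcases adjSwap_cases g t m with ⟨h, e⟩ | ⟨h, e⟩ | ⟨-, -, e⟩
  · rw [e, adjSwap_of_raised_pred (by simpa using h)]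
    ring
  · rw [e, adjSwap_of_raised h]
    ring
  · rw [e, e]

theorem adjSwap_neg (t m : ℤ) : adjSwap g t (-1 - m) = -1 - adjSwap g t m := by
  have e2 : Raised g t (-1 - m - 1) ↔ Raised g t m := by
    rw [show -1 - m - 1 = -1 - (m + 1) by ring, raised_sub_one_neg]
    simp
  rcases adjSwap_cases g t m with ⟨h, e⟩ | ⟨h, e⟩ | ⟨h, h', e⟩
  · rw [e, adjSwap_of_raised_pred (e2.2 h)]
    ring
  · rw [e, adjSwap_of_raised (raised_sub_one_neg.2 h)]
    ring
  · rw [e, adjSwap_of_not (mt raised_sub_one_neg.1 h') (mt e2.1 h)]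

theorem adjSwap_add (t m k : ℤ) : adjSwap g t (m + 2 * g * k) = adjSwap g t m + 2 * g * k := by
  have e2 : Raised g t (m + 2 * g * k - 1) ↔ Raised g t (m - 1) := by
    rw [show m + 2 * g * k - 1 = m - 1 + 2 * g * k by ring, raised_add]
  rcases adjSwap_cases g t m with ⟨h, e⟩ | ⟨h, e⟩ | ⟨h, h', e⟩
  · rw [e, adjSwap_of_raised (raised_add.2 h)]
    ring
  · rw [e, adjSwap_of_raised_pred (e2.2 h)]
    ring
  · rw [e, adjSwap_of_not (mt raised_add.1 h) (mt e2.1 h')]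

theorem adjSwap_congr {t t' : ℤ} (h : 2 * (g : ℤ) ∣ t - t' ∨ 2 * (g : ℤ) ∣ t + t' + 2) (m : ℤ) :
    adjSwap g t m = adjSwap g t' m := by
  unfold adjSwap
  rcases h with ⟨k, hk⟩ | ⟨k, hk⟩
  · rw [show m - t = m - t' + 2 * g * -k by linarith,
      show m + t + 2 = m + t' + 2 + 2 * g * k by linarith,
      show m - t' + 2 * g * -k - 1 = m - t' - 1 + 2 * g * -k by ring,
      show m + t + 1 = m + t' + 1 + 2 * g * k by linarith]
    simp only [dvd_add_left (Dvd.intro _ rfl)]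
  · rw [show m - t = m + t' + 2 + 2 * g * -k by linarith,
      show m + t + 2 = m - t' + 2 * g * k by linarith,
      show m + t' + 2 + 2 * g * -k - 1 = m + t' + 1 + 2 * g * -k by ring,
      show m + t + 1 = m - t' - 1 + 2 * g * k by linarith]
    simp only [dvd_add_left (Dvd.intro _ rfl), or_comm]

variable [NeZero g]

theorem dvd_iff_of_lt {z : ℤ} (h1 : -(2 * g : ℤ) < z) (h2 : z < 4 * g) :
    2 * (g : ℤ) ∣ z ↔ z = 0 ∨ z = 2 * g := by
  have hN := two_mul_pos (g := g)
  constructor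
  · rintro ⟨k, rfl⟩
    have h3 : -1 < k := by nlinarith
    have h4 : k < 2 := by nlinarith
    have : k = 0 ∨ k = 1 := by omega
    rcases this with rfl | rfl <;> simp
  · rintro (rfl | rfl) <;> simp

theorem adjSwap_coe {t : ℤ} (h1 : -1 ≤ t) (h2 : t < g) (i : Fin (2 * g)) :
    adjSwap g t i = if ((i : ℤ) - t = 0 ∨ (i : ℤ) - t = 2 * g) ∨
        ((i : ℤ) + t + 2 = 0 ∨ (i : ℤ) + t + 2 = 2 * g) then (i : ℤ) + 1
      else if ((i : ℤ) - t - 1 = 0 ∨ (i : ℤ) - t - 1 = 2 * g) ∨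
        ((i : ℤ) + t + 1 = 0 ∨ (i : ℤ) + t + 1 = 2 * g) then (i : ℤ) - 1 else i := by
  have hi := i.isLt
  have d1 := dvd_iff_of_lt (g := g) (z := (i : ℤ) - t) (by omega) (by omega)
  have d2 := dvd_iff_of_lt (g := g) (z := (i : ℤ) + t + 2) (by omega) (by omega)
  have d3 := dvd_iff_of_lt (g := g) (z := (i : ℤ) - t - 1) (by omega) (by omega)
  have d4 := dvd_iff_of_lt (g := g) (z := (i : ℤ) + t + 1) (by omega) (by omega)
  simp only [adjSwap, d1, d2, d3, d4]

theorem aperm_eq_of_coe {x : GLExtAffineWeyl g} {t : ℤ}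
    (h : ∀ i : Fin (2 * g), aperm x i = adjSwap g t i) (m : ℤ) : aperm x m = adjSwap g t m := by
  obtain ⟨i, k, rfl⟩ := exists_res (g := g) m
  rw [aperm_add, adjSwap_add, h]

theorem aperm_mkElt_coe (v : Fin (2 * g) → ℤ) (w : Equiv.Perm (Fin (2 * g))) (i : Fin (2 * g)) :
    aperm (mkElt v w) i = ((w⁻¹ i : Fin (2 * g)) : ℕ) + 2 * g * v i :=
  aperm_coe_zero _ _

theorem exists_adjSwap_of_mem {s : GLExtAffineWeyl g} (hs : s ∈ simpleReflections g) :
    ∃ t, ∀ m, aperm s m = adjSwap g t m := by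
  have hg := NeZero.pos g
  rcases hs with (⟨i, hi, rfl⟩ | ⟨i, j, hij, hj, rfl⟩) | ⟨i, hi, rfl⟩
  · refine ⟨-1, aperm_eq_of_coe fun k => ?_⟩
    have hk := k.isLt
    rw [aperm_mkElt_coe, adjSwap_coe (by omega) (by omega), Equiv.swap_inv, Equiv.swap_apply_def]
    simp only [Pi.sub_apply, Pi.single_apply, Fin.ext_iff, Fin.val_rev, hi]
    split_ifs <;> (try simp only [Fin.val_rev] at *) <;> omega
  · refine ⟨i, aperm_eq_of_coe fun k => ?_⟩
    have hk := k.isLt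
    rw [aperm_mkElt_coe, adjSwap_coe (by omega) (by omega), mul_inv_rev, Equiv.swap_inv, Equiv.swap_inv,
      Equiv.Perm.mul_apply, Equiv.swap_apply_def, Equiv.swap_apply_def]
    simp only [Pi.zero_apply, Fin.ext_iff, Fin.val_rev]
    split_ifs <;> (try simp only [Fin.val_rev] at *) <;> omega
  · refine ⟨i, aperm_eq_of_coe fun k => ?_⟩
    have hk := k.isLt
    rw [aperm_mkElt_coe, adjSwap_coe (by omega) (by omega), Equiv.swap_inv, Equiv.swap_apply_def]
    simp only [Pi.zero_apply, Fin.ext_iff, Fin.val_rev]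
    split_ifs <;> (try simp only [Fin.val_rev] at *) <;> omega

/-- The exchange depends on t only modulo 2g and up to t ↦ -2 - t, so t may be taken in [-1, g).
There t = -1 gives s_0, t = g - 1 gives s_g, and the others give the s_{i,i+1}. -/
theorem exists_simpleReflection (t : ℤ) :
    ∃ s ∈ simpleReflections g, ∀ m, aperm s m = adjSwap g t m := by
  have hg := NeZero.pos g
  have key : ∀ t' : ℤ, -1 ≤ t' → t' < g →
      ∃ s ∈ simpleReflections g, ∀ m, aperm s m = adjSwap g t' m := by
    intro t' h1 h2
    have hmem : ∃ s ∈ simpleReflections g, aperm s t' = t' + 1 := by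
      by_cases h3 : t' = -1
      · refine ⟨_, Or.inl (Or.inl ⟨⟨0, by omega⟩, rfl, rfl⟩), ?_⟩
        have h4 : t' = ((⟨2 * g - 1, by omega⟩ : Fin (2 * g)) : ℕ) + 2 * g * (-1) := by
          simp only
          omega
        rw [h4, aperm_add, aperm_mkElt_coe, Equiv.swap_inv, Equiv.swap_apply_def]
        simp only [Pi.sub_apply, Pi.single_apply, Fin.ext_iff, Fin.val_rev]
        split_ifs <;> (try simp only [Fin.val_rev] at *) <;> omega
      · by_cases h4 : t' = g - 1
        · subst h4
          refine ⟨_, Or.inr ⟨⟨g - 1, by omega⟩, by simp only; omega, rfl⟩, ?_⟩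
          have h5 : (g : ℤ) - 1 = ((⟨g - 1, by omega⟩ : Fin (2 * g)) : ℕ) := by
            simp only
            omega
          rw [h5, aperm_mkElt_coe, Equiv.swap_inv, Equiv.swap_apply_def]
          simp only [Pi.zero_apply, Fin.ext_iff, Fin.val_rev]
          split_ifs <;> (try simp only [Fin.val_rev] at *) <;> omega
        · lift t' to ℕ using by omega
          refine ⟨_, Or.inl (Or.inr ⟨⟨t', by omega⟩, ⟨t' + 1, by omega⟩, rfl,
            by simp only; omega, rfl⟩), ?_⟩
          have h5 := aperm_mkElt_coe (g := g) 0 (Equiv.swap ⟨t', by omega⟩ ⟨t' + 1, by omega⟩ *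
            Equiv.swap (Fin.rev ⟨t', by omega⟩) (Fin.rev ⟨t' + 1, by omega⟩)) ⟨t', by omega⟩
          rw [h5, mul_inv_rev, Equiv.swap_inv, Equiv.swap_inv,
            Equiv.Perm.mul_apply, Equiv.swap_apply_def, Equiv.swap_apply_def]
          simp only [Pi.zero_apply, Fin.ext_iff, Fin.val_rev]
          split_ifs <;> (try simp only [Fin.val_rev] at *) <;> omega
    -- A single value identifies s: it is an exchange for some t'', and raising t' forces t' to be
    -- congruent to t'' or to -2 - t''.
    obtain ⟨s, hs, hst⟩ := hmem
    obtain ⟨t'', ht⟩ := exists_adjSwap_of_mem hs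
    refine ⟨s, hs, fun m => ?_⟩
    rw [ht, adjSwap_congr]
    rw [ht] at hst
    rcases adjSwap_cases g t'' t' with ⟨h, -⟩ | ⟨-, e⟩ | ⟨-, -, e⟩
    · rcases h with h | h
      · left
        rwa [dvd_sub_comm] at h
      · right
        rwa [add_comm t' t''] at h
    · omega
    · omega
  obtain ⟨j, k, rfl⟩ := exists_res (g := g) t
  have hj := j.isLt
  have h1 : ∃ t', -1 ≤ t' ∧ t' < (g : ℤ) ∧
      (2 * (g : ℤ) ∣ t' - (j + 2 * g * k) ∨ 2 * (g : ℤ) ∣ t' + (j + 2 * g * k) + 2) := by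
    by_cases h : j.val < g
    · exact ⟨j, by omega, by omega, Or.inl ⟨-k, by ring⟩⟩
    · exact ⟨2 * g - 2 - j, by omega, by omega, Or.inr ⟨1 + k, by ring⟩⟩
  obtain ⟨t', h2, h3, h4⟩ := h1
  obtain ⟨s, hs, h⟩ := key t' h2 h3
  exact ⟨s, hs, fun m => by rw [h, adjSwap_congr h4]⟩

theorem hasSim_of_adjSwap {s : GLExtAffineWeyl g} {t : ℤ} (h : ∀ m, aperm s m = adjSwap g t m) :
    HasSim s 0 := by
  intro m
  rw [h, h, adjSwap_neg]
  ring

theorem hasSim_of_mem_simpleReflections {s : GLExtAffineWeyl g} (hs : s ∈ simpleReflections g) :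
    HasSim s 0 := by
  obtain ⟨t, h⟩ := exists_adjSwap_of_mem hs
  exact hasSim_of_adjSwap h

theorem mul_self_of_adjSwap {s : GLExtAffineWeyl g} {t : ℤ} (h : ∀ m, aperm s m = adjSwap g t m) :
    s * s = 1 := by
  apply aperm_ext
  intro m
  rw [aperm_mul, h, h, adjSwap_adjSwap, aperm_one]

theorem mul_self_of_mem_simpleReflections {s : GLExtAffineWeyl g}
    (hs : s ∈ simpleReflections g) : s * s = 1 := by
  obtain ⟨t, h⟩ := exists_adjSwap_of_mem hs
  exact mul_self_of_adjSwap h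

theorem res_eq_iff (m : ℤ) (i : Fin (2 * g)) : res g m = i ↔ 2 * (g : ℤ) ∣ i - m := by
  constructor
  · rintro rfl
    exact ⟨-(m / (2 * g)), by linarith [res_decomp (g := g) m]⟩
  · rintro ⟨k, hk⟩
    rw [show m = i + 2 * g * (-k) by linarith, res_add]

-- Usually t and -2 - t give two raised residues. If they coincide modulo 2g there is only one, but
-- then the pair i, i + 1 is its own mirror image and is counted twice. The total 2 is the drop of
-- `invNum` under a simple reflection.
open Classical in
theorem card_raised (t : ℤ) :
    (∑ i : Fin (2 * g), ((if Raised g t i then 1 else 0) +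
      if Raised g t i ∧ 2 * (g : ℤ) ∣ i + (i + 1) + 1 then 1 else 0)) = 2 := by
  have h1 : ∀ i : Fin (2 * g), Raised g t i ↔ i = res g t ∨ i = res g (-2 - t) := by
    intro i
    rw [eq_comm, res_eq_iff, eq_comm, res_eq_iff, Raised]
    rw [show (i : ℤ) - (-2 - t) = i + t + 2 by ring]
  have h2 : ∀ i : Fin (2 * g), (Raised g t i ∧ 2 * (g : ℤ) ∣ i + (i + 1) + 1) ↔
      i = res g t ∧ i = res g (-2 - t) := by
    intro i
    have e1 : i = res g t ↔ 2 * (g : ℤ) ∣ i - t := by rw [eq_comm, res_eq_iff]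
    have e2 : i = res g (-2 - t) ↔ 2 * (g : ℤ) ∣ i + t + 2 := by
      rw [eq_comm, res_eq_iff, show (i : ℤ) - (-2 - t) = i + t + 2 by ring]
    rw [e1, e2, Raised, show (i : ℤ) + (i + 1) + 1 = (i - t) + (i + t + 2) by ring]
    constructor
    · rintro ⟨h | h, h'⟩
      · exact ⟨h, (dvd_add_right h).1 h'⟩
      · exact ⟨(dvd_add_left h).1 h', h⟩
    · rintro ⟨h, h'⟩
      exact ⟨Or.inl h, dvd_add h h'⟩
  simp only [h2]
  simp only [h1, Finset.sum_add_distrib, ← Finset.card_filter]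
  by_cases h : res g t = res g (-2 - t)
  · simp [← h, Finset.filter_eq']
  · have e1 : (Finset.univ.filter fun i : Fin (2 * g) => i = res g t ∨ i = res g (-2 - t)) =
        {res g t, res g (-2 - t)} := by
      ext; simp
    have e2 : (Finset.univ.filter fun i : Fin (2 * g) => i = res g t ∧ i = res g (-2 - t)) = ∅ := by
      ext i
      simp only [Finset.mem_filter, Finset.mem_univ, true_and, Finset.notMem_empty, iff_false]
      rintro ⟨rfl, h'⟩
      exact h h'
    rw [e1, e2, Finset.card_pair h, Finset.card_empty]

end SimpleReflections

/-! ### Counting inversions of affine permutations -/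

section InversionCount

variable {g : ℕ} [NeZero g]

/-- The condition says that a and b are mirror images modulo 2g, that is, that the pair belongs to a
long root. Elements with a similitude preserve this. Such pairs are their own mirror image, whereas
other inversions come in mirror pairs, hence the extra weight in `invNum`. -/
theorem HasSim.dvd_iff {x : GLExtAffineWeyl g} {c : ℤ} (hx : HasSim x c) (a b : ℤ) :
    2 * (g : ℤ) ∣ aperm x a + aperm x b + 1 ↔ 2 * (g : ℤ) ∣ a + b + 1 := by
  have key : ∀ {y : GLExtAffineWeyl g} {d : ℤ}, HasSim y d → ∀ a b, 2 * (g : ℤ) ∣ a + b + 1 →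
      2 * (g : ℤ) ∣ aperm y a + aperm y b + 1 := by
    rintro y d hy a b ⟨k, hk⟩
    rw [show b = (-1 - a) + 2 * g * k by linarith, aperm_add, hy]
    exact ⟨d + k, by ring⟩
  refine ⟨fun h => ?_, key hx a b⟩
  have := key hx.inv _ _ h
  rwa [aperm_inv_apply, aperm_inv_apply] at this

/-- The inversions of `x` with first entry `a`. -/
def invSet (x : GLExtAffineWeyl g) (a : ℤ) : Set ℤ := {b | a < b ∧ aperm x b < aperm x a}

theorem exists_bound (x : GLExtAffineWeyl g) : ∃ M : ℤ, ∀ m, |aperm x m - m| ≤ M := by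
  refine ⟨∑ i : Fin (2 * g), |aperm x i - i|, fun m => ?_⟩
  obtain ⟨i, k, rfl⟩ := exists_res (g := g) m
  rw [aperm_add, add_sub_add_right_eq_sub]
  exact Finset.single_le_sum (f := fun i : Fin (2 * g) => |aperm x i - i|)
    (fun i _ => abs_nonneg _) (Finset.mem_univ i)

theorem invSet_finite (x : GLExtAffineWeyl g) (a : ℤ) : (invSet x a).Finite := by
  obtain ⟨M, hM⟩ := exists_bound x
  refine (Set.finite_Icc a (a + 2 * M)).subset ?_
  rintro b ⟨h1, h2⟩
  have h3 := abs_le.1 (hM a)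
  have h4 := abs_le.1 (hM b)
  constructor <;> linarith

/-- The inversions on the hyperplanes of long roots with first entry `a`. -/
def selfInvSet (x : GLExtAffineWeyl g) (a : ℤ) : Set ℤ :=
  invSet x a ∩ {b | 2 * (g : ℤ) ∣ a + b + 1}

/-- Twice the number of hyperplanes separating the base alcove from its image. -/
noncomputable def invNum (x : GLExtAffineWeyl g) : ℕ :=
  ∑ i : Fin (2 * g), ((invSet x i).ncard + (selfInvSet x i).ncard)

theorem invSet_add (x : GLExtAffineWeyl g) (a k : ℤ) :
    invSet x (a + 2 * g * k) = (· + 2 * g * k) '' invSet x a := by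
  ext b
  constructor
  · rintro ⟨h1, h2⟩
    refine ⟨b - 2 * g * k, ⟨by linarith, ?_⟩, by ring⟩
    have := aperm_add x (b - 2 * g * k) k
    rw [sub_add_cancel] at this
    rw [aperm_add] at h2
    linarith
  · rintro ⟨b, ⟨h1, h2⟩, rfl⟩
    refine ⟨by linarith, ?_⟩
    rw [aperm_add, aperm_add]
    linarith

theorem selfInvSet_add (x : GLExtAffineWeyl g) (a k : ℤ) :
    selfInvSet x (a + 2 * g * k) = (· + 2 * g * k) '' selfInvSet x a := by
  rw [selfInvSet, selfInvSet, invSet_add]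
  ext b
  constructor
  · rintro ⟨⟨b, h, rfl⟩, h'⟩
    refine ⟨b, ⟨h, ?_⟩, rfl⟩
    simp only [Set.mem_ofPred_eq] at h' ⊢
    rw [show a + 2 * g * k + (b + 2 * g * k) + 1 = a + b + 1 + 2 * g * (k + k) by ring,
      dvd_add_left (Dvd.intro _ rfl)] at h'
    exact h'
  · rintro ⟨b, ⟨h, h'⟩, rfl⟩
    refine ⟨⟨b, h, rfl⟩, ?_⟩
    simp only [Set.mem_ofPred_eq] at h' ⊢
    rw [show a + 2 * g * k + (b + 2 * g * k) + 1 = a + b + 1 + 2 * g * (k + k) by ring,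
      dvd_add_left (Dvd.intro _ rfl)]
    exact h'

theorem ncard_invSet_add (x : GLExtAffineWeyl g) (a k : ℤ) :
    (invSet x (a + 2 * g * k)).ncard + (selfInvSet x (a + 2 * g * k)).ncard =
      (invSet x a).ncard + (selfInvSet x a).ncard := by
  rw [invSet_add, selfInvSet_add, Set.ncard_image_of_injective _ (add_left_injective _),
    Set.ncard_image_of_injective _ (add_left_injective _)]

/-- A descent at `t` propagates to all raised residues. -/
theorem HasSim.descent {x : GLExtAffineWeyl g} {c t : ℤ} (hx : HasSim x c)
    (h : aperm x (t + 1) < aperm x t) {m : ℤ} (hm : Raised g t m) :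
    aperm x (m + 1) < aperm x m := by
  rcases hm with ⟨k, hk⟩ | ⟨k, hk⟩
  · rw [show m = t + 2 * g * k by linarith,
      show t + 2 * g * k + 1 = t + 1 + 2 * g * k by ring, aperm_add, aperm_add]
    linarith
  · rw [show m = (-1 - (t + 1)) + 2 * g * k by linarith,
      show (-1 - (t + 1)) + 2 * g * k + 1 = (-1 - t) + 2 * g * k by ring, aperm_add, aperm_add,
      hx, hx]
    linarith

/-- Relabelling by s preserves the order of two integers unless they are neighbours exchanged by s.
At a descent, the only inversions lost are therefore the pairs (a, a + 1) with a raised, and none is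
gained. -/
theorem image_invSet_of_descent {x s : GLExtAffineWeyl g} {c t : ℤ}
    (hs : ∀ m, aperm s m = adjSwap g t m) (hx : HasSim x c)
    (h : aperm x (t + 1) < aperm x t) (a : ℤ) :
    aperm s '' invSet (s * x) (aperm s a) = invSet x a \ {b | Raised g t a ∧ b = a + 1} := by
  ext b
  have hss : ∀ m, aperm s (aperm s m) = m := fun m => by rw [hs, hs, adjSwap_adjSwap]
  have h0 : b ∈ aperm s '' invSet (s * x) (aperm s a) ↔
      aperm s a < aperm s b ∧ aperm x b < aperm x a := by
    constructor
    · rintro ⟨b, ⟨h1, h2⟩, rfl⟩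
      rw [aperm_mul, aperm_mul, hss] at h2
      rw [hss]
      exact ⟨h1, h2⟩
    · rintro ⟨h1, h2⟩
      refine ⟨aperm s b, ⟨h1, ?_⟩, hss b⟩
      rwa [aperm_mul, aperm_mul, hss, hss]
  rw [h0]
  simp only [invSet, Set.mem_sdiff, Set.mem_ofPred_eq]
  have hinj : aperm s a = aperm s b → a = b := fun h => aperm_injective s h
  -- This excludes a new inversion from b = a - 1, the neighbour that s moves past a.
  have hda : Raised g t (a - 1) → aperm x a < aperm x (a - 1) := fun h' => by
    simpa using hx.descent h h'
  rw [hs, hs] at hinj ⊢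
  rcases adjSwap_cases g t a with ⟨ha, ea⟩ | ⟨ha, ea⟩ | ⟨ha, ha', ea⟩ <;>
  rcases adjSwap_cases g t b with ⟨hb, eb⟩ | ⟨hb, eb⟩ | ⟨hb, hb', eb⟩ <;>
  rw [ea, eb] at hinj ⊢
  · have := ha.parity
    have := hb.parity
    constructor
    · rintro ⟨h1, h2⟩
      exact ⟨⟨by omega, h2⟩, fun h => by omega⟩
    · rintro ⟨⟨h1, h2⟩, h3⟩
      exact ⟨by omega, h2⟩
  · have := ha.parity
    have := hb.parity
    constructor
    · rintro ⟨h1, h2⟩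
      exact ⟨⟨by omega, h2⟩, fun h => by omega⟩
    · rintro ⟨⟨h1, h2⟩, h3⟩
      have : b ≠ a + 1 := fun h => h3 ⟨ha, h⟩
      exact ⟨by omega, h2⟩
  · have h4 : b ≠ a + 1 := by
      rintro rfl
      apply hb'
      simpa using ha
    constructor
    · rintro ⟨h1, h2⟩
      exact ⟨⟨by omega, h2⟩, fun h => by omega⟩
    · rintro ⟨⟨h1, h2⟩, h3⟩
      exact ⟨by omega, h2⟩
  · have := ha.parity
    have := hb.parity
    constructor
    · rintro ⟨h1, h2⟩
      refine ⟨⟨?_, h2⟩, fun h => ha.not_raised_pred (by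
        have h5 := h.1.parity
        omega)⟩
      have h6 : b ≠ a - 1 := by
        rintro rfl
        have := hda ha
        linarith
      omega
    · rintro ⟨⟨h1, h2⟩, h3⟩
      exact ⟨by omega, h2⟩
  · have := ha.parity
    have := hb.parity
    constructor
    · rintro ⟨h1, h2⟩
      exact ⟨⟨by omega, h2⟩, fun h => by omega⟩
    · rintro ⟨⟨h1, h2⟩, h3⟩
      exact ⟨by omega, h2⟩
  · have h4 : b ≠ a := fun h => hb' (h ▸ ha)
    constructor
    · rintro ⟨h1, h2⟩
      refine ⟨⟨by omega, h2⟩, fun h => ?_⟩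
      have := h.1.parity
      have := ha.parity
      omega
    · rintro ⟨⟨h1, h2⟩, h3⟩
      exact ⟨by omega, h2⟩
  · have h4 : b ≠ a := fun h => ha (h ▸ hb)
    constructor
    · rintro ⟨h1, h2⟩
      exact ⟨⟨by omega, h2⟩, fun h => ha h.1⟩
    · rintro ⟨⟨h1, h2⟩, h3⟩
      exact ⟨by omega, h2⟩
  · have h4 : b ≠ a := fun h => ha' (h ▸ hb)
    have h5 : b ≠ a + 1 := by
      rintro rfl
      apply ha
      simpa using hb
    constructor
    · rintro ⟨h1, h2⟩
      exact ⟨⟨by omega, h2⟩, fun h => ha h.1⟩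
    · rintro ⟨⟨h1, h2⟩, h3⟩
      exact ⟨by omega, h2⟩
  · constructor
    · rintro ⟨h1, h2⟩
      exact ⟨⟨by omega, h2⟩, fun h => ha h.1⟩
    · rintro ⟨⟨h1, h2⟩, h3⟩
      exact ⟨by omega, h2⟩

theorem image_selfInvSet_of_descent {x s : GLExtAffineWeyl g} {c t : ℤ}
    (hs : ∀ m, aperm s m = adjSwap g t m) (hx : HasSim x c)
    (h : aperm x (t + 1) < aperm x t) (a : ℤ) :
    aperm s '' selfInvSet (s * x) (aperm s a) = selfInvSet x a \ {b | Raised g t a ∧ b = a + 1} := by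
  have h1 : aperm s '' selfInvSet (s * x) (aperm s a) =
      aperm s '' invSet (s * x) (aperm s a) ∩ {b | 2 * (g : ℤ) ∣ a + b + 1} := by
    ext b
    constructor
    · rintro ⟨b, ⟨h1, h2⟩, rfl⟩
      refine ⟨⟨b, h1, rfl⟩, ?_⟩
      have h3 := (hasSim_of_adjSwap hs).dvd_iff (aperm s a) b
      rw [hs (aperm s a), hs a, adjSwap_adjSwap, ← hs a] at h3
      exact h3.2 h2
    · rintro ⟨⟨b, h1, rfl⟩, h2⟩
      refine ⟨b, ⟨h1, ?_⟩, rfl⟩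
      have h3 := (hasSim_of_adjSwap hs).dvd_iff (aperm s a) b
      rw [hs (aperm s a), hs a, adjSwap_adjSwap, ← hs a] at h3
      exact h3.1 h2
  rw [h1, image_invSet_of_descent hs hx h, selfInvSet]
  ext b
  simp only [Set.mem_inter_iff, Set.mem_sdiff]
  tauto

open Classical in
theorem ncard_diff_raised {x : GLExtAffineWeyl g} {c t : ℤ} (hx : HasSim x c)
    (h : aperm x (t + 1) < aperm x t) (a : ℤ) (P : Set ℤ) :
    ((invSet x a ∩ P) \ {b | Raised g t a ∧ b = a + 1}).ncard +
      (if Raised g t a ∧ a + 1 ∈ P then 1 else 0) = (invSet x a ∩ P).ncard := by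
  have hfin : (invSet x a ∩ P).Finite := (invSet_finite x a).inter_of_left _
  by_cases h1 : Raised g t a ∧ a + 1 ∈ P
  · have e : {b | Raised g t a ∧ b = a + 1} = {a + 1} := by
      ext b
      simp [h1.1]
    rw [if_pos h1, e]
    exact Set.ncard_sdiff_singleton_add_one ⟨⟨by linarith, hx.descent h h1.1⟩, h1.2⟩ hfin
  · rw [if_neg h1, add_zero]
    congr 1
    ext b
    simp only [Set.mem_sdiff, Set.mem_ofPred_eq]
    constructor
    · exact fun h => h.1
    · intro h2
      refine ⟨h2, ?_⟩
      rintro ⟨h3, rfl⟩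
      exact h1 ⟨h3, h2.2⟩

/-- After the period is reindexed by s, each raised residue loses one inversion, and one more when
the pair is of long root type. By `card_raised` the total loss is 2. -/
theorem invNum_of_descent {x s : GLExtAffineWeyl g} {c t : ℤ}
    (hs : ∀ m, aperm s m = adjSwap g t m) (hx : HasSim x c)
    (h : aperm x (t + 1) < aperm x t) : invNum (s * x) + 2 = invNum x := by
  classical
  have h1 := sum_aperm s (fun a => (invSet (s * x) a).ncard + (selfInvSet (s * x) a).ncard)
    (fun m k => ncard_invSet_add _ m k)
  rw [invNum, ← h1, invNum]
  refine (congrArg _ (card_raised (g := g) t).symm).trans ?_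
  rw [← Finset.sum_add_distrib]
  refine Finset.sum_congr rfl fun i _ => ?_
  have e1 := ncard_diff_raised hx h (i : ℤ) Set.univ
  have e2 := ncard_diff_raised hx h (i : ℤ) {b | 2 * (g : ℤ) ∣ i + b + 1}
  rw [Set.inter_univ, ← image_invSet_of_descent hs hx h,
    Set.ncard_image_of_injective _ (aperm_injective s)] at e1
  rw [← selfInvSet, ← image_selfInvSet_of_descent hs hx h,
    Set.ncard_image_of_injective _ (aperm_injective s)] at e2
  simp only [Set.mem_univ, and_true, Set.mem_ofPred_eq] at e1 e2
  split_ifs at e1 e2 ⊢ <;> omega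

end InversionCount

end GSpWeyl

namespace GSpWeyl

/-! ### Coxeter length and inversions -/

section Length

variable {g : ℕ}

/-- Words in the simple affine reflections. -/
def IsWord (l : List (GLExtAffineWeyl g)) : Prop := ∀ s ∈ l, s ∈ simpleReflections g

theorem affineLength_le {l : List (GLExtAffineWeyl g)} (hl : IsWord l) :
    affineLength l.prod ≤ l.length :=
  Nat.sInf_le ⟨l, hl, rfl, rfl⟩

variable [NeZero g]

/-- The displacement F(m) - m of an increasing F is monotone and periodic, hence constant, and the
similitude determines the constant. -/
theorem eq_add_of_no_descent {x : GLExtAffineWeyl g} {c : ℤ} (hx : HasSim x c)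
    (h : ∀ t, aperm x t < aperm x (t + 1)) (m : ℤ) : aperm x m = m + g * c := by
  have hN := two_mul_pos (g := g)
  have hmono : Monotone fun m => aperm x m - m :=
    monotone_int_of_le_succ fun t => by
      have := h t
      change aperm x t - t ≤ aperm x (t + 1) - (t + 1)
      omega
  have hper : ∀ k, aperm x (2 * g * k) - 2 * g * k = aperm x 0 := fun k => by
    have := aperm_add x 0 k
    rw [zero_add] at this
    rw [this]
    ring
  have hconst : ∀ m, aperm x m - m = aperm x 0 := by
    intro m
    -- m lies between two multiples of the period, at which the displacement is the same.
    have h0 : |m| ≤ 2 * g * |m| := by nlinarith [abs_nonneg m]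
    have h1 := hmono (show m ≤ 2 * g * |m| from (le_abs_self m).trans h0)
    have h2 := hmono (show 2 * g * (-|m|) ≤ m by linarith [neg_abs_le m])
    simp only [hper] at h1 h2
    exact le_antisymm h1 h2
  have h1 := hx 0
  have h2 := hconst (-1 - 0)
  have h3 := hconst m
  linarith

theorem exists_descent {x : GLExtAffineWeyl g} (hx : HasSim x 0) (h : x ≠ 1) :
    ∃ t, aperm x (t + 1) < aperm x t := by
  by_contra! hc
  apply h
  apply aperm_ext
  intro m
  rw [aperm_one, eq_add_of_no_descent hx (fun t => (hc t).lt_of_ne fun e => ?_)]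
  · ring
  · have := aperm_injective x e
    omega

theorem invNum_one : invNum (1 : GLExtAffineWeyl g) = 0 := by
  have h : ∀ a, invSet (1 : GLExtAffineWeyl g) a = ∅ := by
    intro a
    ext b
    simp only [invSet, aperm_one, Set.mem_ofPred_eq, Set.mem_empty_iff_false, iff_false]
    omega
  simp [invNum, selfInvSet, h]

theorem IsWord.hasSim {l : List (GLExtAffineWeyl g)} (hl : IsWord l) : HasSim l.prod 0 := by
  induction l with
  | nil => exact hasSim_one
  | cons s l ih =>
    rw [List.prod_cons]
    exact (hasSim_of_mem_simpleReflections (hl s (by simp))).mul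
      (ih fun s hs => hl s (List.mem_cons_of_mem _ hs))

/-- Sorting by adjacent exchanges: any element other than 1 has a descent, and removing it lowers
`invNum` by 2. -/
theorem exists_word {w : GLExtAffineWeyl g} (hw : HasSim w 0) :
    ∃ l, IsWord l ∧ l.prod = w ∧ 2 * l.length = invNum w := by
  induction hn : invNum w using Nat.strong_induction_on generalizing w with
  | _ n ih =>
    by_cases h1 : w = 1
    · refine ⟨[], by simp [IsWord], by simp [h1], ?_⟩
      rw [← hn, h1, invNum_one, List.length_nil]
    · obtain ⟨t, ht⟩ := exists_descent hw h1
      obtain ⟨s, hs, hst⟩ := exists_simpleReflection (g := g) t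
      have h2 := invNum_of_descent hst hw ht
      have h3 := (hasSim_of_mem_simpleReflections hs).mul hw
      obtain ⟨l, hl, hl', hl''⟩ := ih _ (by omega) h3 rfl
      refine ⟨s :: l, ?_, ?_, ?_⟩
      · rintro s' hs'
        rcases List.mem_cons.1 hs' with rfl | hs'
        · exact hs
        · exact hl _ hs'
      · rw [List.prod_cons, hl', ← mul_assoc, mul_self_of_mem_simpleReflections hs, one_mul]
      · rw [List.length_cons]
        omega

/-- Each letter changes `invNum` by 2 in one direction or the other, so the words found by sorting
are shortest possible. -/
theorem IsWord.invNum_le {l : List (GLExtAffineWeyl g)} (hl : IsWord l) :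
    invNum l.prod ≤ 2 * l.length := by
  induction l with
  | nil => simp [invNum_one]
  | cons s l ih =>
    have hl' : IsWord l := fun s hs => hl s (List.mem_cons_of_mem _ hs)
    have hs := hl s (by simp)
    specialize ih hl'
    rw [List.prod_cons, List.length_cons]
    obtain ⟨t, ht⟩ := exists_adjSwap_of_mem hs
    have hR : Raised g t t := Or.inl (by simp)
    rcases lt_trichotomy (aperm l.prod (t + 1)) (aperm l.prod t) with h | h | h
    · have := invNum_of_descent ht hl'.hasSim h
      omega
    · have := aperm_injective _ h
      omega
    · have h2 : HasSim (s * l.prod) (0 + 0) := (hasSim_of_mem_simpleReflections hs).mul hl'.hasSim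
      have h3 := invNum_of_descent ht h2 (by
        rw [aperm_mul, aperm_mul, ht, ht, adjSwap_of_raised hR,
          adjSwap_of_raised_pred (by simpa using hR)]
        simpa using h)
      rw [← mul_assoc, mul_self_of_mem_simpleReflections hs, one_mul] at h3
      omega

/-- The length of an element of the affine Weyl group is the number of hyperplanes separating the
base alcove from its image. -/
theorem two_mul_affineLength {w : GLExtAffineWeyl g} (hw : HasSim w 0) :
    2 * affineLength w = invNum w := by
  obtain ⟨l, hl, rfl, h⟩ := exists_word hw
  have h1 := affineLength_le hl
  have hne : {n | ∃ l' : List (GLExtAffineWeyl g),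
    (∀ s ∈ l', s ∈ simpleReflections g) ∧ l'.prod = l.prod ∧ l'.length = n}.Nonempty :=
    ⟨_, l, hl, rfl, rfl⟩
  obtain ⟨l', hl', h2, h3⟩ := Nat.sInf_mem hne
  have h4 := IsWord.invNum_le (l := l') hl'
  rw [h2, h3] at h4
  change _ ≤ 2 * affineLength l.prod at h4
  omega

theorem exists_reduced_word {w : GLExtAffineWeyl g} (hw : HasSim w 0) :
    ∃ l, IsWord l ∧ l.prod = w ∧ l.length = affineLength w := by
  obtain ⟨l, hl, h, h'⟩ := exists_word hw
  have := two_mul_affineLength hw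
  exact ⟨l, hl, h, by omega⟩

end Length

/-! ### Affine reflections and the strong exchange condition -/

section Reflections

variable {g : ℕ} [NeZero g]

/-- `r` is the affine reflection exchanging `a` and `b`. -/
def Swaps (r : GLExtAffineWeyl g) (a b : ℤ) : Prop :=
  HasSim r 0 ∧ aperm r a = b ∧ aperm r b = a ∧ ∀ m, ¬ 2 * (g : ℤ) ∣ m - a → ¬ 2 * (g : ℤ) ∣ m - b →
    ¬ 2 * (g : ℤ) ∣ m + a + 1 → ¬ 2 * (g : ℤ) ∣ m + b + 1 → aperm r m = m

theorem Swaps.symm {r : GLExtAffineWeyl g} {a b : ℤ} (h : Swaps r a b) : Swaps r b a :=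
  ⟨h.1, h.2.2.1, h.2.1, fun m h1 h2 h3 h4 => h.2.2.2 m h2 h1 h4 h3⟩

theorem aperm_of_dvd_sub {x y : GLExtAffineWeyl g} {a a' m : ℤ}
    (h : aperm x a = aperm y a') (hm : 2 * (g : ℤ) ∣ m - a) : aperm x m = aperm y (m - a + a') := by
  obtain ⟨k, hk⟩ := hm
  rw [hk, show m = a + 2 * g * k by linarith, add_comm _ a', aperm_add, aperm_add, h]

theorem HasSim.aperm_of_dvd_add {x y : GLExtAffineWeyl g} {c a a' m : ℤ} (hx : HasSim x c)
    (hy : HasSim y c) (h : aperm x a = aperm y a') (hm : 2 * (g : ℤ) ∣ m + a + 1) :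
    aperm x m = aperm y (m + a - a') := by
  obtain ⟨k, hk⟩ := hm
  rw [show m + a - a' = (-1 - a') + 2 * g * k by linarith,
    show m = (-1 - a) + 2 * g * k by linarith, aperm_add, aperm_add, hx, hy, h]

/-- The values at a and b propagate to their residue classes by periodicity and to the mirror
classes by the similitude. All other integers are fixed. -/
theorem Swaps.unique {r r' : GLExtAffineWeyl g} {a b : ℤ} (h : Swaps r a b) (h' : Swaps r' a b) :
    r = r' := by
  apply aperm_ext
  intro m
  have ha : aperm r a = aperm r' a := h.2.1.trans h'.2.1.symm
  have hb : aperm r b = aperm r' b := h.2.2.1.trans h'.2.2.1.symm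
  by_cases h1 : 2 * (g : ℤ) ∣ m - a
  · rw [aperm_of_dvd_sub ha h1, sub_add_cancel]
  by_cases h2 : 2 * (g : ℤ) ∣ m - b
  · rw [aperm_of_dvd_sub hb h2, sub_add_cancel]
  by_cases h3 : 2 * (g : ℤ) ∣ m + a + 1
  · rw [h.1.aperm_of_dvd_add h'.1 ha h3, add_sub_cancel_right]
  by_cases h4 : 2 * (g : ℤ) ∣ m + b + 1
  · rw [h.1.aperm_of_dvd_add h'.1 hb h4, add_sub_cancel_right]
  rw [h.2.2.2 m h1 h2 h3 h4, h'.2.2.2 m h1 h2 h3 h4]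

theorem aperm_inv_eq {r : GLExtAffineWeyl g} {a b : ℤ} (h : aperm r a = b) : aperm r⁻¹ b = a := by
  rw [← h, aperm_inv_apply]

theorem Swaps.inv {r : GLExtAffineWeyl g} {a b : ℤ} (h : Swaps r a b) : Swaps r⁻¹ a b :=
  ⟨by simpa using h.1.inv, aperm_inv_eq h.2.2.1, aperm_inv_eq h.2.1,
    fun m h1 h2 h3 h4 => aperm_inv_eq (h.2.2.2 m h1 h2 h3 h4)⟩

theorem Swaps.mul_self {r : GLExtAffineWeyl g} {a b : ℤ} (h : Swaps r a b) : r * r = 1 := by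
  have := h.unique h.inv
  exact mul_eq_one_iff_eq_inv.2 this

theorem dvd_aperm_sub_iff (x : GLExtAffineWeyl g) (a b : ℤ) :
    2 * (g : ℤ) ∣ aperm x a - aperm x b ↔ 2 * (g : ℤ) ∣ a - b := by
  have key : ∀ (y : GLExtAffineWeyl g) a b, 2 * (g : ℤ) ∣ a - b →
      2 * (g : ℤ) ∣ aperm y a - aperm y b := by
    rintro y a b ⟨k, hk⟩
    rw [show a = b + 2 * g * k by linarith, aperm_add]
    exact ⟨k, by ring⟩
  refine ⟨fun h => ?_, key x a b⟩
  have := key x⁻¹ _ _ h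
  rwa [aperm_inv_apply, aperm_inv_apply] at this

theorem Swaps.conj {r u : GLExtAffineWeyl g} {a b c : ℤ} (h : Swaps r a b) (hu : HasSim u c) :
    Swaps (u⁻¹ * r * u) (aperm u a) (aperm u b) := by
  refine ⟨by simpa using (hu.inv.mul h.1).mul hu, ?_, ?_, ?_⟩
  · rw [aperm_mul, aperm_mul, aperm_inv_apply, h.2.1]
  · rw [aperm_mul, aperm_mul, aperm_inv_apply, h.2.2.1]
  · intro m h1 h2 h3 h4
    have e : m = aperm u (aperm u⁻¹ m) := (aperm_apply_inv u m).symm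
    rw [e, dvd_aperm_sub_iff] at h1 h2
    rw [e, hu.dvd_iff] at h3 h4
    rw [aperm_mul, aperm_mul, h.2.2.2 _ h1 h2 h3 h4, aperm_apply_inv]

theorem swaps_of_adjSwap {s : GLExtAffineWeyl g} {t : ℤ} (h : ∀ m, aperm s m = adjSwap g t m) :
    Swaps s t (t + 1) := by
  have hR : Raised g t t := Or.inl (by simp)
  refine ⟨hasSim_of_adjSwap h, ?_, ?_, ?_⟩
  · rw [h, adjSwap_of_raised hR]
  · rw [h, adjSwap_of_raised_pred (by simpa using hR)]
    ring
  · intro m h1 h2 h3 h4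
    rw [h, adjSwap_of_not]
    · rintro (h5 | h5)
      · exact h1 h5
      · exact h4 (by convert h5 using 1; ring)
    · rintro (h5 | h5)
      · exact h2 (by convert h5 using 1; ring)
      · exact h3 (by convert h5 using 1; ring)

theorem exists_swaps_of_mem_reflections {r : GLExtAffineWeyl g} (hr : r ∈ reflections g) :
    ∃ a b, a < b ∧ Swaps r a b := by
  obtain ⟨u, hu, s, hs, rfl⟩ := hr
  rw [mem_affineWeyl_iff] at hu
  obtain ⟨t, ht⟩ := exists_adjSwap_of_mem hs
  have h := (swaps_of_adjSwap ht).conj hu.inv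
  rw [inv_inv] at h
  rcases lt_trichotomy (aperm u⁻¹ t) (aperm u⁻¹ (t + 1)) with h1 | h1 | h1
  · exact ⟨_, _, h1, h⟩
  · have := aperm_injective _ h1
    omega
  · exact ⟨_, _, h1, h.symm⟩

/-- The strong exchange condition. -/
theorem IsWord.exchange {l : List (GLExtAffineWeyl g)} (hl : IsWord l) {a b : ℤ} (hab : a < b)
    (h : aperm l.prod b < aperm l.prod a) :
    ∃ r ∈ reflections g, Swaps r a b ∧ ∃ l', IsWord l' ∧ l'.prod = r * l.prod ∧
      l'.length < l.length := by
  induction l generalizing a b with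
  | nil =>
    rw [List.prod_nil, aperm_one, aperm_one] at h
    omega
  | cons s l ih =>
    have hl' : IsWord l := fun s hs => hl s (List.mem_cons_of_mem _ hs)
    have hs := hl s (by simp)
    have hss := mul_self_of_mem_simpleReflections hs
    have hs0 := hasSim_of_mem_simpleReflections hs
    have hsi : s⁻¹ = s := inv_eq_of_mul_eq_one_left hss
    rw [List.prod_cons, aperm_mul, aperm_mul] at h
    have hcancel : ∀ m, aperm s (aperm s m) = m := fun m => by
      rw [← aperm_mul, hss, aperm_one]
    -- If s keeps a and b in order, the tail of the word inverts their images, and the reflection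
    -- found for the tail is conjugated by s. If s reverses them, they are neighbours exchanged by
    -- s, so the reflection is s itself and the first letter is deleted.
    rcases lt_trichotomy (aperm s a) (aperm s b) with h1 | h1 | h1
    · obtain ⟨r, ⟨u, hu, s', hs', rfl⟩, hrs, l', hw, hp, hlen⟩ := ih hl' h1 h
      refine ⟨s * (u * s' * u⁻¹) * s, ⟨s * u, ?_, s', hs', ?_⟩, ?_, s :: l', ?_, ?_, ?_⟩
      · rw [mem_affineWeyl_iff] at hu ⊢
        exact hs0.mul hu
      · rw [mul_inv_rev, hsi]
        group
      · have := hrs.conj hs0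
        rwa [hcancel, hcancel, hsi] at this
      · intro s'' hs''
        rcases List.mem_cons.1 hs'' with rfl | hs''
        · exact hs
        · exact hw _ hs''
      · rw [List.prod_cons, List.prod_cons, hp]
        rw [mul_assoc _ s, ← mul_assoc s s, hss, one_mul]
        simp only [mul_assoc]
      · simpa using hlen
    · have := aperm_injective _ h1
      omega
    · obtain ⟨t, ht⟩ := exists_adjSwap_of_mem hs
      have key : Raised g t a ∧ b = a + 1 := by
        rw [ht, ht] at h1
        rcases adjSwap_cases g t a with ⟨ha, ea⟩ | ⟨ha, ea⟩ | ⟨ha, ha', ea⟩ <;>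
        rcases adjSwap_cases g t b with ⟨hb, eb⟩ | ⟨hb, eb⟩ | ⟨hb, hb', eb⟩ <;>
        rw [ea, eb] at h1 <;> try omega
        · refine ⟨ha, ?_⟩
          have := ha.parity
          have := hb.parity
          omega
      have hst := swaps_of_adjSwap ht
      refine ⟨s, ⟨1, ?_, s, hs, by simp⟩, ?_, l, hl', ?_, by simp⟩
      · rw [mem_affineWeyl_iff]
        exact hasSim_one
      · rw [key.2]
        have hR := key.1
        refine ⟨hs0, by rw [ht, adjSwap_of_raised hR], ?_, ?_⟩
        · rw [ht, adjSwap_of_raised_pred (by simpa using hR)]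
          ring
        · intro m h2 h3 h4 h5
          rw [ht]
          have e : adjSwap g t m = adjSwap g a m := by
            apply adjSwap_congr
            rcases hR with hR | hR
            · left
              rwa [dvd_sub_comm]
            · right
              rwa [add_comm t a]
          rw [e, adjSwap_of_not]
          · rintro (h6 | h6)
            · exact h2 h6
            · exact h5 (by convert h6 using 1; ring)
          · rintro (h6 | h6)
            · exact h3 (by convert h6 using 1; ring)
            · exact h4 (by convert h6 using 1; ring)
      · rw [List.prod_cons, ← mul_assoc, hss, one_mul]

/-- A word for r inverts the pair a < b, so the exchange condition yields a reflection exchanging a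
and b, which is r by uniqueness. -/
theorem Swaps.mem_reflections {r : GLExtAffineWeyl g} {a b : ℤ} (h : Swaps r a b) (hab : a < b) :
    r ∈ reflections g := by
  obtain ⟨l, hl, rfl, -⟩ := exists_word h.1
  obtain ⟨r', hr', h', -⟩ := hl.exchange hab (by rw [h.2.1, h.2.2.1]; exact hab)
  rwa [h.unique h']

/-- Since r w inverts a and b, the exchange condition for a reduced word of r w gives a shorter word
for r(r w) = w. -/
theorem Swaps.affineLength_lt {r w : GLExtAffineWeyl g} {a b : ℤ} (h : Swaps r a b) (hab : a < b)
    (hw : HasSim w 0) (hlt : aperm w a < aperm w b) : affineLength w < affineLength (r * w) := by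
  obtain ⟨l, hl, hp, hlen⟩ := exists_reduced_word (h.1.mul hw)
  obtain ⟨r', -, h', l', hl', hp', hlen'⟩ := hl.exchange hab (by
    rw [hp, aperm_mul, aperm_mul, h.2.1, h.2.2.1]
    exact hlt)
  rw [← h.unique h', hp, ← mul_assoc, h.mul_self, one_mul] at hp'
  have := affineLength_le hl'
  rw [hp'] at this
  omega

theorem Swaps.lt_of_affineLength_lt {r w : GLExtAffineWeyl g} {a b : ℤ} (h : Swaps r a b)
    (hab : a < b) (hw : HasSim w 0) (hlt : affineLength w < affineLength (r * w)) :
    aperm w a < aperm w b := by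
  rcases lt_trichotomy (aperm w a) (aperm w b) with h1 | h1 | h1
  · exact h1
  · have := aperm_injective _ h1
    omega
  · have h2 := h.affineLength_lt hab (h.1.mul hw) (by
      rw [aperm_mul, aperm_mul, h.2.1, h.2.2.1]
      exact h1)
    rw [← mul_assoc, h.mul_self, one_mul] at h2
    omega

theorem exists_swaps {a b : ℤ} (hab : ¬ 2 * (g : ℤ) ∣ a - b) :
    ∃ r : GLExtAffineWeyl g, Swaps r a b := by
  have dadd : ∀ z k : ℤ, 2 * (g : ℤ) ∣ z + 2 * g * k ↔ 2 * (g : ℤ) ∣ z := fun z k =>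
    dvd_add_left (Dvd.intro _ rfl)
  -- An integer is never congruent to its own mirror image modulo 2g, by parity. Hence the classes
  -- moved by b - a (those of a and -1 - b) are disjoint from the classes moved back.
  have hodd : ∀ z : ℤ, 2 * (g : ℤ) ∣ 2 * z + 1 → False := by
    rintro z ⟨k, hk⟩
    rw [mul_assoc] at hk
    omega
  let R : ℤ → ℤ := fun m =>
    if 2 * (g : ℤ) ∣ m - a ∨ 2 * (g : ℤ) ∣ m + b + 1 then m + (b - a)
    else if 2 * (g : ℤ) ∣ m - b ∨ 2 * (g : ℤ) ∣ m + a + 1 then m - (b - a) else m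
  have hdisj : ∀ m, (2 * (g : ℤ) ∣ m - a ∨ 2 * (g : ℤ) ∣ m + b + 1) →
      (2 * (g : ℤ) ∣ m - b ∨ 2 * (g : ℤ) ∣ m + a + 1) → False := by
    rintro m (h1 | h1) (h2 | h2)
    · exact hab (by rw [show a - b = (m - b) - (m - a) by ring]; exact dvd_sub h2 h1)
    · exact hodd a (by
        rw [show 2 * a + 1 = (m + a + 1) - (m - a) by ring]; exact dvd_sub h2 h1)
    · exact hodd b (by
        rw [show 2 * b + 1 = (m + b + 1) - (m - b) by ring]; exact dvd_sub h1 h2)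
    · exact hab (by
        rw [show a - b = (m + a + 1) - (m + b + 1) by ring]; exact dvd_sub h2 h1)
  have hR1 : ∀ m, (2 * (g : ℤ) ∣ m - a ∨ 2 * (g : ℤ) ∣ m + b + 1) → R m = m + (b - a) :=
    fun m h => if_pos h
  have hR2 : ∀ m, (2 * (g : ℤ) ∣ m - b ∨ 2 * (g : ℤ) ∣ m + a + 1) → R m = m - (b - a) :=
    fun m h => (if_neg fun h' => hdisj m h' h).trans (if_pos h)
  have hR3 : ∀ m, ¬ (2 * (g : ℤ) ∣ m - a ∨ 2 * (g : ℤ) ∣ m + b + 1) →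
      ¬ (2 * (g : ℤ) ∣ m - b ∨ 2 * (g : ℤ) ∣ m + a + 1) → R m = m :=
    fun m h h' => (if_neg h).trans (if_neg h')
  have hA : ∀ m k, R (m + 2 * g * k) = R m + 2 * g * k := by
    intro m k
    have e1 : m + 2 * g * k - a = m - a + 2 * g * k := by ring
    have e2 : m + 2 * g * k + b + 1 = m + b + 1 + 2 * g * k := by ring
    have e3 : m + 2 * g * k - b = m - b + 2 * g * k := by ring
    have e4 : m + 2 * g * k + a + 1 = m + a + 1 + 2 * g * k := by ring
    simp only [R, e1, e2, e3, e4, dadd]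
    split_ifs <;> ring
  have hB : ∀ m, R (R m) = m := by
    intro m
    by_cases h1 : 2 * (g : ℤ) ∣ m - a ∨ 2 * (g : ℤ) ∣ m + b + 1
    · rw [hR1 m h1, hR2]
      · ring
      · exact h1.imp (fun h => by convert h using 1; ring) (fun h => by convert h using 1; ring)
    · by_cases h2 : 2 * (g : ℤ) ∣ m - b ∨ 2 * (g : ℤ) ∣ m + a + 1
      · rw [hR2 m h2, hR1]
        · ring
        · exact h2.imp (fun h => by convert h using 1; ring) (fun h => by convert h using 1; ring)
      · rw [hR3 m h1 h2, hR3 m h1 h2]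
  have hC : ∀ m, R (-1 - m) = -1 - R m := by
    intro m
    have e1 : 2 * (g : ℤ) ∣ (-1 - m) - a ↔ 2 * (g : ℤ) ∣ m + a + 1 := by
      rw [show (-1 - m) - a = -(m + a + 1) by ring, dvd_neg]
    have e2 : 2 * (g : ℤ) ∣ (-1 - m) + b + 1 ↔ 2 * (g : ℤ) ∣ m - b := by
      rw [show (-1 - m) + b + 1 = -(m - b) by ring, dvd_neg]
    have e3 : 2 * (g : ℤ) ∣ (-1 - m) - b ↔ 2 * (g : ℤ) ∣ m + b + 1 := by
      rw [show (-1 - m) - b = -(m + b + 1) by ring, dvd_neg]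
    have e4 : 2 * (g : ℤ) ∣ (-1 - m) + a + 1 ↔ 2 * (g : ℤ) ∣ m - a := by
      rw [show (-1 - m) + a + 1 = -(m - a) by ring, dvd_neg]
    by_cases h1 : 2 * (g : ℤ) ∣ m - a ∨ 2 * (g : ℤ) ∣ m + b + 1
    · rw [hR1 m h1, hR2 _ (by rw [e3, e4]; exact h1.symm)]
      ring
    · by_cases h2 : 2 * (g : ℤ) ∣ m - b ∨ 2 * (g : ℤ) ∣ m + a + 1
      · rw [hR2 m h2, hR1 _ (by rw [e1, e2]; exact h2.symm)]
        ring
      · rw [hR3 m h1 h2, hR3 _ (by rw [e1, e2]; exact fun h => h2 h.symm)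
          (by rw [e3, e4]; exact fun h => h1 h.symm)]
  obtain ⟨r, hr, hrR⟩ := exists_aperm_eq (g := g) R hA hB hC
  refine ⟨r, (mem_affineWeyl_iff r).1 hr, ?_, ?_, ?_⟩
  · rw [hrR, hR1 a (Or.inl (by simp))]
    ring
  · rw [hrR, hR2 b (Or.inl (by simp))]
    ring
  · intro m h1 h2 h3 h4
    rw [hrR, hR3 m (by tauto) (by tauto)]

end Reflections

end GSpWeyl

namespace GSpWeyl

/-! ### The stabilizer of the base alcove -/

section Omega

variable {g : ℕ}

/-- The permutation `i ↦ i + g` modulo `2g`. -/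
def halfTurn (g : ℕ) : Equiv.Perm (Fin (2 * g)) where
  toFun i := if h : i.val < g then ⟨i.val + g, by omega⟩ else ⟨i.val - g, by have := i.isLt; omega⟩
  invFun i := if h : i.val < g then ⟨i.val + g, by omega⟩ else ⟨i.val - g, by have := i.isLt; omega⟩
  left_inv i := by
    have := i.isLt
    by_cases h : i.val < g
    · simp [h]
    · have h2 : i.val - g < g := by omega
      simp only [h, h2, dif_pos, dif_neg, not_false_eq_true, Fin.ext_iff]
      omega
  right_inv i := by
    have := i.isLt
    by_cases h : i.val < g
    · simp [h]
    · have h2 : i.val - g < g := by omega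
      simp only [h, h2, dif_pos, dif_neg, not_false_eq_true, Fin.ext_iff]
      omega

/-- The element of `Ω` shifting the affine permutations by `g`. -/
def tau (g : ℕ) : GLExtAffineWeyl g :=
  mkElt (fun i => if i.val < g then 0 else 1) (halfTurn g)

theorem halfTurn_val (i : Fin (2 * g)) :
    (halfTurn g i).val = if i.val < g then i.val + g else i.val - g := by
  simp only [halfTurn, Equiv.coe_fn_mk]
  split_ifs <;> rfl

theorem halfTurn_inv : (halfTurn g)⁻¹ = halfTurn g := rfl

theorem affineAct_tau (v : Fin (2 * g) → ℝ) (i : Fin (2 * g)) :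
    affineAct (tau g) v i = (if i.val < g then 0 else 1) + v (halfTurn g i) := by
  simp only [affineAct, tau, transPart, permPart, mkElt, halfTurn_inv, toAdd_ofAdd]
  split_ifs <;> simp

theorem halfTurn_rev (i : Fin (2 * g)) : halfTurn g i.rev = (halfTurn g i).rev := by
  have := i.isLt
  apply Fin.ext
  simp only [halfTurn_val, Fin.val_rev]
  split_ifs <;> omega

theorem halfTurn_halfTurn (i : Fin (2 * g)) : halfTurn g (halfTurn g i) = i :=
  (halfTurn g).left_inv i

variable [NeZero g]

theorem aperm_tau (m : ℤ) : aperm (tau g) m = m + g := by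
  obtain ⟨i, k, rfl⟩ := exists_res (g := g) m
  have := i.isLt
  rw [aperm_add]
  have h : aperm (tau g) i = ((halfTurn g i).val : ℤ) + 2 * g * (if i.val < g then 0 else 1) :=
    aperm_mkElt_coe _ _ _
  rw [h, halfTurn_val]
  split_ifs <;> omega

theorem aperm_tau_inv (m : ℤ) : aperm (tau g)⁻¹ m = m - g :=
  aperm_inv_eq (by rw [aperm_tau]; ring)

theorem hasSim_tau : HasSim (tau g) 1 := by
  intro m
  rw [aperm_tau, aperm_tau]
  ring

theorem tau_mem_omega : tau g ∈ omega g := by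
  refine ⟨(mem_extAffineWeyl_iff _).2 ⟨1, hasSim_tau⟩, ?_⟩
  ext u
  constructor
  · rintro ⟨v, ⟨⟨c, hc⟩, hv⟩, rfl⟩
    refine ⟨⟨c + 1, fun i => ?_⟩, fun i j hij => ?_⟩
    · have h1 := hc (halfTurn g i)
      have := i.isLt
      rw [affineAct_tau, affineAct_tau, halfTurn_rev]
      have h2 : i.rev.val < g ↔ ¬ i.val < g := by
        rw [Fin.val_rev]
        omega
      simp only [h2]
      split_ifs <;> linarith
    · rw [affineAct_tau, affineAct_tau]
      have hi := i.isLt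
      have hj := j.isLt
      have hij' : i.val < j.val := hij
      by_cases h1 : i.val < g <;> by_cases h2 : j.val < g
      · have := hv (halfTurn g i) (halfTurn g j) (by
          rw [Fin.lt_def, halfTurn_val, halfTurn_val, if_pos h1, if_pos h2]; omega)
        simp only [h1, h2, if_true]
        constructor <;> linarith
      · have := hv (halfTurn g j) (halfTurn g i) (by
          rw [Fin.lt_def, halfTurn_val, halfTurn_val, if_pos h1, if_neg h2]; omega)
        simp only [h1, h2, if_true, if_false]
        constructor <;> linarith
      · omega
      · have := hv (halfTurn g i) (halfTurn g j) (by
          rw [Fin.lt_def, halfTurn_val, halfTurn_val, if_neg h1, if_neg h2]; omega)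
        simp only [h1, h2, if_false]
        constructor <;> linarith
  · rintro ⟨⟨c, hc⟩, hu⟩
    refine ⟨fun i => u (halfTurn g i) - (if i.val < g then 1 else 0), ⟨⟨c - 1, fun i => ?_⟩,
      fun i j hij => ?_⟩, ?_⟩
    · have h1 := hc (halfTurn g i)
      have := i.isLt
      beta_reduce
      rw [halfTurn_rev]
      have h2 : i.rev.val < g ↔ ¬ i.val < g := by
        rw [Fin.val_rev]
        omega
      simp only [h2]
      split_ifs <;> linarith
    · have hi := i.isLt
      have hj := j.isLt
      have hij' : i.val < j.val := hij
      by_cases h1 : i.val < g <;> by_cases h2 : j.val < g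
      · have := hu (halfTurn g i) (halfTurn g j) (by
          rw [Fin.lt_def, halfTurn_val, halfTurn_val, if_pos h1, if_pos h2]; omega)
        simp only [h1, h2, if_true]
        constructor <;> linarith
      · have := hu (halfTurn g j) (halfTurn g i) (by
          rw [Fin.lt_def, halfTurn_val, halfTurn_val, if_pos h1, if_neg h2]; omega)
        simp only [h1, h2, if_true, if_false]
        constructor <;> linarith
      · omega
      · have := hu (halfTurn g i) (halfTurn g j) (by
          rw [Fin.lt_def, halfTurn_val, halfTurn_val, if_neg h1, if_neg h2]; omega)
        simp only [h1, h2, if_false]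
        constructor <;> linarith
    · ext i
      have hi := i.isLt
      rw [affineAct_tau, halfTurn_halfTurn, halfTurn_val]
      split_ifs <;> first | omega | ring

/-- The point (i/2g) lies in the base alcove and its image has coordinates F(i)/2g. That this image
is again in the alcove says exactly that F is increasing, so F is a shift. -/
theorem aperm_of_mem_omega {x : GLExtAffineWeyl g} (hx : x ∈ omega g) {c : ℤ} (hc : HasSim x c)
    (m : ℤ) : aperm x m = m + g * c := by
  have hN : (0 : ℝ) < 2 * g := by
    have := NeZero.pos g
    positivity
  have hp : (fun i : Fin (2 * g) => (i.val : ℝ) / (2 * g)) ∈ baseAlcove g := by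
    refine ⟨⟨(2 * g - 1) / (2 * g), fun i => ?_⟩, fun i j hij => ?_⟩
    · have := rev_val_int i
      have h2 : (i.rev.val : ℝ) = 2 * g - 1 - i.val := by exact_mod_cast this
      beta_reduce
      rw [h2]
      ring
    · have h1 : (i.val : ℝ) < j.val := by exact_mod_cast hij
      have h2 : (j.val : ℝ) < 2 * g := by exact_mod_cast j.isLt
      have h3 : (0 : ℝ) ≤ i.val := by positivity
      rw [← sub_div]
      constructor
      · rw [lt_div_iff₀ hN]
        linarith
      · rw [div_lt_iff₀ hN]
        linarith
  have h1 : affineAct x (fun i : Fin (2 * g) => (i.val : ℝ) / (2 * g)) ∈ baseAlcove g := by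
    rw [← hx.2]
    exact ⟨_, hp, rfl⟩
  have h2 : ∀ i : Fin (2 * g), affineAct x (fun i : Fin (2 * g) => (i.val : ℝ) / (2 * g)) i =
      (aperm x i : ℝ) / (2 * g) := by
    intro i
    rw [aperm_coe_zero, affineAct]
    push_cast
    rw [add_div, mul_div_cancel_left₀ _ hN.ne', add_comm]
  have h3 : ∀ i j : Fin (2 * g), i < j → aperm x j - 2 * g < aperm x i ∧ aperm x i < aperm x j := by
    intro i j hij
    have h4 := h1.2 i j hij
    rw [h2, h2, ← sub_div, lt_div_iff₀ hN, div_lt_iff₀ hN] at h4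
    obtain ⟨h5, h6⟩ := h4
    constructor
    · have : (aperm x j : ℝ) - 2 * g < aperm x i := by linarith
      exact_mod_cast this
    · have : (aperm x i : ℝ) < aperm x j := by linarith
      exact_mod_cast this
  refine eq_add_of_no_descent hc (fun t => ?_) m
  obtain ⟨i, k, rfl⟩ := exists_res (g := g) t
  have hi := i.isLt
  by_cases h : i.val + 1 < 2 * g
  · have h4 := (h3 i ⟨i.val + 1, h⟩ (by rw [Fin.lt_def]; simp)).2
    rw [show (i : ℤ) + 2 * g * k + 1 = ((⟨i.val + 1, h⟩ : Fin (2 * g)).val : ℕ) + 2 * g * k by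
      push_cast; ring, aperm_add, aperm_add]
    linarith
  · have h0 : 0 < i.val := by
      have := NeZero.pos g
      omega
    have h4 := (h3 ⟨0, by omega⟩ i h0).1
    have h5 : (i : ℤ) + 1 = 2 * g := by omega
    rw [show (i : ℤ) + 2 * g * k + 1 = ((⟨0, by omega⟩ : Fin (2 * g)).val : ℕ) + 2 * g * (k + 1) by
      push_cast
      linarith, aperm_add, aperm_add]
    linarith

theorem eq_tau_of_mem_omega {x : GLExtAffineWeyl g} (hx : x ∈ omega g) (hc : HasSim x 1) :
    x = tau g := by
  apply aperm_ext
  intro m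
  rw [aperm_of_mem_omega hx hc, aperm_tau, mul_one]

theorem eq_tau_of_mul {c w x : GLExtAffineWeyl g} (hc : c ∈ omega g) (hw : w ∈ affineWeyl g)
    (hx : HasSim x 1) (h : x = c * w) : c = tau g := by
  rw [mem_affineWeyl_iff] at hw
  apply eq_tau_of_mem_omega hc
  rw [show c = x * w⁻¹ by rw [h, mul_inv_cancel_right]]
  simpa using hx.mul hw.inv

theorem HasSim.tau_inv_mul {x : GLExtAffineWeyl g} (hx : HasSim x 1) :
    HasSim ((tau g)⁻¹ * x) 0 := by
  simpa using hasSim_tau.inv.mul hx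

/-- The set in the definition of `length` is a singleton, because the Ω-component of an element of
similitude 1 must be `tau`. -/
theorem length_eq {x : GLExtAffineWeyl g} (hx : HasSim x 1) :
    length x = affineLength ((tau g)⁻¹ * x) := by
  have h : {n | ∃ c ∈ omega g, ∃ w ∈ affineWeyl g, x = c * w ∧ n = affineLength w} =
      {affineLength ((tau g)⁻¹ * x)} := by
    ext n
    constructor
    · rintro ⟨c, hc, w, hw, h, rfl⟩
      have := eq_tau_of_mul hc hw hx h
      subst this
      rw [h, inv_mul_cancel_left]
      rfl
    · rintro rfl
      exact ⟨tau g, tau_mem_omega, _, (mem_affineWeyl_iff _).2 hx.tau_inv_mul, by simp, rfl⟩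
  rw [length, h, csInf_singleton]

theorem invNum_tau_inv_mul (x : GLExtAffineWeyl g) : invNum ((tau g)⁻¹ * x) = invNum x := by
  have h : ∀ a, invSet ((tau g)⁻¹ * x) a = (· + (g : ℤ)) '' invSet x (a - g) := by
    intro a
    ext b
    simp only [invSet, aperm_mul, aperm_tau_inv, Set.mem_ofPred_eq, Set.mem_image]
    constructor
    · rintro ⟨h1, h2⟩
      exact ⟨b - g, ⟨by omega, h2⟩, by ring⟩
    · rintro ⟨b, ⟨h1, h2⟩, rfl⟩
      refine ⟨by omega, ?_⟩
      rwa [add_sub_cancel_right]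
  have h' : ∀ a, selfInvSet ((tau g)⁻¹ * x) a = (· + (g : ℤ)) '' selfInvSet x (a - g) := by
    intro a
    rw [selfInvSet, h, selfInvSet]
    ext b
    have e : ∀ b, 2 * (g : ℤ) ∣ a + (b + g) + 1 ↔ 2 * (g : ℤ) ∣ a - g + b + 1 := fun b => by
      rw [show a + (b + g) + 1 = a - g + b + 1 + 2 * g by ring, dvd_add_left (dvd_refl _)]
    constructor
    · rintro ⟨⟨b, h, rfl⟩, h'⟩
      exact ⟨b, ⟨h, (e b).1 h'⟩, rfl⟩
    · rintro ⟨b, ⟨h, h'⟩, rfl⟩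
      exact ⟨⟨b, h, rfl⟩, (e b).2 h'⟩
  have h1 := sum_aperm (tau g)⁻¹ (fun a => (invSet x a).ncard + (selfInvSet x a).ncard)
    (fun m k => ncard_invSet_add _ m k)
  rw [invNum, invNum, ← h1]
  refine Finset.sum_congr rfl fun i _ => ?_
  rw [h, h', Set.ncard_image_of_injective _ (add_left_injective _),
    Set.ncard_image_of_injective _ (add_left_injective _), aperm_tau_inv]

theorem two_mul_length {x : GLExtAffineWeyl g} (hx : HasSim x 1) : 2 * length x = invNum x := by
  rw [length_eq hx, two_mul_affineLength hx.tau_inv_mul, invNum_tau_inv_mul]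

end Omega

/-! ### Admissible equals permissible -/

section Admissible

variable {g : ℕ} [NeZero g]

/-- The permissible elements. -/
def IsPermissible (x : GLExtAffineWeyl g) : Prop :=
  HasSim x 1 ∧ ∀ m, m ≤ aperm x m ∧ aperm x m ≤ m + 2 * g

theorem IsPermissible.swaps_mul {x r : GLExtAffineWeyl g} {a b : ℤ} (hx : IsPermissible x)
    (hr : Swaps r a b) (ha : a ≤ aperm x b) (ha' : aperm x b ≤ a + 2 * g)
    (hb : b ≤ aperm x a) (hb' : aperm x a ≤ b + 2 * g) : IsPermissible (r * x) := by
  have hs : HasSim (r * x) 1 := by simpa using hr.1.mul hx.1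
  refine ⟨hs, fun m => ?_⟩
  have hcls : ∀ p q : ℤ, aperm r p = q → p ≤ aperm x q → aperm x q ≤ p + 2 * g →
      ∀ k, (p + 2 * g * k ≤ aperm (r * x) (p + 2 * g * k) ∧
        aperm (r * x) (p + 2 * g * k) ≤ p + 2 * g * k + 2 * g) := by
    intro p q hpq h1 h2 k
    rw [aperm_mul, aperm_add, aperm_add, hpq]
    constructor <;> linarith
  have hneg : ∀ m, (m ≤ aperm (r * x) m ∧ aperm (r * x) m ≤ m + 2 * g) →
      -1 - m ≤ aperm (r * x) (-1 - m) ∧ aperm (r * x) (-1 - m) ≤ -1 - m + 2 * g := by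
    intro m h
    rw [hs]
    constructor <;> linarith
  by_cases h1 : 2 * (g : ℤ) ∣ m - a
  · obtain ⟨k, hk⟩ := h1
    rw [show m = a + 2 * g * k by linarith]
    exact hcls a b hr.2.1 ha ha' k
  by_cases h2 : 2 * (g : ℤ) ∣ m - b
  · obtain ⟨k, hk⟩ := h2
    rw [show m = b + 2 * g * k by linarith]
    exact hcls b a hr.2.2.1 hb hb' k
  by_cases h3 : 2 * (g : ℤ) ∣ m + a + 1
  · obtain ⟨k, hk⟩ := h3
    rw [show m = -1 - (a + 2 * g * (-k)) by linarith]
    exact hneg _ (hcls a b hr.2.1 ha ha' (-k))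
  by_cases h4 : 2 * (g : ℤ) ∣ m + b + 1
  · obtain ⟨k, hk⟩ := h4
    rw [show m = -1 - (b + 2 * g * (-k)) by linarith]
    exact hneg _ (hcls b a hr.2.2.1 hb hb' (-k))
  rw [aperm_mul, hr.2.2.2 m h1 h2 h3 h4]
  exact hx.2 m

theorem swaps_tau_conj {r : GLExtAffineWeyl g} {a b : ℤ} (hr : Swaps r a b) :
    Swaps (tau g * r * (tau g)⁻¹) (a - g) (b - g) := by
  have := hr.conj (hasSim_tau (g := g)).inv
  rwa [inv_inv, aperm_tau_inv, aperm_tau_inv] at this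

/-- Going down one step puts two values at positions a < b in increasing order. The bounds for the
inverted values, the larger at a and the smaller at b, imply those for the ordered ones. -/
theorem isPermissible_of_affineBruhatLE {u v : GLExtAffineWeyl g} (hu : HasSim u 0)
    (h : affineBruhatLE u v) (hv : IsPermissible (tau g * v)) : IsPermissible (tau g * u) := by
  induction h using Relation.ReflTransGen.head_induction_on with
  | refl => exact hv
  | head h1 _ ih =>
    rename_i u w _
    obtain ⟨r, hr, rfl, hlt⟩ := h1
    obtain ⟨a, b, hab, hs⟩ := exists_swaps_of_mem_reflections hr
    have hw := ih (hs.1.mul hu)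
    have h2 := hs.lt_of_affineLength_lt hab hu hlt
    have h3 := hw.swaps_mul (swaps_tau_conj hs)
    have e1 : aperm (tau g * (r * u)) (a - g) = aperm u b := by
      rw [aperm_mul, aperm_mul, aperm_tau, sub_add_cancel, hs.2.1]
    have e2 : aperm (tau g * (r * u)) (b - g) = aperm u a := by
      rw [aperm_mul, aperm_mul, aperm_tau, sub_add_cancel, hs.2.2.1]
    have e3 : tau g * r * (tau g)⁻¹ * (tau g * (r * u)) = tau g * u := by
      rw [← mul_assoc, inv_mul_cancel_right, mul_assoc (tau g), ← mul_assoc r, hs.mul_self, one_mul]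
    rw [e1, e2, e3] at h3
    have b1 := hw.2 (a - g)
    have b2 := hw.2 (b - g)
    rw [e1] at b1
    rw [e2] at b2
    exact h3 (by linarith) (by linarith) (by linarith) (by linarith)

/-- Call m moving if F(m) is neither m nor m + 2g, and let a be a moving point of least
displacement. If no b worked, F would inject the moving points of (a, F(a)] into those of (a + 2g,
F(a) + 2g). Shifting back by 2g lands in the moving points of (a, F(a)) without the endpoint F(a),
which is itself moving: a contradiction to cardinality. -/
theorem IsPermissible.exists_raising {x : GLExtAffineWeyl g} (hx : IsPermissible x)
    (h : ∃ m, aperm x m ≠ m ∧ aperm x m ≠ m + 2 * g) :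
    ∃ a b : ℤ, a < b ∧ b < a + 2 * g ∧ b ≤ aperm x a ∧ aperm x a < aperm x b ∧
      aperm x b ≤ a + 2 * g := by
  classical
  let P : ℤ → Prop := fun m => aperm x m ≠ m ∧ aperm x m ≠ m + 2 * g
  have hP : ∀ m, P m → m < aperm x m ∧ aperm x m < m + 2 * g := fun m hm => by
    have := hx.2 m
    have h1 := hm.1
    have h2 := hm.2
    omega
  have hPF : ∀ m, P m → P (aperm x m) := by
    intro m hm
    refine ⟨fun e => hm.1 (aperm_injective x e), fun e => hm.2 (aperm_injective x ?_)⟩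
    have := aperm_add x m 1
    rw [mul_one] at this
    rw [e, this]
  have hPadd : ∀ m, P (m - 2 * g) ↔ P m := by
    intro m
    have := aperm_add x m (-1)
    rw [show m + 2 * g * (-1) = m - 2 * g by ring] at this
    simp only [P]
    rw [this]
    constructor
    · rintro ⟨h1, h2⟩
      exact ⟨fun e => h1 (by linarith), fun e => h2 (by linarith)⟩
    · rintro ⟨h1, h2⟩
      exact ⟨fun e => h1 (by linarith), fun e => h2 (by linarith)⟩
  have hex : ∃ d : ℕ, ∃ m, P m ∧ aperm x m - m = d := by
    obtain ⟨m, hm⟩ := h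
    have := hP m hm
    exact ⟨(aperm x m - m).toNat, m, hm, by omega⟩
  obtain ⟨a, ha, had⟩ := Nat.find_spec hex
  have hmin : ∀ m, P m → aperm x a - a ≤ aperm x m - m := by
    intro m hm
    have h1 := hP m hm
    have := Nat.find_min' hex ⟨m, hm, (by omega : aperm x m - m = ((aperm x m - m).toNat : ℤ))⟩
    omega
  have hab := hP a ha
  by_contra! hcon
  let S := (Finset.Ioc a (aperm x a)).filter P
  let T := (Finset.Ioo (a + 2 * g) (aperm x a + 2 * g)).filter P
  have h1 : S.card ≤ T.card := by
    apply Finset.card_le_card_of_injOn (aperm x) ?_ (aperm_injective x).injOn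
    intro b hb
    simp only [S, Finset.coe_filter, Finset.mem_Ioc, Set.mem_ofPred_eq] at hb
    simp only [T, Finset.coe_filter, Finset.mem_Ioo, Set.mem_ofPred_eq]
    obtain ⟨⟨h1, h2⟩, h3⟩ := hb
    have h4 := hmin b h3
    -- F(b) exceeds F(a) because b > a and the displacement at a is minimal, so the failure of b
    -- forces F(b) > a + 2g.
    have h5 := hcon a b h1 (by omega) h2 (by omega)
    have h6 := hP b h3
    exact ⟨⟨h5, by omega⟩, hPF b h3⟩
  have h2 : T.card ≤ (S.erase (aperm x a)).card := by
    apply Finset.card_le_card_of_injOn (fun m : ℤ => m - 2 * g) ?_ (sub_left_injective).injOn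
    intro b hb
    simp only [T, Finset.coe_filter, Finset.mem_Ioo, Set.mem_ofPred_eq] at hb
    simp only [S, Finset.coe_erase, Finset.coe_filter, Finset.mem_Ioc, Set.mem_sdiff,
      Set.mem_ofPred_eq, Set.mem_singleton_iff]
    exact ⟨⟨⟨by omega, by omega⟩, (hPadd b).2 hb.2⟩, by omega⟩
  have h3 : aperm x a ∈ S := by
    simp only [S, Finset.mem_filter, Finset.mem_Ioc]
    exact ⟨⟨hab.1, le_rfl⟩, hPF a ha⟩
  have h4 := Finset.card_erase_lt_of_mem h3
  omega

theorem isPermissible_translation {w : Equiv.Perm (Fin (2 * g))} (hw : w ∈ weyl g) :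
    IsPermissible (mkElt (fun i => mu g (w⁻¹ i)) 1) := by
  have h := (mem_weyl_iff _).1 (inv_mem hw)
  refine ⟨(hasSim_iff _ _).2 ⟨fun i => ?_, one_mem _⟩, fun m => ?_⟩
  · change mu g (w⁻¹ i) + mu g (w⁻¹ i.rev) = 1
    have := (w⁻¹ i).isLt
    rw [h, mu, mu, Fin.val_rev]
    split_ifs <;> omega
  · obtain ⟨i, k, rfl⟩ := exists_res (g := g) m
    rw [aperm_add, aperm_mkElt_coe]
    have : ((1 : Equiv.Perm (Fin (2 * g)))⁻¹ i) = i := rfl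
    rw [this, mu]
    have := two_mul_pos (g := g)
    split_ifs <;> constructor <;> linarith

theorem IsPermissible.eq_translation {x : GLExtAffineWeyl g} (hx : IsPermissible x)
    (h : ∀ m, aperm x m = m ∨ aperm x m = m + 2 * g) :
    ∃ w ∈ weyl g, x = mkElt (fun i => mu g (w⁻¹ i)) 1 := by
  have hN := two_mul_pos (g := g)
  have h1 : ∀ i, (permPart x)⁻¹ i = i ∧ (transPart x i = 0 ∨ transPart x i = 1) := by
    intro i
    have h2 := h i
    rw [aperm_coe_zero] at h2
    have h3 : (permPart x)⁻¹ i = i := by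
      rcases h2 with h2 | h2
      · have := congrArg (res g) (h2.trans (by ring : (i : ℤ) = i + 2 * g * 0))
        rwa [res_add, res_add] at this
      · have := congrArg (res g) (h2.trans (by ring : (i : ℤ) + 2 * g = i + 2 * g * 1))
        rwa [res_add, res_add] at this
    refine ⟨h3, ?_⟩
    rw [h3] at h2
    rcases h2 with h2 | h2
    · left
      apply mul_left_cancel₀ hN.ne'
      linarith
    · right
      apply mul_left_cancel₀ hN.ne'
      linarith
  have hsum := ((hasSim_iff x 1).1 hx.1).1
  have hmu : ∀ i : Fin (2 * g), mu g i + mu g i.rev = 1 ∧ (mu g i = 0 ∨ mu g i = 1) := by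
    intro i
    have := i.isLt
    rw [mu, mu, Fin.val_rev]
    constructor
    · split_ifs <;> omega
    · split_ifs <;> simp
  -- The required w exchanges an index with its mirror wherever the translation differs from μ.
  let f : Fin (2 * g) → Fin (2 * g) := fun i => if transPart x i = mu g i then i else i.rev
  have hrev : ∀ i, transPart x i.rev = mu g i.rev ↔ transPart x i = mu g i := by
    intro i
    have := hsum i
    have := (hmu i).1
    constructor <;> intro <;> linarith
  have hff : ∀ i, f (f i) = i := by
    intro i
    by_cases hi : transPart x i = mu g i
    · simp only [f, if_pos hi]
    · have hi' := mt (hrev i).1 hi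
      simp only [f, if_neg hi, if_neg hi', Fin.rev_rev]
  let w : Equiv.Perm (Fin (2 * g)) := ⟨f, f, hff, hff⟩
  refine ⟨w, (mem_weyl_iff _).2 fun i => ?_, ext_parts (funext fun i => ?_) ?_⟩
  · change f i.rev = (f i).rev
    simp only [f, hrev]
    split_ifs <;> rfl
  · change transPart x i = mu g (f i)
    by_cases hi : transPart x i = mu g i
    · simp only [f, if_pos hi]
      exact hi
    · simp only [f, if_neg hi]
      have h2 := (h1 i).2
      have h3 := hmu i
      omega
  · exact inv_injective (Equiv.ext fun i => (h1 i).1)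

/-- A crude bound, whose purpose is to make the raising process terminate: an inversion of i lies in
(i, i + 2g]. -/
theorem IsPermissible.length_le {x : GLExtAffineWeyl g} (hx : IsPermissible x) :
    2 * length x ≤ 2 * g * (4 * g) := by
  rw [two_mul_length hx.1, invNum]
  refine (Finset.sum_le_card_nsmul _ _ (4 * g) fun i _ => ?_).trans (by simp)
  have h : invSet x i ⊆ Finset.Ioc (i : ℤ) (i + 2 * g) := by
    rintro b ⟨h1, h2⟩
    have := hx.2 i
    have := hx.2 b
    simp only [Finset.coe_Ioc, Set.mem_Ioc]
    omega
  have h1 := Set.ncard_le_ncard h (Finset.finite_toSet _)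
  have h2 := Set.ncard_le_ncard (Set.inter_subset_left.trans h : selfInvSet x i ⊆ _)
    (Finset.finite_toSet _)
  rw [Set.ncard_coe_finset, Int.card_Ioc] at h1 h2
  rw [← selfInvSet] at h2
  omega

/-- Raise repeatedly within the permissible set. Lengths increase and are bounded, so the process
stops, and it can only stop at a translation. -/
theorem IsPermissible.exists_affineBruhatLE {x : GLExtAffineWeyl g} (hx : IsPermissible x) :
    ∃ w ∈ weyl g, affineBruhatLE ((tau g)⁻¹ * x)
      ((tau g)⁻¹ * mkElt (fun i => mu g (w⁻¹ i)) 1) := by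
  induction hn : 4 * g * g - length x using Nat.strong_induction_on generalizing x with
  | _ n ih =>
    by_cases h : ∀ m, aperm x m = m ∨ aperm x m = m + 2 * g
    · obtain ⟨w, hw, hxw⟩ := hx.eq_translation h
      refine ⟨w, hw, ?_⟩
      rw [← hxw]
      exact Relation.ReflTransGen.refl
    · push Not at h
      obtain ⟨a, b, hab, hab', h1, h2, h3⟩ := hx.exists_raising h
      obtain ⟨r, hr⟩ := exists_swaps (g := g) (a := a) (b := b) (by
        rintro ⟨k, hk⟩
        have h4 : k < 0 := by nlinarith
        have h5 : -1 < k := by nlinarith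
        omega)
      have hy := hx.swaps_mul hr (by linarith) h3 h1 (by linarith)
      have hr' := hr.conj (hasSim_tau (g := g))
      rw [aperm_tau, aperm_tau] at hr'
      have e : (tau g)⁻¹ * (r * x) = (tau g)⁻¹ * r * tau g * ((tau g)⁻¹ * x) := by group
      have hlt := hr'.affineLength_lt (by linarith) hx.1.tau_inv_mul (by
        rw [aperm_mul, aperm_mul, aperm_tau_inv, aperm_tau_inv, add_sub_cancel_right,
          add_sub_cancel_right]
        exact h2)
      have hlt' := hlt
      rw [← e, ← length_eq hx.1, ← length_eq hy.1] at hlt'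
      have hle := hy.length_le
      obtain ⟨w, hw, hle'⟩ := ih (4 * g * g - length (r * x)) (by
        have : 2 * g * (4 * g) = 2 * (4 * g * g) := by ring
        omega) hy rfl
      refine ⟨w, hw, Relation.ReflTransGen.head ⟨_, hr'.mem_reflections (by linarith), ?_, hlt⟩
        (e ▸ hle')⟩
      rfl

/-- The admissible and permissible elements agree. -/
theorem mem_adm_iff (x : GLExtAffineWeyl g) : x ∈ adm g ↔ IsPermissible x := by
  constructor
  · rintro ⟨-, w, hw, c, hc, w₁, hw₁, w₂, hw₂, rfl, h2, h3⟩
    have hp := isPermissible_translation hw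
    have hct := eq_tau_of_mul hc hw₂ hp.1 h2
    rw [h2, hct] at hp
    rw [hct]
    exact isPermissible_of_affineBruhatLE ((mem_affineWeyl_iff _).1 hw₁) h3 hp
  · intro hx
    obtain ⟨w, hw, h⟩ := hx.exists_affineBruhatLE
    have hp := isPermissible_translation hw
    refine ⟨(mem_extAffineWeyl_iff _).2 ⟨1, hx.1⟩, w, hw, tau g, tau_mem_omega, _,
      (mem_affineWeyl_iff _).2 hx.1.tau_inv_mul, _, (mem_affineWeyl_iff _).2 hp.1.tau_inv_mul,
      by simp, by simp, h⟩

end Admissible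

end GSpWeyl

namespace GSpWeyl

/-! ### Alignments, nestings and crossings of arcs -/

section Alignments

variable {n : ℕ} {σ : Equiv.Perm (Fin n)} {S : Finset (Fin n)}

/-- The number of arcs `k → σ k`, `i → σ i` with `k < i < σ k < σ i`, `i, k ∈ S`. -/
def upCrossings (σ : Equiv.Perm (Fin n)) (S : Finset (Fin n)) : ℕ :=
  ∑ i, ∑ k, if i ∈ S ∧ k ∈ S ∧ k < i ∧ i < σ k ∧ σ k < σ i then 1 else 0

/-- The number of arcs `k → σ k`, `i → σ i` with `σ k < σ i < k < i`, `i, k ∉ S`. -/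
def downCrossings (σ : Equiv.Perm (Fin n)) (S : Finset (Fin n)) : ℕ :=
  ∑ i, ∑ k, if i ∉ S ∧ k ∉ S ∧ σ k < σ i ∧ σ i < k ∧ k < i then 1 else 0

/-- The number of arcs over a gap from the left and from the right agree. -/
theorem sum_up_arcs_eq (hup : ∀ i ∈ S, i ≤ σ i) (hdown : ∀ i ∉ S, σ i ≤ i) (t : Fin n) :
    (∑ k, if k ∈ S ∧ k ≤ t ∧ t < σ k then 1 else 0) =
      ∑ j, if j ∉ S ∧ σ j ≤ t ∧ t < j then 1 else 0 := by
  have h1 : (∑ k, if k ≤ t then 1 else 0) = ∑ k, if σ k ≤ t then 1 else 0 :=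
    (Equiv.sum_comp σ (fun k => if k ≤ t then 1 else 0)).symm
  have h2 : ∀ k, (if k ≤ t then 1 else 0) + (if k ∉ S ∧ σ k ≤ t ∧ t < k then 1 else 0) =
      (if σ k ≤ t then 1 else 0) + if k ∈ S ∧ k ≤ t ∧ t < σ k then 1 else 0 := by
    intro k
    have := hup k
    have := hdown k
    grind
  have h3 := Finset.sum_congr (rfl : (Finset.univ : Finset (Fin n)) = _) fun k _ => h2 k
  rw [Finset.sum_add_distrib, Finset.sum_add_distrib, h1] at h3
  omega

/-- Split by whether the down arc j passes over the gap after i. If it does, `sum_up_arcs_eq` trades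
such down arcs for the up arcs over that gap, each of which nests the arc of i, crosses it, or
equals it. -/
theorem sum_up_down_eq (hup : ∀ i ∈ S, i ≤ σ i) (hdown : ∀ i ∉ S, σ i ≤ i) :
    (∑ i, ∑ j, if i ∈ S ∧ j ∉ S ∧ i < j ∧ σ j < σ i then 1 else 0) =
      (∑ i, ∑ k, if i ∈ S ∧ k ∈ S ∧ k < i ∧ σ i < σ k then 1 else 0) + upCrossings σ S +
      (∑ i, if i ∈ S ∧ σ i ≠ i then 1 else 0) +
      ∑ j, ∑ i, if i ∈ S ∧ j ∉ S ∧ i < σ j ∧ σ j < σ i then 1 else 0 := by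
  have hinj : ∀ i j, σ i = σ j → i = j := fun i j h => σ.injective h
  have h1 : ∀ i j : Fin n, (if i ∈ S ∧ j ∉ S ∧ i < j ∧ σ j < σ i then 1 else 0) =
      (if i ∈ S ∧ j ∉ S ∧ σ j ≤ i ∧ i < j then 1 else 0) +
        if i ∈ S ∧ j ∉ S ∧ i < σ j ∧ σ j < σ i then 1 else 0 := by
    intro i j
    have := hup i
    have := hdown j
    have := hinj i j
    grind
  have h2 : ∀ i, (∑ j, if i ∈ S ∧ j ∉ S ∧ σ j ≤ i ∧ i < j then 1 else 0) =
      ∑ k, if i ∈ S ∧ k ∈ S ∧ k ≤ i ∧ i < σ k then 1 else 0 := by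
    intro i
    by_cases hi : i ∈ S
    · simpa [hi] using (sum_up_arcs_eq hup hdown i).symm
    · simp [hi]
  have h3 : ∀ i k, (if i ∈ S ∧ k ∈ S ∧ k ≤ i ∧ i < σ k then 1 else 0) =
      (if i ∈ S ∧ k ∈ S ∧ k < i ∧ σ i < σ k then 1 else 0) +
      (if i ∈ S ∧ k ∈ S ∧ k < i ∧ i < σ k ∧ σ k < σ i then 1 else 0) +
      if k = i then (if i ∈ S ∧ σ i ≠ i then 1 else 0) else 0 := by
    intro i k
    have := hup i
    have := hup k
    have := hinj i k
    grind
  simp_rw [h1, Finset.sum_add_distrib, h2, h3, Finset.sum_add_distrib]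
  rw [Finset.sum_comm (f := fun i j => if i ∈ S ∧ j ∉ S ∧ i < σ j ∧ σ j < σ i then 1 else 0)]
  simp only [Finset.sum_ite_eq', Finset.mem_univ, if_true]
  rfl

/-- The same trade at the gap after the end point σ j of a down arc. The correction term accounts
for an up arc that starts at σ j itself. -/
theorem sum_down_add_eq (hup : ∀ i ∈ S, i ≤ σ i) (hdown : ∀ i ∉ S, σ i ≤ i) :
    (∑ j, ∑ i, if i ∈ S ∧ j ∉ S ∧ i < σ j ∧ σ j < σ i then 1 else 0) +
      (∑ j, if j ∉ S ∧ σ j ∈ S then 1 else 0) =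
      (∑ i, ∑ k, if i ∉ S ∧ k ∉ S ∧ k < i ∧ σ i < σ k then 1 else 0) + downCrossings σ S +
      (∑ i, if i ∉ S ∧ σ i ≠ i then 1 else 0) := by
  have hinj : ∀ i j, σ i = σ j → i = j := fun i j h => σ.injective h
  have h4 : ∀ i j, (if i ∈ S ∧ j ∉ S ∧ i < σ j ∧ σ j < σ i then 1 else 0) +
      (if i = σ j then (if j ∉ S ∧ σ j ∈ S then 1 else 0) else 0) =
      if j ∉ S ∧ i ∈ S ∧ i ≤ σ j ∧ σ j < σ i then 1 else 0 := by
    intro i j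
    have := hup i
    have := hup (σ j)
    have := hinj (σ j) j
    grind
  have h5 : ∀ j, (∑ i, if j ∉ S ∧ i ∈ S ∧ i ≤ σ j ∧ σ j < σ i then 1 else 0) =
      ∑ k, if j ∉ S ∧ k ∉ S ∧ σ k ≤ σ j ∧ σ j < k then 1 else 0 := by
    intro j
    by_cases hj : j ∈ S
    · simp [hj]
    · simpa [hj] using sum_up_arcs_eq hup hdown (σ j)
  have h6 : ∀ j k, (if j ∉ S ∧ k ∉ S ∧ σ k ≤ σ j ∧ σ j < k then 1 else 0) =
      (if k ∉ S ∧ j ∉ S ∧ j < k ∧ σ k < σ j then 1 else 0) +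
      (if j ∉ S ∧ k ∉ S ∧ σ k < σ j ∧ σ j < k ∧ k < j then 1 else 0) +
      if k = j then (if j ∉ S ∧ σ j ≠ j then 1 else 0) else 0 := by
    intro j k
    have := hdown j
    have := hdown k
    have := hinj j k
    grind
  have e3 : (∑ j, if j ∉ S ∧ σ j ∈ S then 1 else 0) =
      ∑ j, ∑ i, if i = σ j then (if j ∉ S ∧ σ j ∈ S then 1 else 0) else 0 := by
    simp
  rw [e3, ← Finset.sum_add_distrib]
  simp_rw [← Finset.sum_add_distrib, h4, h5, h6, Finset.sum_add_distrib]
  rw [Finset.sum_comm (f := fun j k => if k ∉ S ∧ j ∉ S ∧ j < k ∧ σ k < σ j then 1 else 0)]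
  simp only [Finset.sum_ite_eq', Finset.mem_univ, if_true]
  rfl

/-- The number of alignments in terms of crossings. -/
theorem alignments_eq (hup : ∀ i ∈ S, i ≤ σ i) (hdown : ∀ i ∉ S, σ i ≤ i) :
    (∑ i, ∑ j, if i ∈ S ∧ j ∉ S ∧ i < j ∧ σ j < σ i then 1 else 0) +
      (∑ j, if j ∉ S ∧ σ j ∈ S then 1 else 0) =
    (∑ i, ∑ k, if i ∈ S ∧ k ∈ S ∧ k < i ∧ σ i < σ k then 1 else 0) +
      (∑ i, ∑ k, if i ∉ S ∧ k ∉ S ∧ k < i ∧ σ i < σ k then 1 else 0) +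
      (∑ i, if σ i ≠ i then 1 else 0) + upCrossings σ S + downCrossings σ S := by
  have h7 : ∀ i, (if σ i ≠ i then 1 else 0) =
      (if i ∈ S ∧ σ i ≠ i then 1 else 0) + if i ∉ S ∧ σ i ≠ i then 1 else 0 := by
    intro i
    grind
  have e1 := sum_up_down_eq hup hdown
  have e2 := sum_down_add_eq hup hdown
  simp_rw [h7, Finset.sum_add_distrib]
  omega

end Alignments

end GSpWeyl

namespace GSpWeyl

/-! ### Decorated permutations and the length formula -/

section Decorated

variable {g : ℕ} {σ : Equiv.Perm (Fin (2 * g))} {S : Finset (Fin (2 * g))}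

/-- Decorated permutations: elements `σ` of the Weyl group together with a decoration of the fixed
points, encoded by the set `S` of indices moved upwards. -/
structure IsDecorated (σ : Equiv.Perm (Fin (2 * g))) (S : Finset (Fin (2 * g))) : Prop where
  map_rev : ∀ i, σ i.rev = (σ i).rev
  rev_mem : ∀ i, i.rev ∈ S ↔ i ∉ S
  up : ∀ i ∈ S, i ≤ σ i
  down : ∀ i ∉ S, σ i ≤ i

/-- The element of the extended affine Weyl group given by a decorated permutation. -/
def decElt (σ : Equiv.Perm (Fin (2 * g))) (S : Finset (Fin (2 * g))) : GLExtAffineWeyl g :=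
  mkElt (fun i => if i ∈ S then 0 else 1) σ⁻¹

theorem decElt_injective {σ' : Equiv.Perm (Fin (2 * g))} {S' : Finset (Fin (2 * g))}
    (h : decElt σ S = decElt σ' S') : σ = σ' ∧ S = S' := by
  have h1 : permPart (decElt σ S) = permPart (decElt σ' S') := by rw [h]
  have h2 : transPart (decElt σ S) = transPart (decElt σ' S') := by rw [h]
  refine ⟨inv_injective h1, Finset.ext fun i => ?_⟩
  have h3 : (if i ∈ S then (0 : ℤ) else 1) = if i ∈ S' then 0 else 1 := congrFun h2 i
  split_ifs at h3 <;> simp_all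

theorem sum_eq_sum_half (f : Fin (2 * g) → ℕ) :
    ∑ i, f i = ∑ i, if i.val < g then f i + f i.rev else 0 := by
  have h1 : ∀ i : Fin (2 * g), f i =
      (if i.val < g then f i else 0) + if i.rev.val < g then f i else 0 := by
    intro i
    have := i.isLt
    rw [Fin.val_rev]
    split_ifs <;> omega
  have h2 : ∑ i : Fin (2 * g), (if i.rev.val < g then f i else 0) =
      ∑ i : Fin (2 * g), if i.val < g then f i.rev else 0 := by
    rw [← Equiv.sum_comp Fin.revPerm]
    simp
  rw [Finset.sum_congr rfl fun i _ => h1 i, Finset.sum_add_distrib, h2, ← Finset.sum_add_distrib]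
  refine Finset.sum_congr rfl fun i _ => ?_
  split_ifs <;> simp

theorem sum_half_one : (∑ i : Fin (2 * g), if i.val < g then 1 else 0) = g := by
  have h := sum_eq_sum_half (g := g) (fun _ => 1)
  have h2 : ∀ i : Fin (2 * g), (if i.val < g then 1 + 1 else 0) = 2 * if i.val < g then 1 else 0 :=
    fun i => by split_ifs <;> rfl
  simp_rw [h2, ← Finset.mul_sum] at h
  simp only [Finset.sum_const, Finset.card_univ, Fintype.card_fin, smul_eq_mul] at h
  omega

namespace IsDecorated

theorem map_inv_rev (h : IsDecorated σ S) (i : Fin (2 * g)) : σ⁻¹ i.rev = (σ⁻¹ i).rev := by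
  rw [Equiv.Perm.inv_eq_iff_eq, h.map_rev, ← Equiv.Perm.mul_apply, mul_inv_cancel,
    Equiv.Perm.one_apply]

theorem sum_mem (h : IsDecorated σ S) : (∑ i, if i ∈ S then 1 else 0) = g := by
  rw [sum_eq_sum_half]
  conv_rhs => rw [← sum_half_one (g := g)]
  refine Finset.sum_congr rfl fun i _ => ?_
  have := h.rev_mem i
  grind

theorem sum_not_mem (h : IsDecorated σ S) : (∑ i, if i ∉ S then 1 else 0) = g := by
  rw [sum_eq_sum_half]
  conv_rhs => rw [← sum_half_one (g := g)]
  refine Finset.sum_congr rfl fun i _ => ?_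
  have := h.rev_mem i
  grind

theorem downCrossings_eq (h : IsDecorated σ S) : downCrossings σ S = upCrossings σ S := by
  unfold downCrossings upCrossings
  rw [← Equiv.sum_comp Fin.revPerm]
  simp_rw [← Equiv.sum_comp Fin.revPerm (fun k => if Fin.revPerm _ ∉ S ∧ k ∉ S ∧ _ then 1 else 0)]
  rw [Finset.sum_comm]
  refine Finset.sum_congr rfl fun i _ => Finset.sum_congr rfl fun k _ => ?_
  simp only [Fin.revPerm_apply, h.rev_mem, h.map_rev, Fin.rev_lt_rev, not_not]
  congr 1
  apply propext
  tauto

/-- The number of arcs crossing the axis. -/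
theorem sum_crossing_axis (h : IsDecorated σ S) :
    (∑ i : Fin (2 * g), if i ∉ S ∧ g ≤ i.val ∧ (σ i).val < g then 1 else 0) =
      ∑ i : Fin (2 * g), if i.val < g ∧ g ≤ (σ i).val then 1 else 0 := by
  rw [← Equiv.sum_comp Fin.revPerm]
  refine Finset.sum_congr rfl fun i _ => ?_
  have h1 := h.rev_mem i
  have h2 := h.down i
  have h3 := i.isLt
  have h4 := (σ i).isLt
  rw [Fin.le_def] at h2
  simp only [Fin.revPerm_apply, h.map_rev, Fin.val_rev, h1, not_not]
  by_cases hi : i ∈ S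
  · simp only [hi, true_and]
    congr 1
    apply propext
    omega
  · have := h2 hi
    simp only [hi, false_and, if_false]
    rw [if_neg]
    omega

end IsDecorated

/-- The pairs contributing to the length. -/
def InvPair (σ : Equiv.Perm (Fin (2 * g))) (S : Finset (Fin (2 * g))) (i j : Fin (2 * g)) : Prop :=
  (i ∈ S ∧ j ∈ S ∧ i < j ∧ σ j < σ i) ∨ (i ∉ S ∧ j ∉ S ∧ i < j ∧ σ j < σ i) ∨
    (i ∉ S ∧ j ∈ S ∧ ¬ (j < i ∧ σ i < σ j))

instance (i j : Fin (2 * g)) : Decidable (InvPair σ S i j) := by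
  unfold InvPair
  infer_instance

/-- The representative of `j` in the period following `i`. -/
def nextRep (i j : Fin (2 * g)) : ℤ := if i < j then (j : ℤ) else j + 2 * g

theorem nextRep_injective (i : Fin (2 * g)) : Function.Injective (nextRep i) := by
  intro j k hjk
  apply Fin.ext
  have := j.isLt
  have := k.isLt
  have := i.isLt
  simp only [nextRep, Fin.lt_def] at hjk
  split_ifs at hjk <;> omega

/-- Pairs in the same direction are inverted exactly when nested. Of the g² pairs with i ∉ S and j ∈
S, all are inverted except those counted by the second sum on the left. -/
theorem sum_invPair (h : IsDecorated σ S) :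
    (∑ i, ∑ j, if InvPair σ S i j then 1 else 0) +
      (∑ i, ∑ j, if i ∈ S ∧ j ∉ S ∧ i < j ∧ σ j < σ i then 1 else 0) =
    g * g + (∑ i, ∑ k, if i ∈ S ∧ k ∈ S ∧ k < i ∧ σ i < σ k then 1 else 0) +
      ∑ i, ∑ k, if i ∉ S ∧ k ∉ S ∧ k < i ∧ σ i < σ k then 1 else 0 := by
  have h1 : ∀ i j : Fin (2 * g), (if InvPair σ S j i then 1 else 0) +
      (if i ∈ S ∧ j ∉ S ∧ i < j ∧ σ j < σ i then 1 else 0) =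
      (if i ∈ S then 1 else 0) * (if j ∉ S then 1 else 0) +
      (if i ∈ S ∧ j ∈ S ∧ j < i ∧ σ i < σ j then 1 else 0) +
      if i ∉ S ∧ j ∉ S ∧ j < i ∧ σ i < σ j then 1 else 0 := by
    intro i j
    simp only [InvPair]
    by_cases hi : i ∈ S <;> by_cases hj : j ∈ S <;>
      by_cases h1 : i < j ∧ σ j < σ i <;> simp [hi, hj, h1]
  rw [Finset.sum_comm (f := fun i j => if InvPair σ S i j then 1 else 0)]
  simp_rw [← Finset.sum_add_distrib, h1, Finset.sum_add_distrib]
  rw [← Finset.sum_mul_sum, h.sum_mem, h.sum_not_mem]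

/-- An index and its mirror lie on opposite sides of S, so only the g indices outside S can
contribute, and those whose down arc crosses the axis do not. -/
theorem sum_invPair_rev (h : IsDecorated σ S) :
    (∑ i, if InvPair σ S i i.rev then 1 else 0) +
      (∑ i : Fin (2 * g), if i.val < g ∧ g ≤ (σ i).val then 1 else 0) = g := by
  rw [← h.sum_crossing_axis, ← Finset.sum_add_distrib]
  conv_rhs => rw [← h.sum_not_mem]
  refine Finset.sum_congr rfl fun i _ => ?_
  have h1 := h.rev_mem i
  have h3 := i.isLt
  have h4 := (σ i).isLt
  simp only [InvPair, h1, h.map_rev, Fin.lt_def, Fin.val_rev]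
  by_cases hi : i ∈ S
  · simp [hi]
  · by_cases h5 : g ≤ i.val ∧ (σ i).val < g
    · simp only [hi, h5]
      simp
      omega
    · simp only [hi, h5]
      simp
      omega

variable [NeZero g]

theorem aperm_decElt (i : Fin (2 * g)) :
    aperm (decElt σ S) i = (σ i).val + if i ∈ S then 0 else 2 * (g : ℤ) := by
  rw [decElt, aperm_mkElt_coe, inv_inv]
  split_ifs <;> simp

theorem IsDecorated.isPermissible (h : IsDecorated σ S) : IsPermissible (decElt σ S) := by
  refine ⟨(hasSim_iff _ _).2 ⟨fun i => ?_, inv_mem ((mem_weyl_iff σ).2 h.map_rev)⟩, fun m => ?_⟩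
  · change (if i ∈ S then (0 : ℤ) else 1) + (if i.rev ∈ S then 0 else 1) = 1
    have := h.rev_mem i
    grind
  · obtain ⟨i, k, rfl⟩ := exists_res (g := g) m
    rw [aperm_add, aperm_decElt]
    have h1 := i.isLt
    have h2 := (σ i).isLt
    have h3 := h.up i
    have h4 := h.down i
    rw [Fin.le_def] at h3 h4
    split_ifs with hi
    · have := h3 hi
      constructor <;> linarith
    · have := h4 hi
      constructor <;> linarith

/-- The bounds force the translation part into {0, 1}. Value 0 means that σ moves the index weakly
up, value 1 weakly down, and similitude 1 makes mirror indices take different values. -/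
theorem IsPermissible.exists_decorated {x : GLExtAffineWeyl g} (hx : IsPermissible x) :
    ∃ σ S, IsDecorated σ S ∧ x = decElt σ S := by
  have hN := two_mul_pos (g := g)
  obtain ⟨h1, h2⟩ := (hasSim_iff _ _).1 hx.1
  have h3 := (mem_weyl_iff _).1 (inv_mem h2)
  have h4 : ∀ i : Fin (2 * g), (transPart x i = 0 ∧ i ≤ (permPart x)⁻¹ i) ∨
      (transPart x i = 1 ∧ (permPart x)⁻¹ i ≤ i) := by
    intro i
    have h5 := hx.2 i
    rw [aperm_coe_zero] at h5
    have h6 := i.isLt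
    have h7 := ((permPart x)⁻¹ i).isLt
    have h8 : -1 < transPart x i := by
      by_contra hc
      have : 2 * (g : ℤ) * transPart x i ≤ 2 * g * (-1) := by
        apply mul_le_mul_of_nonneg_left (by omega) hN.le
      omega
    have h9 : transPart x i < 2 := by
      by_contra hc
      have : 2 * (g : ℤ) * 2 ≤ 2 * g * transPart x i := by
        apply mul_le_mul_of_nonneg_left (by omega) hN.le
      omega
    rw [Fin.le_def, Fin.le_def]
    have h10 : transPart x i = 0 ∨ transPart x i = 1 := by omega
    rcases h10 with h10 | h10 <;> rw [h10] at h5 ⊢ <;> omega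
  refine ⟨(permPart x)⁻¹, Finset.univ.filter fun i => transPart x i = 0,
    ⟨h3, fun i => ?_, fun i hi => ?_, fun i hi => ?_⟩, ext_parts (funext fun i => ?_) ?_⟩
  · have := h1 i
    have := h4 i
    have := h4 i.rev
    simp only [Finset.mem_filter, Finset.mem_univ, true_and]
    omega
  · have h5 := h4 i
    simp only [Finset.mem_filter, Finset.mem_univ, true_and] at hi
    rcases h5 with h5 | h5
    · exact h5.2
    · omega
  · have h5 := h4 i
    simp only [Finset.mem_filter, Finset.mem_univ, true_and] at hi
    rcases h5 with h5 | h5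
    · omega
    · exact h5.2
  · change transPart x i = if i ∈ Finset.univ.filter (fun i => transPart x i = 0) then 0 else 1
    simp only [Finset.mem_filter, Finset.mem_univ, true_and]
    have := h4 i
    split_ifs <;> omega
  · exact (inv_inv _).symm

theorem invPair_iff (h : IsDecorated σ S) {i j : Fin (2 * g)} (hij : i ≠ j) :
    InvPair σ S i j ↔ nextRep i j ∈ invSet (decElt σ S) i := by
  have h1 : i.val ≠ j.val := fun e => hij (Fin.ext e)
  have h2 : (σ i).val ≠ (σ j).val := fun e => hij (σ.injective (Fin.ext e))
  have e1 : aperm (decElt σ S) (j + 2 * g) = aperm (decElt σ S) j + 2 * g := by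
    simpa using aperm_add (decElt σ S) j 1
  have hi := h.up i
  have hi' := h.down i
  have hj := h.up j
  have hj' := h.down j
  rw [Fin.le_def] at hi hi' hj hj'
  have := i.isLt
  have := j.isLt
  have := (σ i).isLt
  have := (σ j).isLt
  simp only [InvPair, nextRep, invSet, Set.mem_ofPred_eq, Fin.lt_def]
  by_cases hlt : i.val < j.val
  · simp only [hlt, if_true, aperm_decElt]
    by_cases h3 : i ∈ S <;> by_cases h4 : j ∈ S <;> simp [h3, h4] at hi hi' hj hj' ⊢ <;> omega
  · simp only [hlt, if_false, e1, aperm_decElt]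
    by_cases h3 : i ∈ S <;> by_cases h4 : j ∈ S <;> simp [h3, h4] at hi hi' hj hj' ⊢ <;> omega

theorem invSet_decElt (h : IsDecorated σ S) (i : Fin (2 * g)) :
    invSet (decElt σ S) i = nextRep i '' {j | InvPair σ S i j} := by
  have hii : ¬ InvPair σ S i i := by
    simp [InvPair]
  ext b
  constructor
  · intro hb
    have hp := h.isPermissible
    have h1 := hp.2 i
    have h2 := hp.2 b
    have hb' := hb
    obtain ⟨h3, h4⟩ := hb'
    have h5 := i.isLt
    have hN := two_mul_pos (g := g)
    have key : ∃ j, i ≠ j ∧ nextRep i j = b := by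
      obtain ⟨j, k, rfl⟩ := exists_res (g := g) b
      have h6 := j.isLt
      have h7 : -1 < k := by
        by_contra hc
        have : 2 * (g : ℤ) * k ≤ 2 * g * (-1) := by
          apply mul_le_mul_of_nonneg_left (by omega) hN.le
        omega
      have h9 : k < 2 := by
        by_contra hc
        have : 2 * (g : ℤ) * 2 ≤ 2 * g * k := by
          apply mul_le_mul_of_nonneg_left (by omega) hN.le
        omega
      have h10 : k = 0 ∨ k = 1 := by omega
      refine ⟨j, ?_, ?_⟩
      · rintro rfl
        rcases h10 with rfl | rfl <;> omega
      · simp only [nextRep, Fin.lt_def]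
        rcases h10 with rfl | rfl
        · rw [if_pos (by omega)]
          ring
        · rw [if_neg (by omega)]
          ring
    obtain ⟨j, hij, rfl⟩ := key
    exact ⟨j, (invPair_iff h hij).2 hb, rfl⟩
  · rintro ⟨j, hj, rfl⟩
    have hij : i ≠ j := by
      rintro rfl
      exact hii hj
    exact (invPair_iff h hij).1 hj

theorem ncard_invSet_decElt (h : IsDecorated σ S) (i : Fin (2 * g)) :
    (invSet (decElt σ S) i).ncard = ∑ j, if InvPair σ S i j then 1 else 0 := by
  rw [invSet_decElt h, Set.ncard_image_of_injective _ (nextRep_injective i), ← Finset.card_filter,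
    ← Set.ncard_coe_finset]
  simp

theorem ncard_selfInvSet_decElt (h : IsDecorated σ S) (i : Fin (2 * g)) :
    (selfInvSet (decElt σ S) i).ncard = if InvPair σ S i i.rev then 1 else 0 := by
  have h1 : selfInvSet (decElt σ S) i = nextRep i '' {j | InvPair σ S i j ∧ j = i.rev} := by
    rw [selfInvSet, invSet_decElt h]
    have h2 : ∀ j, 2 * (g : ℤ) ∣ i + nextRep i j + 1 ↔ j = i.rev := by
      intro j
      have := i.isLt
      have := j.isLt
      have h3 : ∀ z : ℤ, 2 * (g : ℤ) ∣ z + 2 * g ↔ 2 * (g : ℤ) ∣ z := fun z =>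
        dvd_add_left (dvd_refl _)
      rw [Fin.ext_iff, Fin.val_rev, nextRep]
      split_ifs
      · rw [dvd_iff_of_lt (by omega) (by omega)]
        omega
      · rw [show (i : ℤ) + (j + 2 * g) + 1 = i + j + 1 + 2 * g by ring, h3,
          dvd_iff_of_lt (by omega) (by omega)]
        omega
    ext b
    constructor
    · rintro ⟨⟨j, hj, rfl⟩, hb⟩
      exact ⟨j, ⟨hj, (h2 j).1 hb⟩, rfl⟩
    · rintro ⟨j, ⟨hj, hj'⟩, rfl⟩
      exact ⟨⟨j, hj, rfl⟩, (h2 j).2 hj'⟩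
  rw [h1, Set.ncard_image_of_injective _ (nextRep_injective i)]
  split_ifs with h2
  · have : {j | InvPair σ S i j ∧ j = i.rev} = {i.rev} := by
      ext j
      simp only [Set.mem_ofPred_eq, Set.mem_singleton_iff]
      exact ⟨fun h => h.2, fun h => ⟨h ▸ h2, h⟩⟩
    rw [this, Set.ncard_singleton]
  · have : {j | InvPair σ S i j ∧ j = i.rev} = ∅ := by
      ext j
      simp only [Set.mem_ofPred_eq, Set.mem_empty_iff_false, iff_false]
      rintro ⟨h3, rfl⟩
      exact h2 h3
    rw [this, Set.ncard_empty]

/-- The length of a decorated permutation. -/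
theorem two_mul_length_decElt (h : IsDecorated σ S) :
    2 * length (decElt σ S) +
      ((∑ i : Fin (2 * g), if i.val < g ∧ σ i ≠ i then 1 else 0) +
      (∑ i : Fin (2 * g), if i.val < g ∧ σ i ≠ i ∧ (i ∈ S ↔ σ⁻¹ i ∈ S) then 1 else 0) +
      (∑ i : Fin (2 * g), if i.val < g ∧ g ≤ (σ i).val then 1 else 0) + 2 * upCrossings σ S) =
      g * (g + 1) := by
  have h1 := alignments_eq h.up h.down
  have h2 := sum_invPair h
  have h3 := sum_invPair_rev h
  have h4 : invNum (decElt σ S) = (∑ i, ∑ j, if InvPair σ S i j then 1 else 0) +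
      ∑ i, if InvPair σ S i i.rev then 1 else 0 := by
    rw [invNum, Finset.sum_add_distrib]
    simp_rw [ncard_invSet_decElt h, ncard_selfInvSet_decElt h]
  have h5 : (∑ i, if σ i ≠ i then 1 else 0) =
      2 * ∑ i : Fin (2 * g), if i.val < g ∧ σ i ≠ i then 1 else 0 := by
    rw [sum_eq_sum_half, Finset.mul_sum]
    refine Finset.sum_congr rfl fun i _ => ?_
    simp only [h.map_rev, ne_eq, Fin.rev_inj]
    split_ifs <;> first | rfl | omega
  -- Seen from its end point, such an arc marks a turning index. Folding an index with its mirror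
  -- turns these into the opening and closing indices of the lower half, that is, the moved indices
  -- that are not double.
  have h6 : (∑ i : Fin (2 * g), if i ∉ S ∧ σ i ∈ S then 1 else 0) +
      (∑ i : Fin (2 * g), if i.val < g ∧ σ i ≠ i ∧ (i ∈ S ↔ σ⁻¹ i ∈ S) then 1 else 0) =
      ∑ i : Fin (2 * g), if i.val < g ∧ σ i ≠ i then 1 else 0 := by
    have e : (∑ i : Fin (2 * g), if i ∉ S ∧ σ i ∈ S then 1 else 0) =
        ∑ i : Fin (2 * g), if σ⁻¹ i ∉ S ∧ i ∈ S then 1 else 0 := by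
      rw [← Equiv.sum_comp σ (fun i => if σ⁻¹ i ∉ S ∧ i ∈ S then 1 else 0)]
      simp
    rw [e, sum_eq_sum_half, ← Finset.sum_add_distrib]
    refine Finset.sum_congr rfl fun i _ => ?_
    have e2 : σ i = i → σ⁻¹ i = i := fun h => by rw [Equiv.Perm.inv_eq_iff_eq, h]
    simp only [h.map_inv_rev, h.rev_mem]
    generalize σ⁻¹ i = j at e2 ⊢
    grind
  have h7 := h.downCrossings_eq
  -- The nesting sums in `alignments_eq` and `sum_invPair` cancel here.
  rw [two_mul_length h.isPermissible.1, h4, mul_add, mul_one]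
  omega

end Decorated

end GSpWeyl

namespace GSpWeyl

/-! ### Existence and uniqueness of noncrossing matchings -/

section NoncrossingMatchings

variable {α : Type*} [LinearOrder α]

/-- `f` matches `S` to `T` by noncrossing arcs going upwards. -/
structure IsNoncrossing (f : α → α) (S T : Finset α) : Prop where
  bijOn : Set.BijOn f S T
  lt : ∀ i ∈ S, i < f i
  noncrossing : ∀ i ∈ S, ∀ k ∈ S, k < i → i < f k → ¬ f k < f i

/-- Greedy construction from the right: the largest source takes the nearest target above it, and
the ballot condition survives the removal of both. -/
theorem exists_isNoncrossing (S : Finset α) : ∀ (T : Finset α), S.card = T.card →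
    (∀ t, (S.filter (t ≤ ·)).card ≤ (T.filter (t < ·)).card) → ∃ f, IsNoncrossing f S T := by
  induction S using Finset.induction_on_max with
  | empty =>
    intro T hT _
    have : T = ∅ := by
      rw [← Finset.card_eq_zero, ← hT, Finset.card_empty]
    subst this
    exact ⟨id, by simp, by simp, by simp⟩
  | insert a S ha ih =>
    intro T hT hb
    have haS : a ∉ S := fun h => lt_irrefl _ (ha a h)
    have hne : (T.filter (a < ·)).Nonempty := by
      rw [← Finset.card_pos]
      refine lt_of_lt_of_le ?_ (hb a)
      rw [Finset.card_pos]
      exact ⟨a, by simp⟩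
    set r := (T.filter (a < ·)).min' hne with hr
    have hrmem := Finset.min'_mem _ hne
    rw [← hr, Finset.mem_filter] at hrmem
    have hrmin : ∀ t ∈ T, a < t → r ≤ t := fun t ht hat =>
      Finset.min'_le _ _ (Finset.mem_filter.2 ⟨ht, hat⟩)
    obtain ⟨f, hf⟩ := ih (T.erase r) (by
      rw [Finset.card_erase_of_mem hrmem.1, ← hT, Finset.card_insert_of_notMem haS]
      rfl) (by
      intro t
      by_cases hta : t ≤ a
      · have h1 := hb t
        rw [Finset.filter_insert, if_pos hta, Finset.card_insert_of_notMem (by simp [haS])] at h1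
        have h2 : (T.erase r).filter (t < ·) = (T.filter (t < ·)).erase r := by
          ext
          simp only [Finset.mem_filter, Finset.mem_erase]
          tauto
        rw [h2, Finset.card_erase_of_mem (by
          rw [Finset.mem_filter]
          exact ⟨hrmem.1, lt_of_le_of_lt hta hrmem.2⟩)]
        omega
      · have h2 : S.filter (t ≤ ·) = ∅ := by
          rw [Finset.filter_eq_empty_iff]
          intro x hx hx'
          exact hta (hx'.trans (ha x hx).le)
        rw [h2, Finset.card_empty]
        exact Nat.zero_le _)
    have hfa : ∀ i ∈ S, Function.update f a r i = f i := fun i hi =>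
      Function.update_of_ne (ne_of_mem_of_not_mem hi haS) _ _
    have hmem : ∀ i ∈ S, f i ∈ T ∧ f i ≠ r := fun i hi => by
      have := hf.bijOn.mapsTo (Finset.mem_coe.2 hi)
      rw [Finset.mem_coe, Finset.mem_erase] at this
      exact ⟨this.2, this.1⟩
    refine ⟨Function.update f a r, ⟨?_, ?_, ?_⟩, ?_, ?_⟩
    · intro i hi
      rw [Finset.mem_coe, Finset.mem_insert] at hi
      rcases hi with rfl | hi
      · rw [Function.update_self]
        exact hrmem.1
      · rw [hfa i hi]
        exact (hmem i hi).1
    · intro i hi j hj hij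
      rw [Finset.mem_coe, Finset.mem_insert] at hi hj
      rcases hi with rfl | hi <;> rcases hj with rfl | hj
      · rfl
      · rw [Function.update_self, hfa j hj] at hij
        exact absurd hij.symm (hmem j hj).2
      · rw [Function.update_self, hfa i hi] at hij
        exact absurd hij (hmem i hi).2
      · rw [hfa i hi, hfa j hj] at hij
        exact hf.bijOn.injOn (Finset.mem_coe.2 hi) (Finset.mem_coe.2 hj) hij
    · intro t ht
      by_cases htr : t = r
      · exact ⟨a, by simp, by rw [Function.update_self, htr]⟩
      · obtain ⟨i, hi, rfl⟩ := hf.bijOn.surjOn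
          (Finset.mem_coe.2 (Finset.mem_erase.2 ⟨htr, Finset.mem_coe.1 ht⟩))
        exact ⟨i, by simp [Finset.mem_coe.1 hi], hfa i hi⟩
    · intro i hi
      rw [Finset.mem_insert] at hi
      rcases hi with rfl | hi
      · rw [Function.update_self]
        exact hrmem.2
      · rw [hfa i hi]
        exact hf.lt i hi
    · intro i hi k hk hki
      rw [Finset.mem_insert] at hi hk
      rcases hi with rfl | hi <;> rcases hk with rfl | hk
      · exact absurd hki (lt_irrefl _)
      · rw [Function.update_self, hfa k hk]
        exact fun h => not_lt.2 (hrmin _ (hmem k hk).1 h)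
      · exact absurd hki (ha i hi).not_gt
      · rw [hfa i hi, hfa k hk]
        exact hf.noncrossing i hi k hk hki

/-- At the largest source where they differ, the smaller of the two targets must be hit by the other
matching. From a smaller source this creates a crossing, and from a larger one it contradicts
injectivity. -/
theorem IsNoncrossing.eqOn {f f' : α → α} {S T : Finset α} (hf : IsNoncrossing f S T)
    (hf' : IsNoncrossing f' S T) : ∀ i ∈ S, f i = f' i := by
  classical
  by_contra! hc
  have hne : (S.filter fun i => f i ≠ f' i).Nonempty := by
    obtain ⟨i, hi, h⟩ := hc
    exact ⟨i, Finset.mem_filter.2 ⟨hi, h⟩⟩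
  obtain ⟨i, hi, hmax⟩ := Finset.exists_max_image _ id hne
  rw [Finset.mem_filter] at hi
  have hmax' : ∀ k ∈ S, i < k → f k = f' k := by
    intro k hk hik
    by_contra hne
    exact not_le.2 hik (hmax k (Finset.mem_filter.2 ⟨hk, hne⟩))
  have key : ∀ {p q : α → α}, IsNoncrossing p S T → IsNoncrossing q S T →
      (∀ k ∈ S, i < k → p k = q k) → ¬ p i < q i := by
    intro p q hp hq hpq hlt
    obtain ⟨k, hk, hki⟩ := hq.bijOn.surjOn (hp.bijOn.mapsTo (Finset.mem_coe.2 hi.1))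
    rw [Finset.mem_coe] at hk
    rcases lt_trichotomy k i with h | rfl | h
    · apply hq.noncrossing i hi.1 k hk h
      · rw [hki]
        exact hp.lt i hi.1
      · rwa [hki]
    · exact hlt.ne hki.symm
    · have h1 : p k = p i := (hpq k hk h).trans hki
      exact h.ne' (hp.bijOn.injOn (Finset.mem_coe.2 hk) (Finset.mem_coe.2 hi.1) h1)
  rcases lt_or_gt_of_ne hi.2 with h | h
  · exact key hf hf' hmax' h
  · exact key hf' hf (fun k hk hik => (hmax' k hk hik).symm) h

end NoncrossingMatchings

end GSpWeyl

namespace GSpWeyl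

/-! ### Words and lattice path conditions -/

section Words

/-- Letters of words: for an index `t` of a decorated permutation `(σ, S)`, they record whether
`t ∈ S`, whether `σ⁻¹ t ∈ S` and whether `σ t = t`. -/
abbrev Letter : Type := Bool × Bool × Bool

namespace Letter

/-- An arc starts to the right and one arrives from the right. -/
def IsOpen (x : Letter) : Prop := x.2.2 = false ∧ x.1 = true ∧ x.2.1 = false

/-- An arc starts to the left and one arrives from the left. -/
def IsClose (x : Letter) : Prop := x.2.2 = false ∧ x.1 = false ∧ x.2.1 = true

/-- Both arcs go in the same direction. -/
def IsDouble (x : Letter) : Prop := x.2.2 = false ∧ x.1 = x.2.1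

instance : DecidablePred IsOpen := fun _ => inferInstanceAs (Decidable (_ ∧ _))
instance : DecidablePred IsClose := fun _ => inferInstanceAs (Decidable (_ ∧ _))
instance : DecidablePred IsDouble := fun _ => inferInstanceAs (Decidable (_ ∧ _))

end Letter

/-- Words describing paths from height `h` with `d` fixed letters, where closing and double letters
occur at positive height and the final height and the number of double letters add up to `e`. -/
def Accept : ∀ {n : ℕ} (_e _h _d : ℕ) (_c : Fin n → Letter), Prop
  | 0, e, h, d, _ => h = e ∧ d = 0
  | _ + 1, e, h, d, c =>
    if (c 0).2.2 = true then (c 0).1 = (c 0).2.1 ∧ 1 ≤ d ∧ Accept e h (d - 1) (Fin.tail c)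
    else if (c 0).IsOpen then Accept e (h + 1) d (Fin.tail c)
    else if (c 0).IsClose then 1 ≤ h ∧ Accept e (h - 1) d (Fin.tail c)
    else 1 ≤ h ∧ 1 ≤ e ∧ Accept (e - 1) h d (Fin.tail c)

/-- Unfolds the recursion into prefix inequalities and totals, the form that compares with arc
counts. The last clause supplies `1 ≤ e` at a double letter in the induction. -/
theorem accept_iff {n : ℕ} (e h d : ℕ) (c : Fin n → Letter) : Accept e h d c ↔
    (∀ t, (∑ i, if i < t ∧ (c i).IsClose then 1 else 0) +
      (if (c t).IsClose ∨ (c t).IsDouble then 1 else 0) ≤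
        h + ∑ i, if i < t ∧ (c i).IsOpen then 1 else 0) ∧
    (∀ t, (c t).2.2 = true → (c t).1 = (c t).2.1) ∧
    (∑ i, if (c i).2.2 = true then 1 else 0) = d ∧
    (h + (∑ i, if (c i).IsOpen then 1 else 0) + (∑ i, if (c i).IsDouble then 1 else 0) =
      e + ∑ i, if (c i).IsClose then 1 else 0) ∧
    (∑ i, if (c i).IsDouble then 1 else 0) ≤ e := by
  induction n generalizing e h d with
  | zero =>
    simp [Accept]
    omega
  | succ n ih =>
    have ih' := fun e h d => ih e h d (fun i => c i.succ)
    beta_reduce at ih'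
    have htail : Fin.tail c = fun i => c i.succ := rfl
    simp only [Fin.sum_univ_succ, Fin.forall_fin_succ, Accept, htail, ih', Fin.succ_lt_succ_iff,
      Fin.succ_pos, true_and, Fin.not_lt_zero, false_and, if_false, lt_self_iff_false, add_zero,
      Finset.sum_const_zero]
    generalize c 0 = x
    by_cases hf : x.2.2 = true
    · have h1 : ¬ x.IsOpen := fun h => by simp [h.1] at hf
      have h2 : ¬ x.IsClose := fun h => by simp [h.1] at hf
      have h3 : ¬ x.IsDouble := fun h => by simp [h.1] at hf
      simp only [hf, h1, h2, h3, if_true, if_false, or_self, true_imp_iff, zero_add]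
      constructor
      · rintro ⟨a1, a2, a3, a4, a5, a6, a7⟩
        exact ⟨⟨by omega, a3⟩, ⟨a1, a4⟩, by omega, a6, a7⟩
      · rintro ⟨⟨-, a3⟩, ⟨a1, a4⟩, a5, a6, a7⟩
        exact ⟨a1, by omega, a3, a4, by omega, a6, a7⟩
    by_cases h1 : x.IsOpen
    · have h2 : ¬ x.IsClose := fun h => absurd (h.2.1.symm.trans h1.2.1) (by simp)
      have h3 : ¬ x.IsDouble := fun h => by
        have := h.2
        rw [h1.2.1, h1.2.2] at this
        simp at this
      simp only [hf, h1, h2, h3, if_true, if_false, or_self, Bool.false_eq_true,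
        false_imp_iff, true_and, zero_add]
      constructor
      · rintro ⟨a3, a4, a5, a6, a7⟩
        exact ⟨⟨by omega, fun t => by have := a3 t; omega⟩, a4, a5, by omega, a7⟩
      · rintro ⟨⟨-, a3⟩, a4, a5, a6, a7⟩
        exact ⟨fun t => by have := a3 t; omega, a4, a5, by omega, a7⟩
    by_cases h2 : x.IsClose
    · have h3 : ¬ x.IsDouble := fun h => by
        have := h.2
        rw [h2.2.1, h2.2.2] at this
        simp at this
      simp only [hf, h1, h2, h3, if_true, if_false, or_false, Bool.false_eq_true,
        false_imp_iff, true_and, zero_add]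
      constructor
      · rintro ⟨a2, a3, a4, a5, a6, a7⟩
        exact ⟨⟨a2, fun t => by have := a3 t; omega⟩, a4, a5, by omega, a7⟩
      · rintro ⟨⟨a2, a3⟩, a4, a5, a6, a7⟩
        exact ⟨a2, fun t => by have := a3 t; omega, a4, a5, by omega, a7⟩
    · have h3 : x.IsDouble := by
        obtain ⟨a, b, f⟩ := x
        simp only [Letter.IsOpen, Letter.IsClose, Letter.IsDouble] at *
        cases a <;> cases b <;> cases f <;> simp_all
      simp only [hf, h1, h2, h3, if_true, if_false, or_true, Bool.false_eq_true,
        false_imp_iff, true_and, zero_add]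
      constructor
      · rintro ⟨a1, a2, a3, a4, a5, a6, a7⟩
        exact ⟨⟨a1, a3⟩, a4, a5, by omega, by omega⟩
      · rintro ⟨⟨a1, a3⟩, a4, a5, a6, a7⟩
        exact ⟨a1, by omega, a3, a4, a5, by omega, by omega⟩

theorem sum_castLE {g : ℕ} (p : Fin (2 * g) → Prop) [DecidablePred p] :
    (∑ t : Fin g, if p (Fin.castLE (by omega) t) then 1 else 0) =
      ∑ i, if i.val < g ∧ p i then 1 else 0 := by
  simp_rw [← Finset.card_filter]
  rw [← Finset.card_map (Fin.castLEEmb (by omega : g ≤ 2 * g))]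
  congr 1
  ext i
  simp only [Finset.mem_map, Finset.mem_filter, Finset.mem_univ, true_and, Fin.coe_castLEEmb]
  constructor
  · rintro ⟨t, ht, rfl⟩
    exact ⟨t.isLt, ht⟩
  · rintro ⟨hi, hp⟩
    exact ⟨⟨i, hi⟩, hp, rfl⟩

theorem accept_castLE_iff {g : ℕ} (e d : ℕ) (x : Fin (2 * g) → Letter) :
    Accept e 0 d (fun t : Fin g => x (Fin.castLE (by omega) t)) ↔
    (∀ t : Fin (2 * g), t.val < g → (∑ i, if i < t ∧ (x i).IsClose then 1 else 0) +
      (if (x t).IsClose ∨ (x t).IsDouble then 1 else 0) ≤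
        ∑ i, if i < t ∧ (x i).IsOpen then 1 else 0) ∧
    (∀ t : Fin (2 * g), t.val < g → (x t).2.2 = true → (x t).1 = (x t).2.1) ∧
    (∑ i : Fin (2 * g), if i.val < g ∧ (x i).2.2 = true then 1 else 0) = d ∧
    ((∑ i : Fin (2 * g), if i.val < g ∧ (x i).IsOpen then 1 else 0) +
      (∑ i : Fin (2 * g), if i.val < g ∧ (x i).IsDouble then 1 else 0) =
      e + ∑ i : Fin (2 * g), if i.val < g ∧ (x i).IsClose then 1 else 0) ∧
    (∑ i : Fin (2 * g), if i.val < g ∧ (x i).IsDouble then 1 else 0) ≤ e := by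
  have hforall : ∀ q : Fin (2 * g) → Prop, (∀ t : Fin g, q (Fin.castLE (by omega) t)) ↔
      ∀ t : Fin (2 * g), t.val < g → q t :=
    fun q => ⟨fun h t ht => h ⟨t, ht⟩, fun h t => h _ t.isLt⟩
  have hlt : ∀ (p : Letter → Prop) [DecidablePred p] (t : Fin g),
      (∑ i : Fin g, if i < t ∧ p (x (Fin.castLE (by omega) i)) then 1 else 0) =
      ∑ i, if i < Fin.castLE (by omega) t ∧ p (x i) then 1 else 0 := by
    intro p _ t
    refine (sum_castLE fun i => i < Fin.castLE (by omega) t ∧ p (x i)).trans ?_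
    refine Finset.sum_congr rfl fun i _ => ?_
    congr 1
    apply propext
    have := t.isLt
    rw [Fin.lt_def, Fin.val_castLE]
    constructor
    · exact fun h => h.2
    · exact fun h => ⟨by omega, h⟩
  rw [accept_iff, sum_castLE fun i => (x i).2.2 = true, sum_castLE fun i => (x i).IsOpen,
    sum_castLE fun i => (x i).IsDouble, sum_castLE fun i => (x i).IsClose]
  simp_rw [hlt, zero_add]
  rw [← hforall, ← hforall]

end Words

end GSpWeyl

namespace GSpWeyl

/-! ### From noncrossing decorated permutations to words -/

section Encoding

variable {g : ℕ} {σ : Equiv.Perm (Fin (2 * g))} {S : Finset (Fin (2 * g))}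

/-- The letter of a decorated permutation at an index. -/
def letter (σ : Equiv.Perm (Fin (2 * g))) (S : Finset (Fin (2 * g))) (i : Fin (2 * g)) : Letter :=
  (decide (i ∈ S), decide (σ⁻¹ i ∈ S), decide (σ i = i))

theorem isOpen_letter (i : Fin (2 * g)) :
    (letter σ S i).IsOpen ↔ σ i ≠ i ∧ i ∈ S ∧ σ⁻¹ i ∉ S := by
  simp only [letter, Letter.IsOpen, decide_eq_false_iff_not, decide_eq_true_eq, ne_eq]

theorem isClose_letter (i : Fin (2 * g)) :
    (letter σ S i).IsClose ↔ σ i ≠ i ∧ i ∉ S ∧ σ⁻¹ i ∈ S := by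
  simp only [letter, Letter.IsClose, decide_eq_false_iff_not, decide_eq_true_eq, ne_eq]

theorem isDouble_letter (i : Fin (2 * g)) :
    (letter σ S i).IsDouble ↔ σ i ≠ i ∧ (i ∈ S ↔ σ⁻¹ i ∈ S) := by
  simp only [letter, Letter.IsDouble, decide_eq_false_iff_not, decide_eq_decide, ne_eq]

/-- The word of a decorated permutation. -/
def word (σ : Equiv.Perm (Fin (2 * g))) (S : Finset (Fin (2 * g))) : Fin g → Letter :=
  fun t => letter σ S (Fin.castLE (by omega) t)

/-- The number of indices in the lower half whose letter is double or whose arc crosses the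
axis. -/
def excess (σ : Equiv.Perm (Fin (2 * g))) (S : Finset (Fin (2 * g))) : ℕ :=
  (∑ i : Fin (2 * g), if i.val < g ∧ σ i ≠ i ∧ (i ∈ S ↔ σ⁻¹ i ∈ S) then 1 else 0) +
    ∑ i : Fin (2 * g), if i.val < g ∧ g ≤ (σ i).val then 1 else 0

/-- The number of fixed points in the lower half. -/
def fixedCount (σ : Equiv.Perm (Fin (2 * g))) : ℕ :=
  ∑ i : Fin (2 * g), if i.val < g ∧ σ i = i then 1 else 0

/-- The noncrossing decorated permutations of given excess and number of fixed points. -/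
def noncrossingSet (g e d : ℕ) : Set (Equiv.Perm (Fin (2 * g)) × Finset (Fin (2 * g))) :=
  {p | IsDecorated p.1 p.2 ∧ upCrossings p.1 p.2 = 0 ∧ fixedCount p.1 = d ∧ excess p.1 p.2 = e}

theorem inv_apply_eq_self_iff (i : Fin (2 * g)) : σ⁻¹ i = i ↔ σ i = i := by
  rw [Equiv.Perm.inv_eq_iff_eq, eq_comm]

/-- Openings are balanced by closings and by arcs over the threshold. -/
theorem IsDecorated.sum_isOpen_letter (h : IsDecorated σ S) (N : ℕ) :
    (∑ i : Fin (2 * g), if i.val < N ∧ (letter σ S i).IsOpen then 1 else 0) =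
      (∑ i : Fin (2 * g), if i.val < N ∧ (letter σ S i).IsClose then 1 else 0) +
        ∑ i : Fin (2 * g), if i.val < N ∧ N ≤ (σ i).val then 1 else 0 := by
  have h1 : (∑ i : Fin (2 * g), if i.val < N ∧ σ i ≠ i ∧ σ⁻¹ i ∈ S then 1 else 0) =
      ∑ i : Fin (2 * g), if (σ i).val < N ∧ σ i ≠ i ∧ i ∈ S then 1 else 0 := by
    rw [← Equiv.sum_comp σ]
    refine Finset.sum_congr rfl fun i _ => ?_
    rw [show σ⁻¹ (σ i) = i from σ.symm_apply_apply i]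
    simp only [σ.injective.ne_iff]
  have h2 : ∀ i : Fin (2 * g), (if i.val < N ∧ σ i ≠ i ∧ i ∈ S then 1 else 0) =
      (if (σ i).val < N ∧ σ i ≠ i ∧ i ∈ S then 1 else 0) +
        if i.val < N ∧ N ≤ (σ i).val then 1 else 0 := by
    intro i
    have hu := h.up i
    have hd := h.down i
    rw [Fin.le_def] at hu hd
    by_cases hi : i ∈ S
    · have := hu hi
      by_cases he : σ i = i
      · simp [hi, he]
      · simp only [hi, he, ne_eq, not_false_eq_true, and_true]
        split_ifs <;> omega
    · have := hd hi
      simp only [hi, and_false, if_false, zero_add]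
      rw [if_neg]
      omega
  have h3 : ∀ i : Fin (2 * g),
      (if i.val < N ∧ (letter σ S i).IsOpen then 1 else 0) +
        (if i.val < N ∧ σ i ≠ i ∧ σ⁻¹ i ∈ S then 1 else 0) =
      (if i.val < N ∧ (letter σ S i).IsClose then 1 else 0) +
        if i.val < N ∧ σ i ≠ i ∧ i ∈ S then 1 else 0 := by
    intro i
    simp only [isOpen_letter, isClose_letter]
    generalize σ⁻¹ i = j
    by_cases hi : i ∈ S <;> by_cases hj : j ∈ S <;> by_cases he : σ i = i <;>
      by_cases hN : i.val < N <;> simp [hi, hj, he, hN]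
  have h4 := Finset.sum_congr (rfl : (Finset.univ : Finset (Fin (2 * g))) = _) fun i _ => h3 i
  rw [Finset.sum_add_distrib, Finset.sum_add_distrib, h1,
    Finset.sum_congr (rfl : (Finset.univ : Finset (Fin (2 * g))) = _) fun i _ => h2 i,
    Finset.sum_add_distrib] at h4
  omega

/-- Otherwise σ would permute the finite set of indices below t, leaving no room for the value σ t.
-/
theorem exists_lt_le_apply {t : Fin (2 * g)} (ht : σ t < t) : ∃ i, i < t ∧ t ≤ σ i := by
  by_contra! hc
  have h1 : Set.MapsTo σ (Set.Iio t) (Set.Iio t) := fun i hi => hc i hi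
  obtain ⟨i, hi, hit⟩ :=
    (((Set.toFinite _).injOn_iff_bijOn_of_mapsTo h1).1 σ.injective.injOn).surjOn ht
  rw [σ.injective hit] at hi
  exact lt_irrefl _ (Set.mem_Iio.1 hi)

theorem IsDecorated.exists_arc_over (h : IsDecorated σ S) {t : Fin (2 * g)}
    (ht : (letter σ S t).IsClose ∨ (letter σ S t).IsDouble) : ∃ i, i < t ∧ t ≤ σ i := by
  rw [isClose_letter, isDouble_letter] at ht
  have hne : σ t ≠ t := by tauto
  by_cases hS : σ⁻¹ t ∈ S
  · have h1 : σ (σ⁻¹ t) = t := by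
      rw [← Equiv.Perm.mul_apply, mul_inv_cancel, Equiv.Perm.one_apply]
    refine ⟨σ⁻¹ t, lt_of_le_of_ne ?_ ?_, h1.ge⟩
    · have := h.up _ hS
      rwa [h1] at this
    · rw [ne_eq, inv_apply_eq_self_iff]
      exact hne
  · exact exists_lt_le_apply (lt_of_le_of_ne (h.down t (by tauto)) hne)

/-- The height before t is the number of arcs from below t to t or beyond, and `exists_arc_over`
makes it positive at closing and double letters. At the axis the height counts the crossing arcs, so
the final condition is the definition of the excess. -/
theorem accept_word {e d : ℕ} (h : (σ, S) ∈ noncrossingSet g e d) :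
    Accept e 0 d (word σ S) := by
  obtain ⟨h, -, hd, he⟩ := h
  dsimp only at h hd he
  have hg := h.sum_isOpen_letter g
  refine (accept_castLE_iff e d (letter σ S)).2 ⟨fun t _ => ?_, fun t _ ht => ?_, ?_, ?_, ?_⟩
  · have h1 := h.sum_isOpen_letter t.val
    simp_rw [← Fin.lt_def] at h1
    rw [h1]
    refine Nat.add_le_add_left ?_ _
    split_ifs with ht
    · obtain ⟨i, hi, hti⟩ := h.exists_arc_over ht
      refine le_trans ?_ (Finset.single_le_sum (fun _ _ => Nat.zero_le _) (Finset.mem_univ i))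
      rw [if_pos ⟨hi, hti⟩]
    · exact Nat.zero_le _
  · simp only [letter, decide_eq_true_eq] at ht
    simp only [letter, (inv_apply_eq_self_iff t).2 ht]
  · rw [← hd, fixedCount]
    simp only [letter, decide_eq_true_eq]
  · rw [← he, excess, hg]
    simp_rw [isDouble_letter]
    omega
  · rw [← he, excess]
    simp_rw [isDouble_letter]
    omega

theorem IsDecorated.isNoncrossing (h : IsDecorated σ S) (hc : upCrossings σ S = 0) :
    IsNoncrossing σ (Finset.univ.filter fun i => i ∈ S ∧ σ i ≠ i)
      (Finset.univ.filter fun i => σ⁻¹ i ∈ S ∧ σ i ≠ i) := by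
  refine ⟨⟨?_, σ.injective.injOn, ?_⟩, ?_, ?_⟩
  · intro i hi
    simp only [Finset.coe_filter, Finset.mem_univ, true_and, Set.mem_ofPred_eq] at hi ⊢
    rw [← Equiv.Perm.mul_apply, inv_mul_cancel, Equiv.Perm.one_apply, σ.injective.ne_iff]
    exact hi
  · intro i hi
    simp only [Finset.coe_filter, Finset.mem_univ, true_and, Set.mem_ofPred_eq] at hi
    have h1 : σ (σ⁻¹ i) = i := by
      rw [← Equiv.Perm.mul_apply, mul_inv_cancel, Equiv.Perm.one_apply]
    refine ⟨σ⁻¹ i, ?_, h1⟩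
    simp only [Finset.coe_filter, Finset.mem_univ, true_and, Set.mem_ofPred_eq]
    refine ⟨hi.1, fun h2 => hi.2 ?_⟩
    rw [h1] at h2
    rw [← inv_apply_eq_self_iff]
    exact h2.symm
  · intro i hi
    rw [Finset.mem_filter] at hi
    exact lt_of_le_of_ne (h.up i hi.2.1) hi.2.2.symm
  · intro i hi k hk h1 h2 h3
    rw [Finset.mem_filter] at hi hk
    have h4 := Finset.sum_eq_zero_iff.1 (Finset.sum_eq_zero_iff.1 hc i (Finset.mem_univ i)) k
      (Finset.mem_univ k)
    rw [if_pos ⟨hi.2.1, hk.2.1, h1, h2, h3⟩] at h4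
    exact one_ne_zero h4

theorem forall_of_forall_lt {P : Fin (2 * g) → Prop} (h : ∀ i, i.val < g → P i)
    (hrev : ∀ i, P i → P i.rev) (i : Fin (2 * g)) : P i := by
  by_cases hi : i.val < g
  · exact h i hi
  · rw [← Fin.rev_rev i]
    refine hrev _ (h _ ?_)
    rw [Fin.val_rev]
    omega

/-- The word gives the letters in the lower half, and symmetry gives the others. They determine S,
the fixed points, and the sources and targets of the up arcs. The up arcs follow from uniqueness of
noncrossing matchings, the down arcs by reversal. -/
theorem word_injOn (e d : ℕ) :
    Set.InjOn (fun p : Equiv.Perm (Fin (2 * g)) × Finset (Fin (2 * g)) => word p.1 p.2)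
      (noncrossingSet g e d) := by
  rintro ⟨σ, S⟩ ⟨h, hc, -, -⟩ ⟨τ, R⟩ ⟨h', hc', -, -⟩ hw
  dsimp only at h hc h' hc' hw
  have hl : ∀ i, (i ∈ S ↔ i ∈ R) ∧ (σ⁻¹ i ∈ S ↔ τ⁻¹ i ∈ R) ∧ (σ i = i ↔ τ i = i) := by
    refine forall_of_forall_lt (fun i hi => ?_) fun i hi => ?_
    · have := congrFun hw ⟨i, hi⟩
      simp only [word, letter, Prod.mk.injEq, decide_eq_decide] at this
      exact this
    · rw [h.map_inv_rev, h'.map_inv_rev, h.map_rev, h'.map_rev, h.rev_mem, h'.rev_mem, h.rev_mem,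
        h'.rev_mem, Fin.rev_inj, Fin.rev_inj]
      tauto
  have hSR : S = R := Finset.ext fun i => (hl i).1
  subst hSR
  have e1 : (Finset.univ.filter fun i => i ∈ S ∧ τ i ≠ i) =
      Finset.univ.filter fun i => i ∈ S ∧ σ i ≠ i :=
    Finset.filter_congr fun i _ => by rw [ne_eq, ne_eq, (hl i).2.2]
  have e2 : (Finset.univ.filter fun i => τ⁻¹ i ∈ S ∧ τ i ≠ i) =
      Finset.univ.filter fun i => σ⁻¹ i ∈ S ∧ σ i ≠ i :=
    Finset.filter_congr fun i _ => by rw [ne_eq, ne_eq, (hl i).2.2, (hl i).2.1]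
  have hn := h.isNoncrossing hc
  have hn' := h'.isNoncrossing hc'
  rw [e1, e2] at hn'
  have hS : ∀ i ∈ S, σ i = τ i := by
    intro i hi
    by_cases hf : σ i = i
    · rw [hf, (hl i).2.2.1 hf]
    · exact hn.eqOn hn' i (by simp [hi, hf])
  have : σ = τ := by
    refine Equiv.ext fun i => ?_
    by_cases hi : i ∈ S
    · exact hS i hi
    · have := hS i.rev ((h.rev_mem i).2 hi)
      rwa [h.map_rev, h'.map_rev, Fin.rev_inj] at this
  rw [this]

end Encoding

end GSpWeyl

namespace GSpWeyl

/-! ### From words back to permutations -/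

section Decoding

variable {g : ℕ}

/-- The letter at the reversed index. -/
def Letter.flip (x : Letter) : Letter := (!x.1, !x.2.1, x.2.2)

/-- The symmetric extension of a word to all indices. -/
def mirror (c : Fin g → Letter) (i : Fin (2 * g)) : Letter :=
  if h : i.val < g then c ⟨i, h⟩
  else (c ⟨i.rev, by rw [Fin.val_rev]; omega⟩).flip

theorem mirror_castLE (c : Fin g → Letter) (t : Fin g) :
    mirror c (Fin.castLE (by omega) t) = c t := by
  simp [mirror]

theorem mirror_rev (c : Fin g → Letter) (i : Fin (2 * g)) :
    mirror c i.rev = (mirror c i).flip := by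
  have h1 := i.isLt
  by_cases h : i.val < g
  · have h2 : ¬ i.rev.val < g := by
      rw [Fin.val_rev]
      omega
    simp only [mirror, h, h2, dif_pos, dif_neg, not_false_eq_true, Fin.rev_rev]
  · have h2 : i.rev.val < g := by
      rw [Fin.val_rev]
      omega
    simp only [mirror, h, h2, dif_pos, dif_neg, not_false_eq_true, Letter.flip, Bool.not_not]

theorem sum_le_eq_sum_lt_add {n : ℕ} (p : Fin n → Prop) [DecidablePred p] (t : Fin n) :
    (∑ i, if i ≤ t ∧ p i then 1 else 0) =
      (∑ i, if i < t ∧ p i then 1 else 0) + if p t then 1 else 0 := by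
  have h1 : (if p t then 1 else 0) = ∑ i, if i = t then (if p i then 1 else 0) else 0 := by
    rw [Finset.sum_ite_eq' Finset.univ t, if_pos (Finset.mem_univ t)]
  rw [h1, ← Finset.sum_add_distrib]
  refine Finset.sum_congr rfl fun i _ => ?_
  rcases lt_trichotomy i t with h | rfl | h
  · simp [h, h.le, h.ne]
  · simp
  · simp [h.not_gt, h.not_ge, h.ne']

variable {x : Fin (2 * g) → Letter}

/-- The starting points of the upward arcs. -/
def arcSources (x : Fin (2 * g) → Letter) : Finset (Fin (2 * g)) :=
  Finset.univ.filter fun i => (x i).1 = true ∧ (x i).2.2 = false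

/-- The end points of the upward arcs. -/
def arcTargets (x : Fin (2 * g) → Letter) : Finset (Fin (2 * g)) :=
  Finset.univ.filter fun i => (x i).2.1 = true ∧ (x i).2.2 = false

theorem card_arcSources_eq (hx : ∀ i, x i.rev = (x i).flip) :
    (arcSources x).card = (arcTargets x).card := by
  rw [arcSources, arcTargets, Finset.card_filter, Finset.card_filter, sum_eq_sum_half,
    sum_eq_sum_half fun i => if (x i).2.1 = true ∧ (x i).2.2 = false then 1 else 0]
  refine Finset.sum_congr rfl fun i _ => ?_
  rw [hx]
  obtain ⟨a, b, f⟩ := x i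
  cases a <;> cases b <;> cases f <;> rfl

/-- The ballot condition for the up arcs. Below the axis, passing to complements turns it into the
height condition at t. Above the axis, reversal turns it into the height condition at the mirror of
t, now for down arcs. This is why both kinds of double letter need positive height. -/
theorem card_arcSources_le (hx : ∀ i, x i.rev = (x i).flip)
    (hb : ∀ t : Fin (2 * g), t.val < g → (∑ i, if i < t ∧ (x i).IsClose then 1 else 0) +
      (if (x t).IsClose ∨ (x t).IsDouble then 1 else 0) ≤
        ∑ i, if i < t ∧ (x i).IsOpen then 1 else 0) (t : Fin (2 * g)) :
    ((arcSources x).filter (t ≤ ·)).card ≤ ((arcTargets x).filter (t < ·)).card := by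
  by_cases ht : t.val < g
  · have h1 : ((arcSources x).filter (t ≤ ·)).card + ((arcSources x).filter (¬ t ≤ ·)).card =
        (arcSources x).card := Finset.card_filter_add_card_filter_not _
    have h2 : ((arcTargets x).filter (t < ·)).card + ((arcTargets x).filter (¬ t < ·)).card =
        (arcTargets x).card := Finset.card_filter_add_card_filter_not _
    have h3 : ((arcSources x).filter (¬ t ≤ ·)).card =
        ∑ i, if i < t ∧ ((x i).1 = true ∧ (x i).2.2 = false) then 1 else 0 := by
      rw [arcSources, Finset.filter_filter, Finset.card_filter]
      simp_rw [not_le, and_comm (a := _ < t)]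
    have h4 : ((arcTargets x).filter (¬ t < ·)).card =
        ∑ i, if i ≤ t ∧ ((x i).2.1 = true ∧ (x i).2.2 = false) then 1 else 0 := by
      rw [arcTargets, Finset.filter_filter, Finset.card_filter]
      simp_rw [not_lt, and_comm (a := _ ≤ t)]
    rw [sum_le_eq_sum_lt_add] at h4
    have h5 : (∑ i, if i < t ∧ ((x i).2.1 = true ∧ (x i).2.2 = false) then 1 else 0) +
        (∑ i, if i < t ∧ (x i).IsOpen then 1 else 0) =
        (∑ i, if i < t ∧ ((x i).1 = true ∧ (x i).2.2 = false) then 1 else 0) +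
        ∑ i, if i < t ∧ (x i).IsClose then 1 else 0 := by
      rw [← Finset.sum_add_distrib, ← Finset.sum_add_distrib]
      refine Finset.sum_congr rfl fun i _ => ?_
      by_cases hi : i < t
      · simp only [hi, true_and]
        generalize x i = y
        obtain ⟨a, b, f⟩ := y
        cases a <;> cases b <;> cases f <;> rfl
      · simp only [hi, false_and, if_false]
    have h6 : (if (x t).2.1 = true ∧ (x t).2.2 = false then 1 else 0) ≤
        if (x t).IsClose ∨ (x t).IsDouble then 1 else 0 := by
      generalize x t = y
      obtain ⟨a, b, f⟩ := y
      cases a <;> cases b <;> cases f <;> decide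
    have h7 := hb t ht
    have h8 := card_arcSources_eq hx
    omega
  · have hr : t.rev.val < g := by
      have := t.isLt
      rw [Fin.val_rev]
      omega
    have h3 : ((arcSources x).filter (t ≤ ·)).card =
        ∑ i, if i ≤ t.rev ∧ ((x i).1 = false ∧ (x i).2.2 = false) then 1 else 0 := by
      rw [arcSources, Finset.filter_filter, Finset.card_filter, ← Equiv.sum_comp Fin.revPerm]
      refine Finset.sum_congr rfl fun i _ => ?_
      simp only [Fin.revPerm_apply, hx, Letter.flip, Bool.not_eq_true', Fin.le_rev_iff,
        and_comm (a := t ≤ i.rev)]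
    have h4 : ((arcTargets x).filter (t < ·)).card =
        ∑ i, if i < t.rev ∧ ((x i).2.1 = false ∧ (x i).2.2 = false) then 1 else 0 := by
      rw [arcTargets, Finset.filter_filter, Finset.card_filter, ← Equiv.sum_comp Fin.revPerm]
      refine Finset.sum_congr rfl fun i _ => ?_
      simp only [Fin.revPerm_apply, hx, Letter.flip, Bool.not_eq_true', Fin.lt_rev_iff,
        and_comm (a := t < i.rev)]
    rw [sum_le_eq_sum_lt_add] at h3
    have h5 : (∑ i, if i < t.rev ∧ ((x i).1 = false ∧ (x i).2.2 = false) then 1 else 0) +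
        (∑ i, if i < t.rev ∧ (x i).IsOpen then 1 else 0) =
        (∑ i, if i < t.rev ∧ ((x i).2.1 = false ∧ (x i).2.2 = false) then 1 else 0) +
        ∑ i, if i < t.rev ∧ (x i).IsClose then 1 else 0 := by
      rw [← Finset.sum_add_distrib, ← Finset.sum_add_distrib]
      refine Finset.sum_congr rfl fun i _ => ?_
      by_cases hi : i < t.rev
      · simp only [hi, true_and]
        generalize x i = y
        obtain ⟨a, b, f⟩ := y
        cases a <;> cases b <;> cases f <;> rfl
      · simp only [hi, false_and, if_false]
    have h6 : (if (x t.rev).1 = false ∧ (x t.rev).2.2 = false then 1 else 0) ≤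
        if (x t.rev).IsClose ∨ (x t.rev).IsDouble then 1 else 0 := by
      generalize x t.rev = y
      obtain ⟨a, b, f⟩ := y
      cases a <;> cases b <;> cases f <;> decide
    have h7 := hb t.rev hr
    omega

/-- The map with the given fixed points and upward arcs that commutes with reversal. -/
def arcMap (x : Fin (2 * g) → Letter) (f : Fin (2 * g) → Fin (2 * g)) (i : Fin (2 * g)) :
    Fin (2 * g) :=
  if (x i).2.2 = true then i else if (x i).1 = true then f i else (f i.rev).rev

/-- Up arcs come from the matching and down arcs are their mirror images. The resulting map carries
the outgoing direction and the fixed flag of i to the incoming data of its image (`hB`), so two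
preimages of a point are of the same type and injectivity reduces to that of f. -/
theorem exists_perm_letter_eq (hx : ∀ i, x i.rev = (x i).flip)
    (hfix : ∀ i, (x i).2.2 = true → (x i).1 = (x i).2.1) {f : Fin (2 * g) → Fin (2 * g)}
    (hf : IsNoncrossing f (arcSources x) (arcTargets x)) :
    ∃ σ S, IsDecorated σ S ∧ upCrossings σ S = 0 ∧ ∀ i, letter σ S i = x i := by
  have hup : ∀ i, (x i).1 = true → (x i).2.2 = false →
      i < f i ∧ (x (f i)).2.1 = true ∧ (x (f i)).2.2 = false := by
    intro i h1 h2
    have hi : i ∈ arcSources x := Finset.mem_filter.2 ⟨Finset.mem_univ i, h1, h2⟩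
    have h3 := hf.bijOn.mapsTo (Finset.mem_coe.2 hi)
    rw [Finset.mem_coe, arcTargets, Finset.mem_filter] at h3
    exact ⟨hf.lt i hi, h3.2⟩
  have hrev : ∀ i, arcMap x f i.rev = (arcMap x f i).rev := by
    intro i
    simp only [arcMap, hx, Letter.flip, Fin.rev_rev]
    cases (x i).2.2 <;> cases (x i).1 <;> simp
  have hA : ∀ i, (x i).1 = true → i ≤ arcMap x f i ∧ (x (arcMap x f i)).2.1 = true ∧
      (x (arcMap x f i)).2.2 = (x i).2.2 ∧ (arcMap x f i = i → (x i).2.2 = true) := by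
    intro i h1
    by_cases h2 : (x i).2.2 = true
    · have h3 : arcMap x f i = i := by rw [arcMap, if_pos h2]
      rw [h3, ← hfix i h2]
      exact ⟨le_rfl, h1, rfl, fun _ => h2⟩
    · have h3 : arcMap x f i = f i := by rw [arcMap, if_neg h2, if_pos h1]
      rw [Bool.not_eq_true] at h2
      obtain ⟨h4, h5, h6⟩ := hup i h1 h2
      rw [h3, h2]
      exact ⟨h4.le, h5, h6, fun h => absurd h h4.ne'⟩
  have hB : ∀ i, (x (arcMap x f i)).2.1 = (x i).1 ∧ (x (arcMap x f i)).2.2 = (x i).2.2 ∧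
      (arcMap x f i = i → (x i).2.2 = true) := by
    intro i
    by_cases h1 : (x i).1 = true
    · rw [h1]
      exact (hA i h1).2
    · rw [Bool.not_eq_true] at h1
      obtain ⟨-, h2, h3, h4⟩ := hA i.rev (by rw [hx, Letter.flip, h1]; rfl)
      rw [hrev, hx] at h2 h3
      rw [hrev, Fin.rev_inj] at h4
      rw [hx] at h3 h4
      simp only [Letter.flip, Bool.not_eq_true'] at h2 h3 h4
      rw [h1]
      exact ⟨h2, h3, h4⟩
  have hinj1 : ∀ i j, (x i).1 = true → arcMap x f i = arcMap x f j → i = j := by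
    intro i j h1 hij
    have h2 : (x j).1 = true := by rw [← (hB j).1, ← hij, (hB i).1, h1]
    have h3 : (x j).2.2 = (x i).2.2 := by rw [← (hB j).2.1, ← hij, (hB i).2.1]
    by_cases h4 : (x i).2.2 = true
    · rwa [arcMap, arcMap, if_pos h4, if_pos (h3.trans h4)] at hij
    · rw [arcMap, arcMap, h3, h1, h2, if_neg h4, if_neg h4, if_pos rfl, if_pos rfl] at hij
      rw [Bool.not_eq_true] at h4
      refine hf.bijOn.injOn ?_ ?_ hij
      · exact Finset.mem_coe.2 (Finset.mem_filter.2 ⟨Finset.mem_univ _, h1, h4⟩)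
      · exact Finset.mem_coe.2 (Finset.mem_filter.2 ⟨Finset.mem_univ _, h2, h3.trans h4⟩)
  have hinj : Function.Injective (arcMap x f) := by
    intro i j hij
    by_cases h1 : (x i).1 = true
    · exact hinj1 i j h1 hij
    · rw [Bool.not_eq_true] at h1
      refine Fin.rev_injective (hinj1 i.rev j.rev ?_ ?_)
      · rw [hx, Letter.flip, h1]
        rfl
      · rw [hrev, hrev, hij]
  let σ : Equiv.Perm (Fin (2 * g)) :=
    Equiv.ofBijective _ (Finite.injective_iff_bijective.1 hinj)
  have hσ : ∀ i, σ i = arcMap x f i := fun i => rfl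
  have hmem : ∀ i, i ∈ Finset.univ.filter (fun i => (x i).1 = true) ↔ (x i).1 = true := by simp
  refine ⟨σ, Finset.univ.filter fun i => (x i).1 = true, ⟨hrev, fun i => ?_, fun i hi => ?_,
    fun i hi => ?_⟩, ?_, fun i => ?_⟩
  · rw [hmem, hmem, hx, Letter.flip, Bool.not_eq_true', Bool.not_eq_true]
  · exact (hA i ((hmem i).1 hi)).1
  · rw [hmem, Bool.not_eq_true] at hi
    have := (hA i.rev (by rw [hx, Letter.flip, hi]; rfl)).1
    rw [hrev, Fin.rev_le_rev] at this
    exact this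
  · refine Finset.sum_eq_zero fun i _ => Finset.sum_eq_zero fun k _ => ?_
    rw [if_neg]
    rintro ⟨hi, hk, h1, h2, h3⟩
    rw [hmem] at hi hk
    have h4 : ∀ j, (x j).1 = true → j < σ j → j ∈ arcSources x ∧ σ j = f j := by
      intro j hj hlt
      have h5 : ¬ (x j).2.2 = true := by
        intro h
        rw [hσ, arcMap, if_pos h] at hlt
        exact lt_irrefl _ hlt
      rw [hσ, arcMap, if_neg h5, if_pos hj]
      rw [Bool.not_eq_true] at h5
      exact ⟨Finset.mem_filter.2 ⟨Finset.mem_univ _, hj, h5⟩, rfl⟩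
    obtain ⟨hk1, hk2⟩ := h4 k hk (h1.trans h2)
    obtain ⟨hi1, hi2⟩ := h4 i hi (h2.trans h3)
    rw [hk2] at h2 h3
    rw [hi2] at h3
    exact hf.noncrossing i hi1 k hk1 h1 h2 h3
  · have h1 : decide (i ∈ Finset.univ.filter fun i => (x i).1 = true) = (x i).1 := by simp
    have h2 : decide (σ⁻¹ i ∈ Finset.univ.filter fun i => (x i).1 = true) = (x i).2.1 := by
      have h3 : σ (σ⁻¹ i) = i := by
        rw [← Equiv.Perm.mul_apply, mul_inv_cancel, Equiv.Perm.one_apply]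
      generalize σ⁻¹ i = j at h3 ⊢
      rw [← h3, hσ, (hB j).1]
      simp
    have h3 : decide (σ i = i) = (x i).2.2 := by
      rw [hσ]
      by_cases h4 : (x i).2.2 = true
      · rw [arcMap, if_pos h4, h4]
        simp
      · have h5 : ¬ arcMap x f i = i := fun h => h4 ((hB i).2.2 h)
        rw [Bool.not_eq_true] at h4
        simp [h4, h5]
    rw [letter, h1, h2, h3]

theorem exists_word_eq {e d : ℕ} {c : Fin g → Letter} (hc : Accept e 0 d c) :
    ∃ p ∈ noncrossingSet g e d, word p.1 p.2 = c := by
  have hc' : Accept e 0 d (fun t : Fin g => mirror c (Fin.castLE (by omega) t)) := by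
    simp_rw [mirror_castLE]
    exact hc
  obtain ⟨h1, h2, h3, h4, -⟩ := (accept_castLE_iff e d (mirror c)).1 hc'
  have hfix : ∀ i, (mirror c i).2.2 = true → (mirror c i).1 = (mirror c i).2.1 := by
    refine forall_of_forall_lt h2 fun i hi => ?_
    rw [mirror_rev]
    simp only [Letter.flip]
    intro h
    rw [hi h]
  obtain ⟨f, hf⟩ := exists_isNoncrossing _ _ (card_arcSources_eq (mirror_rev c))
    (card_arcSources_le (mirror_rev c) h1)
  obtain ⟨σ, S, hd, hcr, hl⟩ := exists_perm_letter_eq (mirror_rev c) hfix hf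
  refine ⟨(σ, S), ⟨hd, hcr, ?_, ?_⟩, ?_⟩
  · rw [← h3, fixedCount]
    simp_rw [← hl]
    simp [letter]
  · have h5 := hd.sum_isOpen_letter g
    simp_rw [← hl] at h4
    rw [h5] at h4
    simp_rw [isDouble_letter] at h4
    rw [excess]
    dsimp only
    omega
  · funext t
    rw [word, hl, mirror_castLE]

theorem ncard_noncrossingSet (g e d : ℕ) :
    (noncrossingSet g e d).ncard = {c : Fin g → Letter | Accept e 0 d c}.ncard := by
  rw [← (word_injOn e d).ncard_image]
  congr 1
  ext c
  constructor
  · rintro ⟨⟨σ, S⟩, hp, rfl⟩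
    exact accept_word hp
  · intro hc
    exact exists_word_eq hc

end Decoding

end GSpWeyl

namespace GSpWeyl

/-! ### Counting words and paths -/

section Counting

open Classical in
/-- The number of accepted words. -/
noncomputable def acceptCount (n e h d : ℕ) : ℕ :=
  ∑ c : Fin n → Letter, if Accept e h d c then 1 else 0

theorem ncard_accept (n e h d : ℕ) :
    {c : Fin n → Letter | Accept e h d c}.ncard = acceptCount n e h d := by
  classical
  rw [acceptCount, ← Finset.card_filter, ← Set.ncard_coe_finset]
  simp

theorem acceptCount_zero (e h d : ℕ) :
    acceptCount 0 e h d = if h = e ∧ d = 0 then 1 else 0 := by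
  rw [acceptCount, Fintype.sum_unique]
  congr 1

/-- Of the eight first letters, two are fixed letters with consistent flags, two are inconsistent,
one opens, one closes, and two are double. -/
theorem acceptCount_succ (n e h d : ℕ) : acceptCount (n + 1) e h d =
    2 * (if 1 ≤ d then acceptCount n e h (d - 1) else 0) + (acceptCount n e (h + 1) d +
      (if 1 ≤ h then acceptCount n e (h - 1) d else 0) +
      2 * if 1 ≤ h ∧ 1 ≤ e then acceptCount n (e - 1) h d else 0) := by
  classical
  have h1 : ∀ (p : Prop) [Decidable p] (e h d : ℕ),
      (∑ c : Fin n → Letter, if p ∧ Accept e h d c then 1 else 0) =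
        if p then acceptCount n e h d else 0 := by
    intro p _ e h d
    by_cases hp : p <;> simp [hp, acceptCount]
  have h2 : ∀ (p q : Prop) [Decidable p] [Decidable q] (e h d : ℕ),
      (∑ c : Fin n → Letter, if p ∧ q ∧ Accept e h d c then 1 else 0) =
        if p ∧ q then acceptCount n e h d else 0 := by
    intro p q _ _ e h d
    simp_rw [← and_assoc]
    exact h1 _ _ _ _
  rw [acceptCount, ← Equiv.sum_comp (Fin.consEquiv fun _ => Letter), Fintype.sum_prod_type,
    Fintype.sum_prod_type, Fintype.sum_bool]
  simp_rw [Fintype.sum_prod_type, Fintype.sum_bool]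
  have h3 : ∀ x (c : Fin n → Letter), Fin.consEquiv (fun _ => Letter) (x, c) =
    (Fin.cons x c : Fin (n + 1) → Letter) := fun _ _ => rfl
  have h4 : ∀ x (c : Fin n → Letter), Fin.tail (Fin.cons x c : Fin (n + 1) → Letter) = c :=
    fun _ _ => rfl
  have h5 : ∀ x (c : Fin n → Letter), (Fin.cons x c : Fin (n + 1) → Letter) 0 = x :=
    fun _ _ => rfl
  simp only [Accept, h3, h4, h5, Letter.IsOpen,
    Letter.IsClose, Bool.false_eq_true, Bool.true_eq_false, if_true, if_false, and_true, true_and,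
    and_false, false_and, Finset.sum_const_zero, h1, h2]
  rw [← acceptCount]
  ring

/-- The number of paths from height `h` with `m` steps up, down or level, where level steps occur
at positive height, have two colors, and their number and the final height add up to `e`. -/
def pathCount (e : ℕ) : ℕ → ℕ → ℕ
  | 0, h => if h = e then 1 else 0
  | m + 1, h => pathCount e m (h + 1) + (if 1 ≤ h then pathCount e m (h - 1) else 0) +
      2 * if 1 ≤ h ∧ 1 ≤ e then pathCount (e - 1) m h else 0

/-- Fixed letters do not affect the height, so d of them, in two decorations each, are inserted
freely into a path; the recursion is Pascal's rule. -/
theorem acceptCount_eq (n e h d : ℕ) :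
    acceptCount n e h d = 2 ^ d * n.choose d * pathCount e (n - d) h := by
  induction n generalizing e h d with
  | zero =>
    rw [acceptCount_zero]
    cases d <;> simp [pathCount]
  | succ n ih =>
    have h1 : ∀ m d, 2 ^ d * n.choose d * pathCount e (m + 1) h =
        2 ^ d * n.choose d * pathCount e m (h + 1) +
          (if 1 ≤ h then 2 ^ d * n.choose d * pathCount e m (h - 1) else 0) +
          2 * if 1 ≤ h ∧ 1 ≤ e then 2 ^ d * n.choose d * pathCount (e - 1) m h else 0 := by
      intro m d
      rw [pathCount, mul_add, mul_add, mul_ite, mul_left_comm _ 2, mul_ite, mul_zero]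
    rw [acceptCount_succ]
    simp_rw [ih]
    rw [← h1]
    cases d with
    | zero => simp
    | succ d =>
      rw [if_pos (by omega), Nat.add_sub_cancel, Nat.choose_succ_succ, Nat.add_sub_add_right]
      by_cases hdn : d + 1 ≤ n
      · rw [show n - (d + 1) + 1 = n - d by omega]
        ring
      · rw [Nat.choose_eq_zero_of_lt (show n < d + 1 by omega)]
        ring

theorem pathCount_zero_succ_zero (m : ℕ) : pathCount 0 (m + 1) 0 = pathCount 0 m 1 := by
  simp [pathCount]

theorem pathCount_zero_succ_succ (m h : ℕ) :
    pathCount 0 (m + 1) (h + 1) = pathCount 0 m (h + 2) + pathCount 0 m h := by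
  simp [pathCount]

/-- The ballot numbers as differences of binomial coefficients, written additively to avoid
truncated subtraction. -/
theorem pathCount_zero_add_choose (m : ℕ) : ∀ h j, m = h + 2 * j →
    pathCount 0 m h + m.choose (h + j + 1) = m.choose (h + j) := by
  have hlt : ∀ m h, m < h → pathCount 0 m h = 0 := by
    intro m
    induction m with
    | zero =>
      intro h hh
      rw [pathCount, if_neg (by omega)]
    | succ m ih =>
      intro h hh
      rw [pathCount, ih _ (by omega), ih _ (by omega)]
      simp
  induction m with
  | zero =>
    intro h j hm
    obtain ⟨rfl, rfl⟩ : h = 0 ∧ j = 0 := by omega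
    simp [pathCount]
  | succ m ih =>
    intro h j hm
    cases h with
    | zero =>
      obtain ⟨j, rfl⟩ : ∃ i, j = i + 1 := ⟨j - 1, by omega⟩
      have h1 := ih 1 j (by omega)
      -- Here m = 2j + 1, so the two central coefficients agree. This is the reflection at height 0.
      have h2 : m.choose j = m.choose (j + 1) :=
        Nat.choose_symm_of_eq_add (by omega)
      rw [pathCount_zero_succ_zero, zero_add, Nat.choose_succ_succ', Nat.choose_succ_succ' m j]
      rw [show 1 + j = j + 1 by ring] at h1
      omega
    | succ h =>
      have h1 := ih h j (by omega)
      have h2 : pathCount 0 m (h + 2) + m.choose (h + j + 2) = m.choose (h + j + 1) := by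
        rcases Nat.eq_zero_or_pos j with rfl | hj
        · rw [hlt _ _ (by omega), Nat.choose_eq_zero_of_lt (by omega),
            Nat.choose_eq_zero_of_lt (by omega)]
        · have := ih (h + 2) (j - 1) (by omega)
          rwa [show h + 2 + (j - 1) + 1 = h + j + 2 by omega,
            show h + 2 + (j - 1) = h + j + 1 by omega] at this
      rw [pathCount_zero_succ_succ, show h + 1 + j + 1 = h + j + 1 + 1 by ring,
        show h + 1 + j = h + j + 1 by ring, Nat.choose_succ_succ', Nat.choose_succ_succ' m (h + j)]
      change _ + (_ + m.choose (h + j + 2)) = _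
      omega

theorem pathCount_zero_even (k : ℕ) : pathCount 0 (2 * k) 0 = catalan k := by
  have h1 := pathCount_zero_add_choose (2 * k) 0 k (by omega)
  have h2 := Nat.choose_succ_right_eq (2 * k) k
  have h3 := succ_mul_catalan_eq_centralBinom k
  rw [Nat.centralBinom_eq_two_mul_choose] at h3
  rw [zero_add] at h1
  rw [show 2 * k - k = k by omega] at h2
  refine Nat.eq_of_mul_eq_mul_left (Nat.succ_pos k) ?_
  rw [Nat.succ_eq_add_one, h3]
  nlinarith

/-- Write D(m) for `pathCount 0 m 0`. For h = 0, inserting a two-colored level step at any of the m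
vertices of a Dyck path of length m - 1 gives 2m D(m - 1) paths. From these, 2D(m + 1) have the step
at height 0 and are forbidden, while D(m + 1) paths without level steps end at height 1. The heights
h + 1 are carried along to make the induction close. At m = 0 the truncated m - 1 is harmless
because of the factor m. -/
theorem pathCount_one (m : ℕ) :
    pathCount 1 m 0 + pathCount 0 (m + 1) 0 = 2 * (m * pathCount 0 (m - 1) 0) ∧
    ∀ h, pathCount 1 m (h + 1) + pathCount 0 (m + 1) (h + 1) =
      2 * (m * pathCount 0 (m - 1) (h + 1)) + 2 * pathCount 0 m h := by
  have s0 : ∀ m, pathCount 1 (m + 1) 0 = pathCount 1 m 1 := fun m => by simp [pathCount]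
  have s1 : ∀ m h, pathCount 1 (m + 1) (h + 1) =
      pathCount 1 m (h + 2) + pathCount 1 m h + 2 * pathCount 0 m (h + 1) :=
    fun m h => by simp [pathCount]
  have t0 : ∀ m, m * pathCount 0 (m - 1) 1 = m * pathCount 0 m 0 := by
    rintro (_ | m)
    · simp
    · rw [pathCount_zero_succ_zero, Nat.add_sub_cancel]
  have t1 : ∀ m h, m * pathCount 0 (m - 1) (h + 2) + m * pathCount 0 (m - 1) h =
      m * pathCount 0 m (h + 1) := by
    rintro (_ | m) h
    · simp
    · rw [pathCount_zero_succ_succ, Nat.add_sub_cancel, mul_add]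
  induction m with
  | zero =>
    constructor
    · simp [pathCount]
    · intro h
      rcases h with _ | h <;> simp [pathCount]
  | succ m ih =>
    obtain ⟨ih0, ih1⟩ := ih
    constructor
    · have h1 := ih1 0
      have h2 := t0 m
      rw [s0, pathCount_zero_succ_zero, Nat.add_sub_cancel, add_mul, one_mul]
      rw [zero_add] at h1
      omega
    · intro h
      have h1 := ih1 (h + 1)
      have h2 := t1 m h
      rw [s1, pathCount_zero_succ_succ, Nat.add_sub_cancel, add_mul, one_mul]
      rcases h with _ | h
      · rw [pathCount_zero_succ_zero m] at ih0 ⊢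
        norm_num at h1 h2 ⊢
        omega
      · have h3 := ih1 h
        have h4 := pathCount_zero_succ_succ m h
        simp only [add_assoc, Nat.reduceAdd] at *
        omega

/-- By the Catalan recursion, 2(2k + 1) C_k = (k + 2) C_{k+1}; subtracting C_{k+1} leaves k + 1
copies. -/
theorem pathCount_one_odd (k : ℕ) :
    pathCount 1 (2 * k + 1) 0 = (k + 1) * catalan (k + 1) := by
  have h1 := (pathCount_one (2 * k + 1)).1
  rw [show 2 * k + 1 + 1 = 2 * (k + 1) by ring, Nat.add_sub_cancel, pathCount_zero_even,
    pathCount_zero_even] at h1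
  have h2 := succ_mul_catalan_eq_centralBinom k
  have h3 := succ_mul_catalan_eq_centralBinom (k + 1)
  have h4 := Nat.succ_mul_centralBinom_succ k
  have h5 : (k + 1 + 1) * catalan (k + 1) = 2 * (2 * k + 1) * catalan k := by
    refine Nat.eq_of_mul_eq_mul_left (Nat.succ_pos k) ?_
    rw [Nat.succ_eq_add_one, h3, h4, ← h2]
    ring
  nlinarith

end Counting

end GSpWeyl

namespace GSpWeyl

/-! ### Elements of maximal length -/

section MaximalLength

variable {g : ℕ} {σ : Equiv.Perm (Fin (2 * g))} {S : Finset (Fin (2 * g))}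

theorem pRank_decElt : pRank (decElt σ S) = fixedCount σ := by
  rw [pRank, fixedCount, Finset.card_filter]
  change (∑ i : Fin (2 * g), if i.val < g ∧ σ⁻¹ i = i then 1 else 0) = _
  simp_rw [inv_apply_eq_self_iff]

theorem sum_moved_add_fixedCount (σ : Equiv.Perm (Fin (2 * g))) :
    (∑ i : Fin (2 * g), if i.val < g ∧ σ i ≠ i then 1 else 0) + fixedCount σ = g := by
  conv_rhs => rw [← sum_half_one (g := g)]
  rw [fixedCount, ← Finset.sum_add_distrib]
  refine Finset.sum_congr rfl fun i _ => ?_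
  by_cases h1 : i.val < g <;> by_cases h2 : σ i = i <;> simp [h1, h2]

theorem ncard_noncrossingSet_eq (g e d : ℕ) :
    (noncrossingSet g e d).ncard = 2 ^ d * g.choose d * pathCount e (g - d) 0 := by
  rw [ncard_noncrossingSet, ncard_accept, acceptCount_eq]

variable [NeZero g]

theorem two_mul_length_decElt_add (h : IsDecorated σ S) :
    2 * length (decElt σ S) + (g - fixedCount σ) + excess σ S + 2 * upCrossings σ S =
      g * (g + 1) := by
  have h1 := two_mul_length_decElt h
  have h2 := sum_moved_add_fixedCount σ
  rw [excess]
  omega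

theorem mem_admRank_iff {d : ℕ} {x : GLExtAffineWeyl g} :
    x ∈ admRank g d ↔ ∃ σ S, IsDecorated σ S ∧ fixedCount σ = d ∧ x = decElt σ S := by
  rw [admRank, Set.mem_ofPred_eq, mem_adm_iff]
  constructor
  · rintro ⟨h1, h2⟩
    obtain ⟨σ, S, h, rfl⟩ := h1.exists_decorated
    exact ⟨σ, S, h, by rw [← h2, pRank_decElt], rfl⟩
  · rintro ⟨σ, S, h, h1, rfl⟩
    exact ⟨h.isPermissible, by rw [pRank_decElt, h1]⟩

/-- The elements of maximal length correspond to the noncrossing decorated permutations of minimal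
excess. -/
theorem maxLengthSet_eq {d : ℕ} (hne : (noncrossingSet g ((g - d) % 2) d).Nonempty) :
    maxLengthSet g d = (fun p => decElt p.1 p.2) '' noncrossingSet g ((g - d) % 2) d := by
  -- By this and the length formula the excess has the parity of g - d, so `(g - d) % 2` bounds it
  -- from below.
  have hpar : (g * (g + 1)) % 2 = 0 := Nat.even_iff.1 (Nat.even_mul_succ_self g)
  ext x
  constructor
  · rintro ⟨hx, hmax⟩
    obtain ⟨σ, S, h, hd, rfl⟩ := mem_admRank_iff.1 hx
    obtain ⟨⟨τ, R⟩, h', hc', hd', he'⟩ := hne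
    dsimp only at h' hc' hd' he'
    have h1 := hmax _ (mem_admRank_iff.2 ⟨τ, R, h', hd', rfl⟩)
    have h2 := two_mul_length_decElt_add h
    have h3 := two_mul_length_decElt_add h'
    rw [hd] at h2
    rw [hd'] at h3
    exact ⟨(σ, S), ⟨h, by dsimp only; omega, hd, by dsimp only; omega⟩, rfl⟩
  · rintro ⟨⟨τ, R⟩, ⟨h', hc', hd', he'⟩, rfl⟩
    dsimp only at h' hc' hd' he' ⊢
    refine ⟨mem_admRank_iff.2 ⟨τ, R, h', hd', rfl⟩, fun y hy => ?_⟩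
    obtain ⟨σ, S, h, hd, rfl⟩ := mem_admRank_iff.1 hy
    have h2 := two_mul_length_decElt_add h
    have h3 := two_mul_length_decElt_add h'
    rw [hd] at h2
    rw [hd'] at h3
    omega

/-- Positivity of the path count is what shows that the bound on the length is attained. -/
theorem ncard_maxLengthSet {d : ℕ} (hpos : 0 < pathCount ((g - d) % 2) (g - d) 0) (hd : d ≤ g) :
    (maxLengthSet g d).Finite ∧
      (maxLengthSet g d).ncard = 2 ^ d * g.choose d * pathCount ((g - d) % 2) (g - d) 0 := by
  have hne : (noncrossingSet g ((g - d) % 2) d).Nonempty := by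
    rw [← Set.ncard_pos, ncard_noncrossingSet_eq]
    have := Nat.choose_pos hd
    positivity
  rw [maxLengthSet_eq hne]
  refine ⟨(Set.toFinite _).image _, ?_⟩
  rw [Set.ncard_image_of_injective _ fun p q h => Prod.ext_iff.2 (decElt_injective h),
    ncard_noncrossingSet_eq]

end MaximalLength

theorem catalan_pos (n : ℕ) : 0 < catalan n := by
  have h1 := succ_mul_catalan_eq_centralBinom n
  have h2 := Nat.centralBinom_pos n
  rw [← h1] at h2
  exact Nat.pos_of_mul_pos_left h2

end GSpWeyl

theorem proposition3 (g d : ℕ) (hg : 0 < g) (hd : d ≤ g) :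
    (Even (g - d) →
      (GSpWeyl.maxLengthSet g d).Finite ∧
      (GSpWeyl.maxLengthSet g d).ncard = 2 ^ d * g.choose d * catalan ((g - d) / 2)) ∧
    (Odd (g - d) →
      (GSpWeyl.maxLengthSet g d).Finite ∧
      (GSpWeyl.maxLengthSet g d).ncard =
        2 ^ d * g.choose d * ((g - d + 1) / 2) * catalan ((g - d + 1) / 2)) := by
  have : NeZero g := ⟨hg.ne'⟩
  constructor
  · rintro ⟨k, hk⟩
    have h1 : GSpWeyl.pathCount ((g - d) % 2) (g - d) 0 = catalan ((g - d) / 2) := by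
      rw [hk, ← two_mul, Nat.mul_mod_right, GSpWeyl.pathCount_zero_even,
        Nat.mul_div_cancel_left k two_pos]
    have h2 := GSpWeyl.ncard_maxLengthSet (by rw [h1]; exact GSpWeyl.catalan_pos _) hd
    rwa [h1] at h2
  · rintro ⟨k, hk⟩
    have h1 : GSpWeyl.pathCount ((g - d) % 2) (g - d) 0 =
        (g - d + 1) / 2 * catalan ((g - d + 1) / 2) := by
      rw [hk, show (2 * k + 1) % 2 = 1 by omega, GSpWeyl.pathCount_one_odd,
        show (2 * k + 1 + 1) / 2 = k + 1 by omega]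
    have h2 := GSpWeyl.ncard_maxLengthSet (by
      rw [h1]
      exact Nat.mul_pos (by omega) (GSpWeyl.catalan_pos _)) hd
    rwa [h1, ← mul_assoc] at h2
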